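/- **Setting.** Let $S$ and $A\neq\emptyset$ be finite sets of states and actions, $t^{ij}_b=P(s^j\mid s^i,b)$ the true transition probabilities of an MDP, and $U\subseteq S$ the set of states that are observed and unsafe. For an array $q=(q^{ij}_b)$ put $\varrho_q^0(i,b)=\mathbb 1(i\in U)$ and, for $k\ge 0$, $\varrho_q^{k+1}(i,b)=1$ if $i\in U$ and $\varrho_q^{k+1}(i,b)=\sum_j q^{ij}_b\min_{c}\varrho_q^{k}(j,c)$ otherwise. A policy $\pi$ gives an action $\pi_k(i)$ for each state $i$ and each number $k$ of remaining steps; it is *safest for $q$* if $\pi_k(i)\in\arg\min_c\varrho_q^k(i,c)$ for all $k,i$. The risk polynomial $g_\pi^m(i,b)[\mathbf x]$ in variables $x^{ij}_b$ is given by $g^0_\pi(i,b)=\mathbb 1(i\in U)$ and $g_\pi^{k+1}(i,b)=1$ if $i\in U$, $g_\pi^{k+1}(i,b)=\sum_j x^{ij}_b\,g_\pi^{k}(j,\pi_k(j))$ otherwise. Thus $g_\pi^m(i,b)[q]=\varrho^m_q(i,b)$ if $\pi$ is safest for $q$. Fix a horizon $m$, a current state $s$ and an action $a$. The agent starts from independent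 priors $\mathrm{Dir}(\alpha^{i1}_b,\dots,\alpha^{iN}_b)$, all $\alpha^{ij}_b>0$, one for each state-action pair. The observed transitions are mutually independent, those from $(i,b)$ having law $t^{i\,\cdot}_b$. At stage $n$ the agent has seen exactly $n$ transitions from each pair $(i,b)$ such that $i\notin U$ is reachable from $s$ (by possible transitions out of states not in $U$), and an arbitrary deterministic number from each other pair. Let $\mathbf p^{(n)}$ have the resulting posterior law (independent Dirichlet rows, the counts being added to the $\alpha$'s), let $\bar{\mathbf p}^{(n)}$ be its mean, and for a polynomial $g$ let $$\bar V^{(n)}(g)=\sum_{i,b}\sum_{j,l}\frac{\partial g}{\partial x^{ij}_b}[\bar{\mathbf p}^{(n)}]\,\frac{\partial g}{\partial x^{il}_b}[\bar{\mathbf p}^{(n)}]\,\mathrm{Cov}\big(p^{ij\,(n)}_b,p^{il\,(n)}_b\big).$$ $\mathrm{Var}(g[\mathbf p^{(n)}])$ denotes the variance under the posterior, given the data. **Theorem 1.** (1) *(fixed policy)* For every policy $\pi$, with $g=g_\pi^m(s,a)$, almost surely $g[\bar{\mathbf p}^{(n)}]\to g[\mathbf t]$. If $\pi$ is safest for $\mathbf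 t$ and the true risk $g[\mathbf t]$ is neither $0$ nor $1$, then moreover almost surely $\mathrm{Var}(g[\mathbf p^{(n)}])/\bar V^{(n)}(g)\to 1$, and $$\frac{g[\bar{\mathbf p}^{(n)}]-g[\mathbf t]}{\sqrt{\bar V^{(n)}(g)}}\to\mathcal N(0,1)\quad\text{in distribution.}$$ (2) *(policy recomputed at each stage)* Let the agent use at stage $n$ a policy $\pi^{(n)}$ that is safest for $\bar{\mathbf p}^{(n)}$, ties being broken by any fixed rule depending on $\bar{\mathbf p}^{(n)}$. Put $g_n=g^m_{\pi^{(n)}}(s,a)$, $\bar\varrho_n=\varrho^m_{\bar{\mathbf p}^{(n)}}(s,a)=g_n[\bar{\mathbf p}^{(n)}]$ and $\rho_n=g_n[\mathbf t]$. Then almost surely $\bar\varrho_n$ and $\rho_n$ both converge to $\varrho^m_{\mathbf t}(s,a)$. If $\varrho^m_{\mathbf t}(s,a)\notin\{0,1\}$, then almost surely $\mathrm{Var}(g_n[\mathbf p^{(n)}])/\bar V^{(n)}(g_n)\to 1$. If, in addition, for all $k<m$ and every $i\notin U$ reachable from $s$ (as above) the minimiser of $\varrho_{\mathbf t}^k(i,\cdot)$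 is unique unless its minimum is $0$ or $1$, then $$\frac{\bar\varrho_n-\rho_n}{\sqrt{\bar V^{(n)}(g_n)}}\to\mathcal N(0,1)\quad\text{in distribution.}$$ -/

import Mathlib

open MeasureTheory ProbabilityTheory Filter Topology

namespace CautiousRL

noncomputable section

/-- The array `t` of true transition probabilities, `t (i, a, j) = P(j | i, a)`, of a finite MDP
with transition kernel `P`. -/
def trueProb {S A : Type*} (P : S → A → PMF S) : S × A × S → ℝ :=
  fun x => (P x.1 x.2.1 x.2.2).toReal

open Classical in
/-- The `m`-step risk obtained from a transition array `q` by back-propagation, every action after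
the first one being the one of smallest back-propagated risk. `hazard` is the set of the states that
are observed and unsafe. All the values at a state of `hazard` are `1`, hence so is their minimum;
for horizon `0` the value is the indicator of `hazard`, whatever the action.
`estRisk hazard q m i a` for `q` the array of the posterior means is the agent's estimate of the
risk. -/
def estRisk {S A : Type*} [Fintype S] [Fintype A] [Nonempty A] (hazard : Set S)
    (q : S × A × S → ℝ) : ℕ → S → A → ℝ
  | 0, i, _ => if i ∈ hazard then 1 else 0
  | n + 1, i, a =>
      if i ∈ hazard then 1
      else ∑ j, q (i, a, j) *
        Finset.univ.inf' Finset.univ_nonempty (fun b => estRisk hazard q n j b)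

/-- `π k i`, the action taken in state `i` with `k` steps to go, is always one of smallest
`k`-step risk, the risks being computed from the transition array `q`. -/
def IsSafest {S A : Type*} [Fintype S] [Fintype A] [Nonempty A] (hazard : Set S)
    (q : S × A × S → ℝ) (π : ℕ → S → A) : Prop :=
  ∀ k i b, estRisk hazard q k i (π k i) ≤ estRisk hazard q k i b

open Classical in
/-- The polynomial `g^m(i, a)[x]` in the variables `x (i, a, j)`: the probability of entering
`hazard` within `m` steps if `a` is taken in `i` and the actions `π` are taken afterwards. -/
def riskPoly {S A : Type*} [Fintype S] (hazard : Set S) (π : ℕ → S → A) :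
    ℕ → S → A → MvPolynomial (S × A × S) ℝ
  | 0, i, _ => if i ∈ hazard then 1 else 0
  | n + 1, i, a =>
      if i ∈ hazard then 1
      else ∑ j, MvPolynomial.X (i, a, j) * riskPoly hazard π n j (π n j)

/-- With the safest actions for `q`, the polynomial evaluated at `q` is the back-propagated risk. -/
theorem eval_riskPoly_of_isSafest {S A : Type*} [Fintype S] [Fintype A] [Nonempty A]
    (hazard : Set S) (q : S × A × S → ℝ) (π : ℕ → S → A) (h : IsSafest hazard q π)
    (m : ℕ) (i : S) (a : A) :
    MvPolynomial.eval q (riskPoly hazard π m i a) = estRisk hazard q m i a := by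
  induction m generalizing i a with
  | zero => unfold riskPoly estRisk; split_ifs <;> simp
  | succ n ih =>
    unfold riskPoly estRisk
    split_ifs with hi
    · simp
    · rw [map_sum]
      refine Finset.sum_congr rfl fun j _ => ?_
      rw [map_mul, MvPolynomial.eval_X, ih]
      congr 1
      exact le_antisymm (Finset.le_inf' _ _ fun b _ => h n j b)
        (Finset.inf'_le _ (Finset.mem_univ _))

/-- The Dirichlet distribution with parameters `β`: the law of a vector of independent
`Gamma(β j, 1)` variables divided by their sum. -/
def dirichlet {ι : Type*} [Fintype ι] (β : ι → ℝ) : Measure (ι → ℝ) :=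
  (Measure.pi (fun j => gammaMeasure (β j) 1)).map (fun y j => y j / ∑ k, y k)

/-- The agent's belief about the whole transition array: independent Dirichlet vectors
`p (i, a, ·) ∼ Dir(β (i, a, ·))`, one for each state-action pair. -/
def belief {S A : Type*} [Fintype S] [Fintype A] (β : S × A × S → ℝ) :
    Measure (S × A × S → ℝ) :=
  (Measure.pi (fun c : S × A => dirichlet (fun j => β (c.1, c.2, j)))).map
    (fun y x => y (x.1, x.2.1) x.2.2)

/-- The array of the means of the belief. -/
def beliefMean {S A : Type*} [Fintype S] [Fintype A] (β : S × A × S → ℝ) : S × A × S → ℝ :=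
  fun x => ∫ p, p x ∂(belief β)

/-- The first-order approximation of the variance of `g[p]`, with `p` distributed as the belief with
parameters `β`. -/
def approxVar {S A : Type*} [Fintype S] [Fintype A] (g : MvPolynomial (S × A × S) ℝ)
    (β : S × A × S → ℝ) : ℝ :=
  ∑ i, ∑ b, ∑ j, ∑ l,
    MvPolynomial.eval (beliefMean β) (MvPolynomial.pderiv (i, b, j) g) *
    MvPolynomial.eval (beliefMean β) (MvPolynomial.pderiv (i, b, l) g) *
    cov[fun p => p (i, b, j), fun p => p (i, b, l); belief β]

/-- The parameters of the posterior: prior parameters plus transition counts. `Y k i b` is the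
result of the `k`-th transition (counted from `0`) from `(i, b)`, and `visits i b n` is the
number of transitions from `(i, b)` that have been seen at stage `n`. -/
def posterior {S A Ω : Type*} (α : S × A × S → ℝ) (Y : ℕ → S → A → Ω → S)
    (visits : S → A → ℕ → ℕ) (n : ℕ) (ω : Ω) : S × A × S → ℝ :=
  fun x => α x + ∑ k ∈ Finset.range (visits x.1 x.2.1 n),
    Set.indicator {ω' | Y k x.1 x.2.1 ω' = x.2.2} (fun _ => (1 : ℝ)) ω

/-- `i` can be reached from `s` by possible transitions, all of them out of states that are not
in `hazard`. -/
def Reachable {S A : Type*} (P : S → A → PMF S) (hazard : Set S) (s i : S) : Prop :=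
  Relation.ReflTransGen (fun j l => j ∉ hazard ∧ ∃ b, 0 < trueProb P (j, b, l)) s i

/-- At every reachable safe state, with fewer than `m` steps to go, the action of smallest true risk
is unique unless that smallest risk is `0` or `1`. -/
def NoRelevantTies {S A : Type*} [Fintype S] [Fintype A] [Nonempty A] (P : S → A → PMF S)
    (hazard : Set S) (s : S) (m : ℕ) : Prop :=
  ∀ k < m, ∀ i, Reachable P hazard s i → i ∉ hazard → ∀ b b',
    (∀ c, estRisk hazard (trueProb P) k i b ≤ estRisk hazard (trueProb P) k i c) →
    (∀ c, estRisk hazard (trueProb P) k i b' ≤ estRisk hazard (trueProb P) k i c) →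
    b = b' ∨ estRisk hazard (trueProb P) k i b = 0 ∨ estRisk hazard (trueProb P) k i b = 1

end

end CautiousRL

open CautiousRL

namespace CautiousRL

open scoped ENNReal

/-! Let R be the set of states reachable from s. It is closed under the possible transitions out of
safe states (`trueProb_isClosedUnder`), and only the rows at states of R outside `hazard` are
learnt. Almost surely only possible transitions are observed, so the posterior gives the transitions
out of R a mass of order 1/n (`exitMass`). The estimates of the error of linearisation therefore
have the form "quadratic in the distance between the learnt rows, plus exit mass", uniformly in the
policy (`exists_abs_riskRem_le`).

Variance: expand the risk about the posterior mean. The linear part has variance exactly `approxVar`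
(`belief_variance_linear`), and n times it tends to `asympVar`. The remainder has variance of order
1/n², because fourth central moments of Dirichlet coordinates are of that order. So the ratio tends
to 1 once `asympVar` is positive. Positivity is where safest policies matter. Their risk grows with
the number of remaining steps, and this allows a row and two of its successors to be chosen so that
the contributions of the various visits to the row to the difference of the two partial derivatives
all have the same sign and cannot cancel (`IsSafestOn.exists_riskGrad_lt`).

Normality: expand about the true array. On the learnt rows the posterior mean is within O(1/n) of
the empirical frequencies, so √n times the error is √n times a linear function of the frequencies,
up to a term tending to 0 in probability. The classical central limit theorem and Slutsky's lemma
conclude (`IsTransitionSample.tendstoInDistribution_policyRisk`).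

Recomputed policy: up to horizon m there are finitely many policies, and eventually only those
safest for the true array on R are used (`RowsTendsto.eventually_isSafestOn`). Almost sure limits
for fixed policies thus carry over (`tendsto_of_policies`). The central limit theorem needs more:
the linear terms of all these policies must agree. Where the risk is 0 or 1 its differential
vanishes along perturbations preserving row sums and supports, so ties there are harmless, and
elsewhere the minimiser is unique (`IsSafestOn.riskDiff_eq`). -/

/-! ### Gamma laws: scaling, exponential tilting, size-biasing. -/

theorem pi_withDensity {ι : Type*} [Fintype ι] {μ : ι → Measure ℝ}
    [∀ i, IsProbabilityMeasure (μ i)] {f : ι → ℝ → ℝ≥0∞} (hf : ∀ i, Measurable (f i))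
    [∀ i, SigmaFinite ((μ i).withDensity (f i))] :
    Measure.pi (fun i => (μ i).withDensity (f i)) =
      (Measure.pi μ).withDensity (fun y => ∏ i, f i (y i)) := by
  refine Measure.pi_eq fun s hs => ?_
  rw [withDensity_apply _ (MeasurableSet.univ_pi hs), ← lintegral_indicator
    (MeasurableSet.univ_pi hs)]
  have h1 : ∀ y : ι → ℝ, (Set.univ.pi s).indicator (fun y => ∏ i, f i (y i)) y =
      ∏ i, (s i).indicator (f i) (y i) := by
    intro y
    by_cases hy : y ∈ Set.univ.pi s
    · rw [Set.indicator_of_mem hy]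
      exact Finset.prod_congr rfl fun i _ => by
        rw [Set.indicator_of_mem (hy i (Set.mem_univ i))]
    · rw [Set.indicator_of_notMem hy]
      simp only [Set.mem_univ_pi, not_forall] at hy
      obtain ⟨i, hi⟩ := hy
      exact (Finset.prod_eq_zero (Finset.mem_univ i) (Set.indicator_of_notMem hi _)).symm
  simp_rw [h1]
  have hm : ∀ i, Measurable ((s i).indicator (f i)) := fun i => (hf i).indicator (hs i)
  have hind := iIndepFun_pi (μ := μ) (X := fun i => (s i).indicator (f i))
    (fun i => (hm i).aemeasurable)
  rw [lintegral_prod_eq_prod_lintegral_of_indepFun _ _ hind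
    (fun i => (hm i).comp (measurable_pi_apply i))]
  refine Finset.prod_congr rfl fun i _ => ?_
  rw [withDensity_apply _ (hs i), ← lintegral_indicator (hs i),
    ← (measurePreserving_eval μ i).lintegral_comp (hm i)]

theorem measurable_gammaPDF (b r : ℝ) : Measurable (gammaPDF b r) :=
  (measurable_gammaPDFReal b r).ennreal_ofReal

theorem gammaMeasure_map_mul {b r : ℝ} (hr : 0 < r) :
    (gammaMeasure b r).map (fun y => r * y) = gammaMeasure b 1 := by
  refine Measure.ext_of_lintegral _ fun F hF => ?_
  have hm : Measurable fun y : ℝ => r * y := measurable_const_mul r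
  rw [lintegral_map hF hm, gammaMeasure, gammaMeasure,
    lintegral_withDensity_eq_lintegral_mul _ (measurable_gammaPDF b r)
      (show Measurable fun y => F (r * y) from hF.comp hm),
    lintegral_withDensity_eq_lintegral_mul _ (measurable_gammaPDF b 1) hF]
  have hh : Measurable fun x => gammaPDF b r (x / r) * F x :=
    ((measurable_gammaPDF b r).comp (measurable_id.div_const r)).mul hF
  have h1 : ∫⁻ y, (gammaPDF b r * fun y => F (r * y)) y =
      ∫⁻ x, gammaPDF b r (x / r) * F x ∂(volume.map (fun y => r * y)) := by
    rw [lintegral_map hh hm]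
    refine lintegral_congr fun y => ?_
    simp only [Pi.mul_apply]
    rw [mul_div_cancel_left₀ _ hr.ne']
  rw [h1, Real.map_volume_mul_left hr.ne', lintegral_smul_measure, smul_eq_mul,
    ← lintegral_const_mul _ hh]
  refine lintegral_congr fun x => ?_
  simp only [Pi.mul_apply]
  rw [← mul_assoc]
  congr 1
  rcases lt_or_ge x 0 with hx | hx
  · rw [gammaPDF_of_neg hx, gammaPDF_of_neg (div_neg_of_neg_of_pos hx hr), mul_zero]
  · rw [gammaPDF_of_nonneg hx, gammaPDF_of_nonneg (div_nonneg hx hr.le),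
      ← ENNReal.ofReal_mul (abs_nonneg _), abs_of_pos (inv_pos.2 hr)]
    congr 1
    rw [mul_div_cancel₀ _ hr.ne', Real.div_rpow hx hr.le, Real.rpow_sub_one hr.ne', one_mul,
      Real.one_rpow]
    have := (Real.rpow_pos_of_pos hr b).ne'
    field_simp

/-- With `gammaMeasure_map_mul`, this describes the Gamma law of rate r in two ways, as a dilation
and as an exponential tilt of the law of rate 1. Equating the two gives `lintegral_gammas_tilt`. -/
theorem gammaMeasure_tilt {b r : ℝ} (hb : 0 < b) (_hr : 0 < r) :
    gammaMeasure b r =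
      (gammaMeasure b 1).withDensity
        (fun y => ENNReal.ofReal (r ^ b * Real.exp (-((r - 1) * y)))) := by
  rw [gammaMeasure, gammaMeasure, ← withDensity_mul _ (measurable_gammaPDF b 1) (by fun_prop)]
  congr 1
  ext y
  simp only [Pi.mul_apply]
  rcases lt_or_ge y 0 with hx | hx
  · rw [gammaPDF_of_neg hx, gammaPDF_of_neg hx, zero_mul]
  · have hG := Real.Gamma_pos_of_pos hb
    rw [gammaPDF_of_nonneg hx, gammaPDF_of_nonneg hx, ← ENNReal.ofReal_mul (by positivity)]
    congr 1
    have : Real.exp (-(r * y)) = Real.exp (-(1 * y)) * Real.exp (-((r - 1) * y)) := by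
      rw [← Real.exp_add]; congr 1; ring
    rw [this, Real.one_rpow]
    ring

theorem gammaMeasure_add_one {b : ℝ} (hb : 0 < b) :
    gammaMeasure (b + 1) 1 =
      (gammaMeasure b 1).withDensity (fun y => ENNReal.ofReal (y / b)) := by
  rw [gammaMeasure, gammaMeasure, ← withDensity_mul _ (measurable_gammaPDF b 1) (by fun_prop)]
  refine withDensity_congr_ae ?_
  -- The point 0 is discarded so that `y ^ (b - 1)` can be written as `y ^ b / y`.
  filter_upwards [Measure.ae_ne volume (0 : ℝ)] with y hy0
  simp only [Pi.mul_apply]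
  rcases lt_or_ge y 0 with hx | hx
  · rw [gammaPDF_of_neg hx, gammaPDF_of_neg hx, zero_mul]
  · have hG := Real.Gamma_pos_of_pos hb
    rw [gammaPDF_of_nonneg hx, gammaPDF_of_nonneg hx, ← ENNReal.ofReal_mul (by positivity)]
    congr 1
    have hy : 0 < y := lt_of_le_of_ne hx (Ne.symm hy0)
    rw [Real.Gamma_add_one hb.ne', Real.one_rpow, Real.one_rpow, add_sub_cancel_right,
      Real.rpow_sub_one hy.ne']
    field_simp

theorem gammaMeasure_ae_pos (b r : ℝ) : ∀ᵐ y ∂(gammaMeasure b r), 0 < y := by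
  rw [gammaMeasure, ae_withDensity_iff (measurable_gammaPDF b r)]
  filter_upwards [Measure.ae_ne volume (0 : ℝ)] with y hy0 h
  by_contra hy
  exact h (gammaPDF_of_neg (lt_of_le_of_ne (not_lt.1 hy) hy0))

section Gammas

variable {ι : Type*} [Fintype ι] {β : ι → ℝ}

omit [Fintype ι] in
theorem isProbabilityMeasure_gammas (hβ : ∀ j, 0 < β j) (j : ι) :
    IsProbabilityMeasure (gammaMeasure (β j) 1) :=
  isProbabilityMeasure_gammaMeasure (hβ j) one_pos

theorem gammas_ae_pos (hβ : ∀ j, 0 < β j) :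
    ∀ᵐ y ∂(Measure.pi (fun j => gammaMeasure (β j) 1)), ∀ j, 0 < y j := by
  have := isProbabilityMeasure_gammas hβ
  exact ae_all_iff.2 fun j =>
    (measurePreserving_eval _ j).quasiMeasurePreserving.ae (gammaMeasure_ae_pos (β j) 1)

/-- Tilting independent Gamma variables by `exp (-(r - 1) * ∑ y)` amounts to dividing them
by `r`. -/
theorem lintegral_gammas_tilt (hβ : ∀ j, 0 < β j) {r : ℝ} (hr : 0 < r)
    {F : (ι → ℝ) → ℝ≥0∞} (hF : Measurable F) :
    ∫⁻ y, ENNReal.ofReal (r ^ (∑ j, β j) * Real.exp (-((r - 1) * ∑ j, y j))) *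
        F (fun j => r * y j) ∂(Measure.pi (fun j => gammaMeasure (β j) 1)) =
      ∫⁻ y, F y ∂(Measure.pi (fun j => gammaMeasure (β j) 1)) := by
  have h1 := isProbabilityMeasure_gammas hβ
  have h2 : ∀ j, IsProbabilityMeasure (gammaMeasure (β j) r) := fun j =>
    isProbabilityMeasure_gammaMeasure (hβ j) hr
  have hm : Measurable fun y : ι → ℝ => fun j => r * y j := by fun_prop
  have hmap : (Measure.pi (fun j => gammaMeasure (β j) r)).map (fun y j => r * y j) =
      Measure.pi (fun j => gammaMeasure (β j) 1) := by
    have h3 : ∀ j, SigmaFinite ((gammaMeasure (β j) r).map (fun y => r * y)) := fun j => by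
      rw [gammaMeasure_map_mul hr]; infer_instance
    rw [Measure.pi_map_pi (fun j => (measurable_const_mul r).aemeasurable)]
    simp_rw [gammaMeasure_map_mul hr]
  have hden : Measure.pi (fun j => gammaMeasure (β j) r) =
      (Measure.pi (fun j => gammaMeasure (β j) 1)).withDensity
        (fun y => ENNReal.ofReal (r ^ (∑ j, β j) * Real.exp (-((r - 1) * ∑ j, y j)))) := by
    have h3 : ∀ j, SigmaFinite ((gammaMeasure (β j) 1).withDensity
        (fun y => ENNReal.ofReal (r ^ (β j) * Real.exp (-((r - 1) * y))))) := fun j => by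
      rw [← gammaMeasure_tilt (hβ j) hr]; infer_instance
    have h4 : (fun j => gammaMeasure (β j) r) = fun j => (gammaMeasure (β j) 1).withDensity
        (fun y => ENNReal.ofReal (r ^ (β j) * Real.exp (-((r - 1) * y)))) :=
      funext fun j => gammaMeasure_tilt (hβ j) hr
    rw [h4, pi_withDensity (fun j => by fun_prop)]
    congr 1
    ext y
    rw [← ENNReal.ofReal_prod_of_nonneg (fun j _ => by positivity), Finset.prod_mul_distrib,
      ← Real.rpow_sum_of_pos hr, ← Real.exp_sum, Finset.mul_sum, ← Finset.sum_neg_distrib]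
  conv_rhs => rw [← hmap, lintegral_map hF hm, hden]
  rw [lintegral_withDensity_eq_lintegral_mul _ (by fun_prop)
    (show Measurable fun y : ι → ℝ => F (fun j => r * y j) from hF.comp hm)]
  rfl

theorem gammas_add_single [DecidableEq ι] (hβ : ∀ j, 0 < β j) (i : ι) :
    Measure.pi (fun j => gammaMeasure ((β + Pi.single i 1 : ι → ℝ) j) 1) =
      (Measure.pi (fun j => gammaMeasure (β j) 1)).withDensity
        (fun y => ENNReal.ofReal (y i / β i)) := by
  have h1 := isProbabilityMeasure_gammas hβ
  have h4 : ∀ j, gammaMeasure ((β + Pi.single i 1 : ι → ℝ) j) 1 =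
      (gammaMeasure (β j) 1).withDensity
        (fun y => if j = i then ENNReal.ofReal (y / β i) else 1) := fun j => by
    by_cases h : j = i
    · subst h
      simp [gammaMeasure_add_one (hβ j)]
    · simp only [Pi.add_apply, Pi.single_eq_of_ne h, add_zero, if_neg h]
      exact withDensity_one.symm
  have h2 : ∀ j, 0 < (β + Pi.single i 1 : ι → ℝ) j := fun j => by
    have : (0 : ℝ) ≤ (Pi.single i 1 : ι → ℝ) j := by
      by_cases h : j = i
      · subst h; simp
      · simp [h]
    simpa using add_pos_of_pos_of_nonneg (hβ j) this
  have h3 : ∀ j, SigmaFinite ((gammaMeasure (β j) 1).withDensity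
        (fun y => if j = i then ENNReal.ofReal (y / β i) else 1)) := fun j => by
    rw [← h4]
    have := isProbabilityMeasure_gammaMeasure (h2 j) one_pos
    infer_instance
  simp_rw [h4]
  rw [pi_withDensity (fun j => by split_ifs <;> fun_prop)]
  congr 1
  ext y
  simp

theorem lintegral_one_add_rpow {B : ℝ} (hB : 0 < B) :
    ∫⁻ u in Set.Ioi (0 : ℝ), ENNReal.ofReal ((1 + u) ^ (-(B + 1))) = ENNReal.ofReal (1 / B) := by
  have hd : ∀ u ∈ Set.Ici (0 : ℝ), HasDerivAt (fun u : ℝ => -(1 / B) * (1 + u) ^ (-B))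
      ((1 + u) ^ (-(B + 1))) u := by
    intro u hu
    have hu' : (0 : ℝ) < 1 + u := by have : (0 : ℝ) ≤ u := hu; linarith
    have := (((hasDerivAt_id u).const_add 1).rpow_const (p := -B) (Or.inl hu'.ne')).const_mul
      (-(1 / B))
    convert! this using 1
    have : -(B + 1) = -B - 1 := by ring
    simp only [id, this]
    field_simp
  have hlim : Tendsto (fun u : ℝ => -(1 / B) * (1 + u) ^ (-B)) atTop (𝓝 (-(1 / B) * 0)) :=
    ((tendsto_rpow_neg_atTop hB).comp (tendsto_atTop_add_const_left _ _ tendsto_id)).const_mul _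
  have hpos : ∀ u ∈ Set.Ioi (0 : ℝ), 0 ≤ (1 + u) ^ (-(B + 1)) := fun u hu =>
    Real.rpow_nonneg (by have : (0 : ℝ) < u := hu; linarith) _
  have hint := integrableOn_Ioi_deriv_of_nonneg' hd hpos hlim
  rw [← ofReal_integral_eq_lintegral_ofReal hint
    ((ae_restrict_iff' measurableSet_Ioi).2 (ae_of_all _ hpos)),
    integral_Ioi_of_hasDerivAt_of_nonneg' hd hpos hlim]
  simp

theorem lintegral_mul_exp_neg {s : ℝ} (hs : 0 < s) :
    ∫⁻ u in Set.Ioi (0 : ℝ), ENNReal.ofReal (s * Real.exp (-(u * s))) = 1 := by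
  have hd : ∀ u ∈ Set.Ici (0 : ℝ), HasDerivAt (fun u : ℝ => -Real.exp (-(u * s)))
      (s * Real.exp (-(u * s))) u := by
    intro u _
    have := (((hasDerivAt_id u).mul_const s).neg.exp).neg
    convert! this using 1
    simp; ring
  have hlim : Tendsto (fun u : ℝ => -Real.exp (-(u * s))) atTop (𝓝 (-0)) :=
    (Real.tendsto_exp_atBot.comp
      (tendsto_neg_atTop_atBot.comp (tendsto_id.atTop_mul_const hs))).neg
  have hpos : ∀ u ∈ Set.Ioi (0 : ℝ), 0 ≤ s * Real.exp (-(u * s)) := fun u _ => by positivity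
  have hint := integrableOn_Ioi_deriv_of_nonneg' hd hpos hlim
  rw [← ofReal_integral_eq_lintegral_ofReal hint
    ((ae_restrict_iff' measurableSet_Ioi).2 (ae_of_all _ hpos)),
    integral_Ioi_of_hasDerivAt_of_nonneg' hd hpos hlim]
  simp

/-- A function of the proportions of independent Gamma variables is uncorrelated with their
sum. -/
theorem lintegral_gammas_mul_sum [Nonempty ι] (hβ : ∀ j, 0 < β j)
    {H : (ι → ℝ) → ℝ≥0∞} (hH : Measurable H) (hom : ∀ r : ℝ, 0 < r → ∀ y, H (fun j => r * y j) = H y) :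
    ∫⁻ y, H y ∂(Measure.pi (fun j => gammaMeasure (β j) 1)) =
      (∫⁻ y, H y * ENNReal.ofReal (∑ j, y j) ∂(Measure.pi (fun j => gammaMeasure (β j) 1))) *
        ENNReal.ofReal (1 / ∑ j, β j) := by
  have h1 := isProbabilityMeasure_gammas hβ
  have hB : 0 < ∑ j, β j := Finset.sum_pos (fun j _ => hβ j) Finset.univ_nonempty
  set γ := Measure.pi (fun j => gammaMeasure (β j) 1) with hγ
  -- Inserting 1 = ∫ σ exp(-uσ) du, with σ the sum of the coordinates, produces an exponential tilt
  -- that the scale-invariant H does not feel. No change of variables to proportions and sum is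
  -- needed.
  calc ∫⁻ y, H y ∂γ
      = ∫⁻ y, (∫⁻ u in Set.Ioi (0 : ℝ),
          H y * ENNReal.ofReal ((∑ j, y j) * Real.exp (-(u * ∑ j, y j)))) ∂γ := by
        refine lintegral_congr_ae ?_
        filter_upwards [gammas_ae_pos hβ] with y hy
        rw [lintegral_const_mul _ (by fun_prop), lintegral_mul_exp_neg
          (Finset.sum_pos (fun j _ => hy j) Finset.univ_nonempty), mul_one]
    _ = ∫⁻ u in Set.Ioi (0 : ℝ), ∫⁻ y,
          H y * ENNReal.ofReal ((∑ j, y j) * Real.exp (-(u * ∑ j, y j))) ∂γ := by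
        refine lintegral_lintegral_swap (Measurable.aemeasurable ?_)
        exact (hH.comp measurable_fst).mul (by fun_prop)
    _ = ∫⁻ u in Set.Ioi (0 : ℝ), (∫⁻ y, H y * ENNReal.ofReal (∑ j, y j) ∂γ) *
          ENNReal.ofReal ((1 + u) ^ (-(∑ j, β j + 1))) := by
        refine setLIntegral_congr_fun measurableSet_Ioi fun u hu => ?_
        have hu' : (0 : ℝ) < 1 + u := by have : (0 : ℝ) < u := hu; linarith
        have hms : Measurable fun y => H y * ENNReal.ofReal (∑ j, y j) := hH.mul (by fun_prop)
        -- Tilting with r = 1 + u rescales y by r. The factor ∑ y contributes one more power of r,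
        -- whence the exponent -(∑ β + 1).
        have key := lintegral_gammas_tilt hβ hu' hms
        rw [← hγ] at key
        rw [← key, mul_comm, ← lintegral_const_mul _ (by
          refine Measurable.mul (by fun_prop) ?_
          exact hms.comp (by fun_prop))]
        refine lintegral_congr fun y => ?_
        rw [hom _ hu', ← Finset.mul_sum, add_sub_cancel_left,
          ENNReal.ofReal_mul hu'.le, ENNReal.ofReal_mul (Real.rpow_nonneg hu'.le _),
          ENNReal.ofReal_mul' (Real.exp_pos _).le]
        have hc : ENNReal.ofReal ((1 + u) ^ (-(∑ j, β j + 1))) *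
            ENNReal.ofReal ((1 + u) ^ (∑ j, β j)) * ENNReal.ofReal (1 + u) = 1 := by
          have hp : ∀ e : ℝ, 0 ≤ (1 + u) ^ e := fun e => Real.rpow_nonneg hu'.le e
          rw [← ENNReal.ofReal_mul (hp _), ← ENNReal.ofReal_mul (mul_nonneg (hp _) (hp _)),
            ← Real.rpow_add hu', ← Real.rpow_add_one hu'.ne']
          simp
        calc _ = 1 * (H y * (ENNReal.ofReal (∑ j, y j) *
              ENNReal.ofReal (Real.exp (-(u * ∑ j, y j))))) := by rw [one_mul]
          _ = _ := by rw [← hc]; ring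
    _ = _ := by
        rw [lintegral_const_mul _ (by fun_prop), lintegral_one_add_rpow hB]

end Gammas

/-! ### Moments of the Dirichlet law. -/

section Dirichlet

variable {ι : Type*} [Fintype ι] {β : ι → ℝ}

theorem measurable_normalize : Measurable fun (y : ι → ℝ) (j : ι) => y j / ∑ k, y k := by
  fun_prop

theorem isProbabilityMeasure_dirichlet (hβ : ∀ j, 0 < β j) :
    IsProbabilityMeasure (dirichlet β) := by
  have := isProbabilityMeasure_gammas hβ
  exact Measure.isProbabilityMeasure_map measurable_normalize.aemeasurable

theorem dirichlet_ae_simplex [Nonempty ι] (hβ : ∀ j, 0 < β j) :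
    ∀ᵐ p ∂(dirichlet β), (∀ j, 0 ≤ p j) ∧ ∑ j, p j = 1 := by
  rw [dirichlet, ae_map_iff measurable_normalize.aemeasurable]
  · filter_upwards [gammas_ae_pos hβ] with y hy
    have hs := Finset.sum_pos (fun j _ => hy j) (Finset.univ_nonempty (α := ι))
    refine ⟨fun j => div_nonneg (hy j).le hs.le, ?_⟩
    rw [← Finset.sum_div, div_self hs.ne']
  · have h : {p : ι → ℝ | (∀ j, 0 ≤ p j) ∧ ∑ j, p j = 1} =
        (⋂ j, {p | 0 ≤ p j}) ∩ {p | ∑ j, p j = 1} := by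
      ext p
      simp
    rw [h]
    exact (MeasurableSet.iInter fun j =>
      measurableSet_le measurable_const (measurable_pi_apply j)).inter
        (measurableSet_eq_fun (by fun_prop) measurable_const)

/-- Size-biasing a Dirichlet vector by a coordinate increments the corresponding parameter. -/
theorem dirichlet_withDensity [Nonempty ι] [DecidableEq ι] (hβ : ∀ j, 0 < β j) (i : ι) :
    (dirichlet β).withDensity (fun p => ENNReal.ofReal (p i)) =
      ENNReal.ofReal (β i / ∑ j, β j) • dirichlet (β + Pi.single i 1) := by
  have h1 := isProbabilityMeasure_gammas hβ
  have hB : 0 < ∑ j, β j := Finset.sum_pos (fun j _ => hβ j) Finset.univ_nonempty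
  refine Measure.ext_of_lintegral _ fun F hF => ?_
  have hFn : Measurable fun y : ι → ℝ => F (fun j => y j / ∑ k, y k) :=
    hF.comp measurable_normalize
  -- The function `p i * F` depends on the proportions only, so its mean may be taken with the extra
  -- weight ∑ y / ∑ β. The sum cancels the denominator of `p i`, and what is left is the
  -- size-biasing density of the i-th Gamma variable.
  rw [lintegral_withDensity_eq_lintegral_mul _ (by fun_prop) hF, lintegral_smul_measure,
    dirichlet, dirichlet, lintegral_map (by fun_prop) measurable_normalize,
    lintegral_map hF measurable_normalize, gammas_add_single hβ,
    lintegral_withDensity_eq_lintegral_mul _ (by fun_prop) hFn,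
    lintegral_gammas_mul_sum hβ
      (H := fun y => ((fun p : ι → ℝ => ENNReal.ofReal (p i)) * F) (fun j => y j / ∑ k, y k))
      (by
        refine Measurable.mul (by fun_prop) ?_
        exact hFn) ?_, mul_comm, smul_eq_mul]
  · rw [← lintegral_const_mul' _ _ ENNReal.ofReal_ne_top,
      ← lintegral_const_mul' _ _ ENNReal.ofReal_ne_top]
    refine lintegral_congr_ae ?_
    filter_upwards [gammas_ae_pos hβ] with y hy
    have hs := Finset.sum_pos (fun j _ => hy j) (Finset.univ_nonempty (α := ι))
    have hyi := hy i
    have hbi := hβ i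
    simp only [Pi.mul_apply]
    have : ENNReal.ofReal (1 / ∑ j, β j) * (ENNReal.ofReal (y i / ∑ k, y k) *
        ENNReal.ofReal (∑ j, y j)) = ENNReal.ofReal (β i / ∑ j, β j) *
          ENNReal.ofReal (y i / β i) := by
      rw [← ENNReal.ofReal_mul (by positivity), ← ENNReal.ofReal_mul (by positivity),
        ← ENNReal.ofReal_mul (by positivity)]
      congr 1
      field_simp
    rw [← mul_assoc (ENNReal.ofReal (β i / ∑ j, β j)), ← this]
    ring
  · intro r hr y
    have : (fun j => r * y j / ∑ k, r * y k) = fun j => y j / ∑ k, y k := by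
      ext j
      rw [← Finset.mul_sum, mul_div_mul_left _ _ hr.ne']
    simp only [this]

/-- The recursion behind all the moments below: a factor `p i` is traded for one unit of the i-th
parameter. -/
theorem integral_dirichlet_mul [Nonempty ι] [DecidableEq ι] (hβ : ∀ j, 0 < β j) (i : ι)
    (f : (ι → ℝ) → ℝ) :
    ∫ p, p i * f p ∂(dirichlet β) =
      β i / (∑ j, β j) * ∫ p, f p ∂(dirichlet (β + Pi.single i 1)) := by
  have hB : 0 < ∑ j, β j := Finset.sum_pos (fun j _ => hβ j) Finset.univ_nonempty
  have h := congrArg (fun ν => ∫ p, f p ∂ν) (dirichlet_withDensity hβ i)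
  simp only [integral_smul_measure] at h
  rw [integral_withDensity_eq_integral_toReal_smul (by fun_prop)
    (ae_of_all _ fun _ => ENNReal.ofReal_lt_top),
    ENNReal.toReal_ofReal (div_nonneg (hβ i).le hB.le), smul_eq_mul] at h
  rw [← h]
  refine integral_congr_ae ?_
  filter_upwards [dirichlet_ae_simplex hβ] with p hp
  rw [ENNReal.toReal_ofReal (hp.1 i), smul_eq_mul]

omit [Fintype ι] in
theorem add_single_pos [DecidableEq ι] (hβ : ∀ j, 0 < β j) (i j : ι) :
    0 < (β + Pi.single i 1 : ι → ℝ) j :=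
  add_pos_of_pos_of_nonneg (hβ j) (by
    by_cases h : j = i
    · subst h; simp
    · simp [h])

theorem sum_add_single [DecidableEq ι] (β : ι → ℝ) (i : ι) :
    ∑ j, (β + Pi.single i 1 : ι → ℝ) j = ∑ j, β j + 1 := by
  simp [Finset.sum_add_distrib]

theorem integral_dirichlet [Nonempty ι] (hβ : ∀ j, 0 < β j) (i : ι) :
    ∫ p, p i ∂(dirichlet β) = β i / ∑ j, β j := by
  classical
  have := isProbabilityMeasure_dirichlet (add_single_pos hβ i)
  simpa using integral_dirichlet_mul hβ i (fun _ => 1)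

theorem integral_dirichlet_mul_apply [Nonempty ι] [DecidableEq ι] (hβ : ∀ j, 0 < β j) (i l : ι) :
    ∫ p, p i * p l ∂(dirichlet β) =
      β i / (∑ j, β j) * ((β l + if l = i then 1 else 0) / (∑ j, β j + 1)) := by
  rw [integral_dirichlet_mul hβ i (fun p => p l), integral_dirichlet (add_single_pos hβ i),
    sum_add_single]
  simp [Pi.single_apply]

theorem integral_dirichlet_pow_succ [Nonempty ι] [DecidableEq ι] (hβ : ∀ j, 0 < β j) (i : ι)
    (k : ℕ) : ∫ p, p i ^ (k + 1) ∂(dirichlet β) =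
      β i / (∑ j, β j) * ∫ p, p i ^ k ∂(dirichlet (β + Pi.single i 1)) := by
  rw [← integral_dirichlet_mul hβ i]
  simp_rw [pow_succ']

theorem integral_dirichlet_pow_two [Nonempty ι] (hβ : ∀ j, 0 < β j) (i : ι) :
    ∫ p, p i ^ 2 ∂(dirichlet β) =
      β i / (∑ j, β j) * ((β i + 1) / (∑ j, β j + 1)) := by
  classical
  rw [integral_dirichlet_pow_succ hβ]
  simp_rw [pow_one]
  rw [integral_dirichlet (add_single_pos hβ i), sum_add_single]
  simp

theorem integral_dirichlet_pow_three [Nonempty ι] (hβ : ∀ j, 0 < β j) (i : ι) :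
    ∫ p, p i ^ 3 ∂(dirichlet β) =
      β i / (∑ j, β j) * ((β i + 1) / (∑ j, β j + 1) * ((β i + 2) / (∑ j, β j + 2))) := by
  classical
  rw [integral_dirichlet_pow_succ hβ, integral_dirichlet_pow_two (add_single_pos hβ i),
    sum_add_single]
  simp [add_assoc, one_add_one_eq_two]

theorem integral_dirichlet_pow_four [Nonempty ι] (hβ : ∀ j, 0 < β j) (i : ι) :
    ∫ p, p i ^ 4 ∂(dirichlet β) =
      β i / (∑ j, β j) * ((β i + 1) / (∑ j, β j + 1) * ((β i + 2) / (∑ j, β j + 2) *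
        ((β i + 3) / (∑ j, β j + 3)))) := by
  classical
  rw [integral_dirichlet_pow_succ hβ, integral_dirichlet_pow_three (add_single_pos hβ i),
    sum_add_single]
  norm_num [add_assoc]

theorem dirichlet_integrable_pow [Nonempty ι] (hβ : ∀ j, 0 < β j) (i : ι) (k : ℕ) :
    Integrable (fun p => p i ^ k) (dirichlet β) := by
  have := isProbabilityMeasure_dirichlet hβ
  refine Integrable.of_bound ((measurable_pi_apply i).pow_const k).aestronglyMeasurable 1 ?_
  filter_upwards [dirichlet_ae_simplex hβ] with p hp
  rw [Real.norm_eq_abs, abs_of_nonneg (pow_nonneg (hp.1 i) k)]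
  refine pow_le_one₀ (hp.1 i) ?_
  rw [← hp.2]
  exact Finset.single_le_sum (fun j _ => hp.1 j) (Finset.mem_univ i)

/-- The fourth central moment of a Dirichlet coordinate is of the order of the inverse square of
the total parameter. -/
theorem integral_dirichlet_central_four_le [Nonempty ι] (hβ : ∀ j, 0 < β j) (i : ι) :
    ∫ p, (p i - β i / ∑ j, β j) ^ 4 ∂(dirichlet β) ≤ 1 / (∑ j, β j) ^ 2 := by
  have := isProbabilityMeasure_dirichlet hβ
  have hI := dirichlet_integrable_pow hβ i
  have hB : 0 < ∑ j, β j := Finset.sum_pos (fun j _ => hβ j) Finset.univ_nonempty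
  have hle : β i ≤ ∑ j, β j := Finset.single_le_sum (fun j _ => (hβ j).le) (Finset.mem_univ i)
  have hb := hβ i
  set B := ∑ j, β j with hBdef
  set c := β i / B with hc
  have hexp : ∀ p : ι → ℝ, (p i - c) ^ 4 =
      p i ^ 4 + (-4 * c) * p i ^ 3 + (6 * c ^ 2) * p i ^ 2 + (-4 * c ^ 3) * p i ^ 1 + c ^ 4 :=
    fun p => by ring
  simp_rw [hexp]
  rw [integral_add, integral_add, integral_add, integral_add, integral_const_mul,
    integral_const_mul, integral_const_mul, integral_dirichlet_pow_four hβ,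
    integral_dirichlet_pow_three hβ, integral_dirichlet_pow_two hβ]
  · simp_rw [pow_one]
    rw [integral_dirichlet hβ, integral_const, ← hBdef]
    simp only [probReal_univ, one_smul]
    set b := β i
    have hd : 0 ≤ B - b := sub_nonneg.2 hle
    -- After this closed form, b(B - b) ≤ B²/4 reduces the claim to 3B³/16 + 3B²/2 ≤ (B + 1)(B +
    -- 2)(B + 3).
    have key : b / B * ((b + 1) / (B + 1) * ((b + 2) / (B + 2) * ((b + 3) / (B + 3)))) +
        -4 * c * (b / B * ((b + 1) / (B + 1) * ((b + 2) / (B + 2)))) +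
        6 * c ^ 2 * (b / B * ((b + 1) / (B + 1))) + -4 * c ^ 3 * (b / B) + c ^ 4 =
        3 * (b * (B - b)) * (b * (B - b) * (B - 6) + 2 * B ^ 2) /
          (B ^ 4 * ((B + 1) * (B + 2) * (B + 3))) := by
      rw [hc]
      field_simp
      ring
    rw [key, div_le_div_iff₀ (by positivity) (by positivity)]
    have h0 : 0 ≤ b * (B - b) := mul_nonneg hb.le hd
    have h1 : b * (B - b) ≤ B ^ 2 / 4 := by nlinarith [sq_nonneg (B - 2 * b)]
    have h2 : b * (B - b) * (B - 6) + 2 * B ^ 2 ≤ B ^ 3 / 4 + 2 * B ^ 2 := by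
      nlinarith
    have h3 : 3 * (b * (B - b)) * (b * (B - b) * (B - 6) + 2 * B ^ 2) ≤
        3 * (B ^ 2 / 4) * (B ^ 3 / 4 + 2 * B ^ 2) := by
      calc _ ≤ 3 * (b * (B - b)) * (B ^ 3 / 4 + 2 * B ^ 2) :=
            mul_le_mul_of_nonneg_left h2 (by positivity)
        _ ≤ _ := mul_le_mul_of_nonneg_right (by linarith) (by positivity)
    calc _ ≤ 3 * (B ^ 2 / 4) * (B ^ 3 / 4 + 2 * B ^ 2) * B ^ 2 :=
          mul_le_mul_of_nonneg_right h3 (by positivity)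
      _ = B ^ 4 * (3 / 16 * B ^ 3 + 3 / 2 * B ^ 2) := by ring
      _ ≤ B ^ 4 * (B ^ 3 + 6 * B ^ 2 + 11 * B + 6) :=
          mul_le_mul_of_nonneg_left (by nlinarith [pow_pos hB 2, pow_pos hB 3]) (by positivity)
      _ = _ := by ring
  all_goals first
    | exact (hI _).const_mul _
    | exact hI _
    | exact integrable_const _
    | fun_prop

end Dirichlet

/-! ### The belief: independent Dirichlet rows, means and covariances. -/

section Belief

variable {S A : Type*} [Fintype S]

/-- A transition array whose rows are probability vectors. -/
def IsStochastic (q : S × A × S → ℝ) : Prop :=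
  (∀ x, 0 ≤ q x) ∧ ∀ i b, ∑ j, q (i, b, j) = 1

theorem IsStochastic.le_one {q : S × A × S → ℝ} (hq : IsStochastic q) (x : S × A × S) :
    q x ≤ 1 := by
  rw [← hq.2 x.1 x.2.1]
  exact Finset.single_le_sum (f := fun j => q (x.1, x.2.1, j)) (fun j _ => hq.1 _)
    (Finset.mem_univ x.2.2)

variable [Fintype A] {β : S × A × S → ℝ}

omit [Fintype S] [Fintype A] in
theorem measurable_uncurry_rows :
    Measurable fun (y : S × A → S → ℝ) (x : S × A × S) => y (x.1, x.2.1) x.2.2 := by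
  fun_prop

theorem isProbabilityMeasure_belief (hβ : ∀ x, 0 < β x) : IsProbabilityMeasure (belief β) := by
  have : ∀ c : S × A, IsProbabilityMeasure (dirichlet (fun j => β (c.1, c.2, j))) := fun c =>
    isProbabilityMeasure_dirichlet fun j => hβ _
  exact Measure.isProbabilityMeasure_map measurable_uncurry_rows.aemeasurable

omit [Fintype S] [Fintype A] in
theorem measurable_row (i : S) (b : A) :
    Measurable fun (p : S × A × S → ℝ) (j : S) => p (i, b, j) := by
  fun_prop

theorem belief_map_row (hβ : ∀ x, 0 < β x) (i : S) (b : A) :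
    (belief β).map (fun p j => p (i, b, j)) = dirichlet (fun j => β (i, b, j)) := by
  have : ∀ c : S × A, IsProbabilityMeasure (dirichlet (fun j => β (c.1, c.2, j))) := fun c =>
    isProbabilityMeasure_dirichlet fun j => hβ _
  rw [belief, Measure.map_map (measurable_row i b) measurable_uncurry_rows]
  exact (measurePreserving_eval (fun c : S × A => dirichlet (fun j => β (c.1, c.2, j)))
    (i, b)).map_eq

theorem integral_belief_row (hβ : ∀ x, 0 < β x) (i : S) (b : A) {f : (S → ℝ) → ℝ}
    (hf : Measurable f) :
    ∫ p, f (fun j => p (i, b, j)) ∂(belief β) = ∫ p, f p ∂(dirichlet (fun j => β (i, b, j))) := by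
  rw [← belief_map_row hβ, integral_map (measurable_row i b).aemeasurable
    hf.aestronglyMeasurable]

theorem belief_ae_isStochastic (hβ : ∀ x, 0 < β x) : ∀ᵐ p ∂(belief β), IsStochastic p := by
  rcases isEmpty_or_nonempty S with hS | hS
  · exact ae_of_all _ fun p => ⟨fun x => (hS.false x.1).elim, fun i => (hS.false i).elim⟩
  have h : ∀ c : S × A, ∀ᵐ p ∂(belief β), (∀ j, 0 ≤ p (c.1, c.2, j)) ∧
      ∑ j, p (c.1, c.2, j) = 1 := fun c => by
    have := dirichlet_ae_simplex (β := fun j => β (c.1, c.2, j)) (fun j => hβ _)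
    rw [← belief_map_row hβ] at this
    exact ae_of_ae_map (measurable_row c.1 c.2).aemeasurable this
  filter_upwards [ae_all_iff.2 h] with p hp
  exact ⟨fun x => (hp (x.1, x.2.1)).1 x.2.2, fun i b => (hp (i, b)).2⟩

theorem belief_memLp (hβ : ∀ x, 0 < β x) (x : S × A × S) : MemLp (fun p => p x) 2 (belief β) := by
  have := isProbabilityMeasure_belief hβ
  refine MemLp.of_bound (measurable_pi_apply x).aestronglyMeasurable 1 ?_
  filter_upwards [belief_ae_isStochastic hβ] with p hp
  rw [Real.norm_eq_abs, abs_of_nonneg (hp.1 x)]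
  exact hp.le_one x

variable [Nonempty S]

theorem beliefMean_eq (hβ : ∀ x, 0 < β x) (i : S) (b : A) (j : S) :
    beliefMean β (i, b, j) = β (i, b, j) / ∑ l, β (i, b, l) := by
  rw [← integral_dirichlet (β := fun j => β (i, b, j)) (fun j => hβ _) j,
    ← integral_belief_row hβ i b (measurable_pi_apply j)]
  rfl

theorem isStochastic_beliefMean (hβ : ∀ x, 0 < β x) : IsStochastic (beliefMean β) := by
  refine ⟨fun x => ?_, fun i b => ?_⟩
  · rw [beliefMean_eq hβ x.1 x.2.1 x.2.2]
    exact div_nonneg (hβ _).le (Finset.sum_nonneg fun l _ => (hβ _).le)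
  · simp_rw [beliefMean_eq hβ]
    rw [← Finset.sum_div, div_self]
    exact (Finset.sum_pos (fun l _ => hβ _) Finset.univ_nonempty).ne'

open Classical in
theorem belief_covariance_row (hβ : ∀ x, 0 < β x) (i : S) (b : A) (j l : S) :
    cov[fun p => p (i, b, j), fun p => p (i, b, l); belief β] =
      ((if l = j then beliefMean β (i, b, j) else 0) -
        beliefMean β (i, b, j) * beliefMean β (i, b, l)) / (∑ k, β (i, b, k) + 1) := by
  have := isProbabilityMeasure_belief hβ
  have hB : 0 < ∑ k, β (i, b, k) := Finset.sum_pos (fun l _ => hβ _) Finset.univ_nonempty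
  have h2 := integral_dirichlet_mul_apply (β := fun j => β (i, b, j)) (fun j => hβ _) j l
  rw [covariance_eq_sub (belief_memLp hβ _) (belief_memLp hβ _)]
  change ∫ p, p (i, b, j) * p (i, b, l) ∂(belief β) -
    beliefMean β (i, b, j) * beliefMean β (i, b, l) = _
  rw [integral_belief_row hβ i b (f := fun p => p j * p l) (by fun_prop), h2, beliefMean_eq hβ,
    beliefMean_eq hβ]
  split_ifs with h
  · subst h
    field_simp
    ring
  · field_simp
    ring

omit [Nonempty S] in
theorem belief_covariance_of_ne (hβ : ∀ x, 0 < β x) {x y : S × A × S}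
    (h : (x.1, x.2.1) ≠ (y.1, y.2.1)) :
    cov[fun p => p x, fun p => p y; belief β] = 0 := by
  have : ∀ c : S × A, IsProbabilityMeasure (dirichlet (fun j => β (c.1, c.2, j))) := fun c =>
    isProbabilityMeasure_dirichlet fun j => hβ _
  have hx := belief_memLp hβ x
  have hy := belief_memLp hβ y
  rw [belief] at hx hy ⊢
  rw [covariance_map_fun (measurable_pi_apply x).aestronglyMeasurable
    (measurable_pi_apply y).aestronglyMeasurable measurable_uncurry_rows.aemeasurable]
  have hind := (iIndepFun_pi (μ := fun c : S × A => dirichlet (fun j => β (c.1, c.2, j)))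
    (X := fun _ y => y) (fun _ => aemeasurable_id)).indepFun h
  have hind2 := hind.comp (measurable_pi_apply x.2.2) (measurable_pi_apply y.2.2)
  refine IndepFun.covariance_eq_zero hind2 ?_ ?_
  · exact hx.comp_of_map measurable_uncurry_rows.aemeasurable
  · exact hy.comp_of_map measurable_uncurry_rows.aemeasurable

omit [Nonempty S] in
-- Distinct rows are independent, so only covariances within a row survive. With c the gradient of g
-- at the mean, the right-hand side is `approxVar`, which is thus the exact variance of the
-- linearisation.
theorem belief_variance_linear (hβ : ∀ x, 0 < β x) (c : S × A × S → ℝ) :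
    Var[fun p => ∑ x, c x * p x; belief β] =
      ∑ i, ∑ b, ∑ j, ∑ l, c (i, b, j) * c (i, b, l) *
        cov[fun p => p (i, b, j), fun p => p (i, b, l); belief β] := by
  classical
  have := isProbabilityMeasure_belief hβ
  have hm : ∀ x, MemLp (fun p : S × A × S → ℝ => c x * p x) 2 (belief β) := fun x =>
    (belief_memLp hβ x).const_mul _
  have hmeas : Measurable fun p : S × A × S → ℝ => ∑ x, c x * p x := by fun_prop
  rw [← covariance_self hmeas.aemeasurable, covariance_fun_sum_fun_sum hm hm]
  simp_rw [covariance_const_mul_left, covariance_const_mul_right, Fintype.sum_prod_type]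
  refine Finset.sum_congr rfl fun i _ => Finset.sum_congr rfl fun b _ =>
    Finset.sum_congr rfl fun j _ => ?_
  rw [Finset.sum_eq_single i, Finset.sum_eq_single b]
  · exact Finset.sum_congr rfl fun l _ => by ring
  · intro b' _ hb
    refine Finset.sum_eq_zero fun l _ => ?_
    rw [belief_covariance_of_ne hβ (by simpa using hb.symm)]
    simp
  · simp
  · intro i' _ hi
    refine Finset.sum_eq_zero fun b' _ => Finset.sum_eq_zero fun l _ => ?_
    rw [belief_covariance_of_ne hβ (by simp [hi.symm])]
    simp
  · simp

/-- The Dirichlet covariance is the covariance of a single draw from the mean row, divided by the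
total parameter plus one. Each row therefore contributes the variance of its partial derivatives
under the mean row; in this form signs and limits are visible. -/
theorem approxVar_eq (hβ : ∀ x, 0 < β x) (g : MvPolynomial (S × A × S) ℝ) :
    approxVar g β = ∑ i, ∑ b,
      (∑ j, beliefMean β (i, b, j) *
          MvPolynomial.eval (beliefMean β) (MvPolynomial.pderiv (i, b, j) g) ^ 2 -
        (∑ j, beliefMean β (i, b, j) *
          MvPolynomial.eval (beliefMean β) (MvPolynomial.pderiv (i, b, j) g)) ^ 2) /
        (∑ k, β (i, b, k) + 1) := by
  classical
  unfold approxVar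
  refine Finset.sum_congr rfl fun i _ => Finset.sum_congr rfl fun b _ => ?_
  simp_rw [belief_covariance_row hβ]
  set D := fun j => MvPolynomial.eval (beliefMean β) (MvPolynomial.pderiv (i, b, j) g) with hD
  change ∑ j, ∑ l, D j * D l * _ = (∑ j, _ * D j ^ 2 - (∑ j, _ * D j) ^ 2) / _
  rw [sq (∑ j, beliefMean β (i, b, j) * D j), Finset.sum_mul_sum, ← Finset.sum_sub_distrib,
    Finset.sum_div]
  refine Finset.sum_congr rfl fun j _ => ?_
  have h : beliefMean β (i, b, j) * D j ^ 2 =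
      ∑ l, if l = j then D j * D l * beliefMean β (i, b, j) else 0 := by
    simp; ring
  rw [h, ← Finset.sum_sub_distrib, Finset.sum_div]
  refine Finset.sum_congr rfl fun l _ => ?_
  split_ifs <;> ring

theorem belief_central_four_le (hβ : ∀ x, 0 < β x) (i : S) (b : A) (j : S) :
    ∫ p, (p (i, b, j) - beliefMean β (i, b, j)) ^ 4 ∂(belief β) ≤ 1 / (∑ l, β (i, b, l)) ^ 2 := by
  rw [integral_belief_row hβ i b (f := fun p => (p j - beliefMean β (i, b, j)) ^ 4)
    (by fun_prop), beliefMean_eq hβ]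
  exact integral_dirichlet_central_four_le (β := fun j => β (i, b, j)) (fun j => hβ _) j

theorem belief_integral_sq (hβ : ∀ x, 0 < β x) (i : S) (b : A) (j : S) :
    ∫ p, p (i, b, j) ^ 2 ∂(belief β) = β (i, b, j) / (∑ l, β (i, b, l)) *
      ((β (i, b, j) + 1) / (∑ l, β (i, b, l) + 1)) := by
  rw [integral_belief_row hβ i b (f := fun p => p j ^ 2) (by fun_prop)]
  exact integral_dirichlet_pow_two (β := fun j => β (i, b, j)) (fun j => hβ _) j

end Belief

noncomputable section

/-! ### Recursions for the risk, its gradient and its linearisation error. -/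

section Algebra

variable {S A : Type*} [Fintype S] (hazard : Set S) (π : ℕ → S → A)

/-- The `k`-step risk of the policy `π` after the action `b`, for the transition array `q`. -/
def policyRisk (q : S × A × S → ℝ) (k : ℕ) (i : S) (b : A) : ℝ :=
  MvPolynomial.eval q (riskPoly hazard π k i b)

/-- The partial derivatives of the `k`-step risk of the policy `π`. -/
def riskGrad (q : S × A × S → ℝ) (k : ℕ) (i : S) (b : A) (x : S × A × S) : ℝ :=
  MvPolynomial.eval q (MvPolynomial.pderiv x (riskPoly hazard π k i b))

/-- The differential at `q` of the `k`-step risk of the policy `π`, applied to `d`. -/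
def riskDiff [Fintype A] (q d : S × A × S → ℝ) (k : ℕ) (i : S) (b : A) : ℝ :=
  ∑ x, riskGrad hazard π q k i b x * d x

variable {hazard π} {q p d t : S × A × S → ℝ} {k : ℕ} {i : S} {b : A}

theorem policyRisk_of_mem (hi : i ∈ hazard) : policyRisk hazard π q k i b = 1 := by
  cases k <;> simp [policyRisk, riskPoly, hi]

theorem policyRisk_zero (hi : i ∉ hazard) : policyRisk hazard π q 0 i b = 0 := by
  simp [policyRisk, riskPoly, hi]

theorem policyRisk_succ (hi : i ∉ hazard) :
    policyRisk hazard π q (k + 1) i b = ∑ j, q (i, b, j) * policyRisk hazard π q k j (π k j) := by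
  simp [policyRisk, riskPoly, hi]

theorem riskGrad_of_mem (hi : i ∈ hazard) (x : S × A × S) :
    riskGrad hazard π q k i b x = 0 := by
  cases k <;> simp [riskGrad, riskPoly, hi]

theorem riskGrad_zero (x : S × A × S) : riskGrad hazard π q 0 i b x = 0 := by
  unfold riskGrad riskPoly
  split_ifs <;> simp

open Classical in
-- Leibniz rule: the first sum is the use of the variable x at the present step, the second its use
-- at later steps.
theorem riskGrad_succ (hi : i ∉ hazard) (x : S × A × S) :
    riskGrad hazard π q (k + 1) i b x =
      (∑ j, if (i, b, j) = x then policyRisk hazard π q k j (π k j) else 0) +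
        ∑ j, q (i, b, j) * riskGrad hazard π q k j (π k j) x := by
  simp only [riskGrad, riskPoly, hi, if_false, map_sum, Derivation.leibniz, map_add,
    smul_eq_mul, map_mul, MvPolynomial.eval_X, MvPolynomial.pderiv_X, Finset.sum_add_distrib]
  rw [add_comm]
  congr 1
  refine Finset.sum_congr rfl fun j _ => ?_
  by_cases h : (i, b, j) = x
  · subst h
    simp [policyRisk]
  · simp [h]

section Diff

variable [Fintype A]

theorem riskDiff_of_mem (hi : i ∈ hazard) : riskDiff hazard π q d k i b = 0 := by
  simp [riskDiff, riskGrad_of_mem hi]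

theorem riskDiff_zero : riskDiff hazard π q d 0 i b = 0 := by
  simp [riskDiff, riskGrad_zero]

theorem riskDiff_succ (hi : i ∉ hazard) :
    riskDiff hazard π q d (k + 1) i b =
      ∑ j, d (i, b, j) * policyRisk hazard π q k j (π k j) +
        ∑ j, q (i, b, j) * riskDiff hazard π q d k j (π k j) := by
  classical
  simp only [riskDiff, riskGrad_succ hi, add_mul, Finset.sum_add_distrib, Finset.sum_mul,
    Finset.mul_sum]
  congr 1
  · rw [Finset.sum_comm]
    refine Finset.sum_congr rfl fun j _ => ?_
    simp [mul_comm]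
  · rw [Finset.sum_comm]
    exact Finset.sum_congr rfl fun j _ => Finset.sum_congr rfl fun x _ => by ring

/-- The error of the first-order expansion of the risk at `q`. -/
def riskRem (hazard : Set S) (π : ℕ → S → A) (p q : S × A × S → ℝ) (k : ℕ) (i : S) (b : A) : ℝ :=
  policyRisk hazard π p k i b - policyRisk hazard π q k i b -
    riskDiff hazard π q (fun x => p x - q x) k i b

/-- Each step adds to the inherited error only products of two first-order differences; this is the
source of the quadratic bound. -/
theorem riskRem_succ (hi : i ∉ hazard) :
    riskRem hazard π p q (k + 1) i b =
      ∑ j, (p (i, b, j) - q (i, b, j)) *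
          (policyRisk hazard π p k j (π k j) - policyRisk hazard π q k j (π k j)) +
        ∑ j, q (i, b, j) * riskRem hazard π p q k j (π k j) := by
  simp only [riskRem, policyRisk_succ hi, riskDiff_succ hi]
  simp only [← Finset.sum_sub_distrib, ← Finset.sum_add_distrib]
  exact Finset.sum_congr rfl fun j _ => by ring

end Diff

theorem policyRisk_nonneg (hq : IsStochastic q) (k : ℕ) (i : S) (b : A) :
    0 ≤ policyRisk hazard π q k i b := by
  induction k generalizing i b with
  | zero =>
    by_cases hi : i ∈ hazard
    · simp [policyRisk_of_mem hi]
    · simp [policyRisk_zero hi]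
  | succ k ih =>
    by_cases hi : i ∈ hazard
    · simp [policyRisk_of_mem hi]
    · rw [policyRisk_succ hi]
      exact Finset.sum_nonneg fun j _ => mul_nonneg (hq.1 _) (ih _ _)

theorem policyRisk_le_one (hq : IsStochastic q) (k : ℕ) (i : S) (b : A) :
    policyRisk hazard π q k i b ≤ 1 := by
  induction k generalizing i b with
  | zero =>
    by_cases hi : i ∈ hazard
    · simp [policyRisk_of_mem hi]
    · simp [policyRisk_zero hi]
  | succ k ih =>
    by_cases hi : i ∈ hazard
    · simp [policyRisk_of_mem hi]
    · rw [policyRisk_succ hi, ← hq.2 i b]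
      exact Finset.sum_le_sum fun j _ => mul_le_of_le_one_right (hq.1 _) (ih _ _)

theorem abs_policyRisk_le (hq : IsStochastic q) (k : ℕ) (i : S) (b : A) :
    |policyRisk hazard π q k i b| ≤ 1 := by
  rw [abs_of_nonneg (policyRisk_nonneg hq k i b)]
  exact policyRisk_le_one hq k i b

theorem riskGrad_nonneg (hq : IsStochastic q) (k : ℕ) (i : S) (b : A) (x : S × A × S) :
    0 ≤ riskGrad hazard π q k i b x := by
  classical
  induction k generalizing i b with
  | zero => simp [riskGrad_zero]
  | succ k ih =>
    by_cases hi : i ∈ hazard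
    · simp [riskGrad_of_mem hi]
    · rw [riskGrad_succ hi]
      refine add_nonneg (Finset.sum_nonneg fun j _ => ?_)
        (Finset.sum_nonneg fun j _ => mul_nonneg (hq.1 _) (ih _ _))
      split_ifs
      · exact policyRisk_nonneg hq _ _ _
      · exact le_rfl

/-- The derivative sums, over the steps, the probability of using the row of x at that step times a
later risk, which is at most 1. -/
theorem riskGrad_le (hq : IsStochastic q) (k : ℕ) (i : S) (b : A) (x : S × A × S) :
    riskGrad hazard π q k i b x ≤ k := by
  classical
  induction k generalizing i b with
  | zero => simp [riskGrad_zero]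
  | succ k ih =>
    by_cases hi : i ∈ hazard
    · rw [riskGrad_of_mem hi]
      positivity
    · rw [riskGrad_succ hi]
      push_cast
      rw [add_comm]
      refine add_le_add ?_ ?_
      · calc _ ≤ ∑ j, q (i, b, j) * (k : ℝ) :=
              Finset.sum_le_sum fun j _ => mul_le_mul_of_nonneg_left (ih _ _) (hq.1 _)
          _ = k := by rw [← Finset.sum_mul, hq.2, one_mul]
      · calc _ ≤ ∑ j, if j = x.2.2 then (1 : ℝ) else 0 := by
              refine Finset.sum_le_sum fun j _ => ?_
              by_cases h : (i, b, j) = x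
              · subst h
                simpa using policyRisk_le_one hq _ _ _
              · rw [if_neg h]
                split_ifs <;> norm_num
          _ = 1 := by simp

theorem abs_riskGrad_le (hq : IsStochastic q) (k : ℕ) (i : S) (b : A) (x : S × A × S) :
    |riskGrad hazard π q k i b x| ≤ k := by
  rw [abs_of_nonneg (riskGrad_nonneg hq k i b x)]
  exact riskGrad_le hq k i b x

theorem IsStochastic.abs_sub_le_one (hp : IsStochastic p) (hq : IsStochastic q)
    (x : S × A × S) : |p x - q x| ≤ 1 :=
  abs_sub_le_iff.2 ⟨by linarith [hp.le_one x, hq.1 x], by linarith [hq.le_one x, hp.1 x]⟩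

theorem abs_policyRisk_sub_le_one (hp : IsStochastic p) (hq : IsStochastic q)
    (k : ℕ) (i : S) (b : A) :
    |policyRisk hazard π p k i b - policyRisk hazard π q k i b| ≤ 1 :=
  abs_sub_le_iff.2
    ⟨by linarith [policyRisk_le_one (hazard := hazard) (π := π) hp k i b,
        policyRisk_nonneg (hazard := hazard) (π := π) hq k i b],
      by linarith [policyRisk_le_one (hazard := hazard) (π := π) hq k i b,
        policyRisk_nonneg (hazard := hazard) (π := π) hp k i b]⟩

/-- A crude bound, for successors outside R, where no quadratic bound is available, and for
integrability. -/
theorem abs_riskRem_le [Fintype A] (hp : IsStochastic p) (hq : IsStochastic q)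
    (k : ℕ) (i : S) (b : A) :
    |riskRem hazard π p q k i b| ≤ 1 + k * Fintype.card (S × A × S) := by
  refine (abs_sub _ _).trans (add_le_add (abs_policyRisk_sub_le_one hp hq k i b) ?_)
  refine (Finset.abs_sum_le_sum_abs _ _).trans ?_
  calc _ ≤ ∑ _x : S × A × S, (k : ℝ) := by
        refine Finset.sum_le_sum fun x _ => ?_
        rw [abs_mul]
        exact (mul_le_mul (abs_riskGrad_le hq k i b x) (hp.abs_sub_le_one hq x) (abs_nonneg _)
          (Nat.cast_nonneg k)).trans_eq (mul_one _)
    _ = _ := by simp [mul_comm]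

open Classical in
theorem abs_sum_mul_le_of_set {w a : S → ℝ} (hw : ∀ j, 0 ≤ w j) (R : Set S) {M N : ℝ}
    (hM : ∀ j ∈ R, |a j| ≤ M) (hN : ∀ j, |a j| ≤ N) (hM0 : 0 ≤ M) :
    |∑ j, w j * a j| ≤ M * ∑ j, w j + N * ∑ j, if j ∈ R then 0 else w j := by
  refine (Finset.abs_sum_le_sum_abs _ _).trans ?_
  rw [Finset.mul_sum, Finset.mul_sum, ← Finset.sum_add_distrib]
  refine Finset.sum_le_sum fun j _ => ?_
  rw [abs_mul, abs_of_nonneg (hw j)]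
  split_ifs with h
  · nlinarith [hM j h, hw j]
  · nlinarith [hN j, hw j]

end Algebra

/-! ### Uniform linearisation error on a set of states with small exit mass. -/

section Remainder

variable {S A : Type*} [Fintype S] [Fintype A] (R hazard : Set S)

open Classical in
/-- The distance between the rows of `p` and `q` at the states of `R` outside `hazard`. -/
def rowDist (p q : S × A × S → ℝ) : ℝ :=
  ∑ x : S × A × S, if x.1 ∈ R ∧ x.1 ∉ hazard then |p x - q x| else 0

open Classical in
/-- The total mass of the transitions from states of `R` outside `hazard` to states out of `R`. -/
def exitMass (q : S × A × S → ℝ) : ℝ :=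
  ∑ x : S × A × S, if x.1 ∈ R ∧ x.1 ∉ hazard ∧ x.2.2 ∉ R then q x else 0

variable {R hazard} {π : ℕ → S → A} {p q : S × A × S → ℝ}

theorem rowDist_nonneg : 0 ≤ rowDist R hazard p q :=
  Finset.sum_nonneg fun x _ => by split_ifs <;> positivity

theorem exitMass_nonneg (hq : IsStochastic q) : 0 ≤ exitMass R hazard q :=
  Finset.sum_nonneg fun x _ => by
    split_ifs
    · exact hq.1 x
    · exact le_rfl

theorem sum_row_le_sum {f : S × A × S → ℝ} (hf : ∀ x, 0 ≤ f x) (i : S) (b : A) :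
    ∑ j, f (i, b, j) ≤ ∑ x, f x := by
  rw [Fintype.sum_prod_type]
  refine (Finset.single_le_sum (f := fun b => ∑ j, f (i, b, j))
    (fun b _ => Finset.sum_nonneg fun j _ => hf _) (Finset.mem_univ b)).trans ?_
  have : ∑ b, ∑ j, f (i, b, j) = (fun i => ∑ y : A × S, f (i, y)) i := by
    simp [Fintype.sum_prod_type]
  rw [this]
  exact Finset.single_le_sum (f := fun i => ∑ y : A × S, f (i, y))
    (fun i _ => Finset.sum_nonneg fun y _ => hf _) (Finset.mem_univ i)

theorem sum_abs_sub_le_rowDist {i : S} (hR : i ∈ R) (hi : i ∉ hazard) (b : A) :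
    ∑ j, |p (i, b, j) - q (i, b, j)| ≤ rowDist R hazard p q := by
  classical
  refine le_trans (le_of_eq ?_) (sum_row_le_sum
    (f := fun x => if x.1 ∈ R ∧ x.1 ∉ hazard then |p x - q x| else 0)
    (fun x => by split_ifs <;> positivity) i b)
  simp [hR, hi]

open Classical in
theorem sum_exit_le_exitMass (hq : IsStochastic q) {i : S} (hR : i ∈ R) (hi : i ∉ hazard)
    (b : A) : (∑ j, if j ∈ R then 0 else q (i, b, j)) ≤ exitMass R hazard q := by
  refine le_trans (le_of_eq ?_) (sum_row_le_sum
    (f := fun x => if x.1 ∈ R ∧ x.1 ∉ hazard ∧ x.2.2 ∉ R then q x else 0)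
    (fun x => by
      split_ifs
      · exact hq.1 x
      · exact le_rfl) i b)
  refine Finset.sum_congr rfl fun j _ => ?_
  by_cases h : j ∈ R <;> simp [hR, hi, h]

theorem rowDist_le_card (hp : IsStochastic p) (hq : IsStochastic q) :
    rowDist R hazard p q ≤ Fintype.card (S × A × S) := by
  calc rowDist R hazard p q ≤ ∑ _x : S × A × S, (1 : ℝ) :=
        Finset.sum_le_sum fun x _ => by
          split_ifs
          · exact hp.abs_sub_le_one hq x
          · exact zero_le_one
    _ = _ := by simp

/-- A weighted sum along a row of `q`, the summands being small at the states of `R`. -/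
theorem abs_sum_row_mul_le (hq : IsStochastic q) {i : S} (hR : i ∈ R) (hi : i ∉ hazard) (b : A)
    {a : S → ℝ} {M N : ℝ} (hM : ∀ j ∈ R, |a j| ≤ M) (hN : ∀ j, |a j| ≤ N) (hM0 : 0 ≤ M) :
    |∑ j, q (i, b, j) * a j| ≤ M + N * exitMass R hazard q := by
  classical
  have hN0 : 0 ≤ N := (abs_nonneg _).trans (hN i)
  refine (abs_sum_mul_le_of_set (fun j => hq.1 (i, b, j)) R hM hN hM0).trans ?_
  rw [hq.2, mul_one]
  have := mul_le_mul_of_nonneg_left (sum_exit_le_exitMass (hazard := hazard) hq hR hi b) hN0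
  linarith

/-- Each step costs one row distance, plus the mass of the exits from R, beyond which the difference
of two risks is only known to be at most 1. -/
theorem abs_policyRisk_sub_le (hp : IsStochastic p) (hq : IsStochastic q) (k : ℕ) {i : S}
    (hR : i ∈ R) (b : A) :
    |policyRisk hazard π p k i b - policyRisk hazard π q k i b| ≤
      k * (rowDist R hazard p q + exitMass R hazard q) := by
  have hD := rowDist_nonneg (R := R) (hazard := hazard) (p := p) (q := q)
  have hE := exitMass_nonneg (R := R) (hazard := hazard) hq
  induction k generalizing i b with
  | zero =>
    by_cases hi : i ∈ hazard
    · simp [policyRisk_of_mem hi]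
    · simp [policyRisk_zero hi]
  | succ k ih =>
    by_cases hi : i ∈ hazard
    · simp only [policyRisk_of_mem hi, sub_self, abs_zero]
      positivity
    · have h : policyRisk hazard π p (k + 1) i b - policyRisk hazard π q (k + 1) i b =
          ∑ j, (p (i, b, j) - q (i, b, j)) * policyRisk hazard π p k j (π k j) +
            ∑ j, q (i, b, j) *
              (policyRisk hazard π p k j (π k j) - policyRisk hazard π q k j (π k j)) := by
        rw [policyRisk_succ hi, policyRisk_succ hi, ← Finset.sum_sub_distrib,
          ← Finset.sum_add_distrib]
        exact Finset.sum_congr rfl fun j _ => by ring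
      have h1 : |∑ j, (p (i, b, j) - q (i, b, j)) * policyRisk hazard π p k j (π k j)| ≤
          rowDist R hazard p q := by
        refine (Finset.abs_sum_le_sum_abs _ _).trans
          (le_trans (Finset.sum_le_sum fun j _ => ?_) (sum_abs_sub_le_rowDist hR hi b))
        rw [abs_mul]
        exact mul_le_of_le_one_right (abs_nonneg _) (abs_policyRisk_le hp _ _ _)
      have h2 := abs_sum_row_mul_le (hazard := hazard) hq hR hi b
        (a := fun j => policyRisk hazard π p k j (π k j) - policyRisk hazard π q k j (π k j))
        (fun j hj => ih hj (π k j)) (fun j => abs_policyRisk_sub_le_one hp hq _ _ _)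
        (by positivity)
      rw [h]
      refine (abs_add_le _ _).trans ((add_le_add h1 h2).trans (le_of_eq ?_))
      push_cast
      ring

/-- Uniformly in the policy, the first-order expansion of the risk at a state of `R` has a
quadratic error in the rows of `R`, up to the mass of the transitions out of `R`. -/
theorem exists_abs_riskRem_le (R hazard : Set S) (k : ℕ) :
    ∃ C : ℝ, 0 ≤ C ∧ ∀ (π : ℕ → S → A) (p q : S × A × S → ℝ), IsStochastic p → IsStochastic q →
      ∀ i ∈ R, ∀ b, |riskRem hazard π p q k i b| ≤
        C * (rowDist R hazard p q ^ 2 + (exitMass R hazard p + exitMass R hazard q)) := by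
  classical
  induction k with
  | zero =>
    refine ⟨0, le_rfl, fun π p q hp hq i _ b => ?_⟩
    by_cases hi : i ∈ hazard
    · simp [riskRem, policyRisk_of_mem hi, riskDiff_of_mem hi]
    · simp [riskRem, policyRisk_zero hi, riskDiff_zero]
  | succ k ih =>
    obtain ⟨C, hC, ih⟩ := ih
    set N : ℝ := (Fintype.card (S × A × S) : ℝ) with hN
    have hN0 : 0 ≤ N := by positivity
    -- With D the row distance and E, F the exit masses of p and q, the recursion yields C(D² + E +
    -- F) + (1 + kN)F from the inherited errors and k(D + F)D + E + F from the products; moreover FD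
    -- ≤ NF.
    refine ⟨C + k + k * N + 2 + k * N, by positivity, fun π p q hp hq i hR b => ?_⟩
    have hD := rowDist_nonneg (R := R) (hazard := hazard) (p := p) (q := q)
    have hEp := exitMass_nonneg (R := R) (hazard := hazard) hp
    have hEq := exitMass_nonneg (R := R) (hazard := hazard) hq
    by_cases hi : i ∈ hazard
    · simp only [riskRem, policyRisk_of_mem hi, riskDiff_of_mem hi, sub_self, abs_zero]
      positivity
    · have h2 := abs_sum_row_mul_le (hazard := hazard) hq hR hi b
        (a := fun j => riskRem hazard π p q k j (π k j))
        (fun j hj => ih π p q hp hq j hj (π k j)) (fun j => abs_riskRem_le hp hq _ _ _)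
        (by positivity)
      -- At successors in R both factors are small. At the others the second is at most 1 and the
      -- first at most p + q, which sums to exit masses.
      have h1 : |∑ j, (p (i, b, j) - q (i, b, j)) *
          (policyRisk hazard π p k j (π k j) - policyRisk hazard π q k j (π k j))| ≤
          (k * (rowDist R hazard p q + exitMass R hazard q)) * rowDist R hazard p q +
            (exitMass R hazard p + exitMass R hazard q) := by
        have h3 := abs_sum_mul_le_of_set (w := fun j => |p (i, b, j) - q (i, b, j)|)
          (a := fun j =>
            |policyRisk hazard π p k j (π k j) - policyRisk hazard π q k j (π k j)|)
          (fun j => abs_nonneg _) R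
          (fun j hj => by
            rw [abs_abs]
            exact abs_policyRisk_sub_le hp hq k hj (π k j))
          (fun j => by
            rw [abs_abs]
            exact abs_policyRisk_sub_le_one hp hq k j (π k j)) (by positivity)
        refine (Finset.abs_sum_le_sum_abs _ _).trans ?_
        simp_rw [abs_mul]
        refine (le_abs_self _).trans (h3.trans (add_le_add ?_ ?_))
        · exact mul_le_mul_of_nonneg_left (sum_abs_sub_le_rowDist hR hi b) (by positivity)
        · rw [one_mul]
          refine le_trans ?_ (add_le_add (sum_exit_le_exitMass (hazard := hazard) hp hR hi b)
            (sum_exit_le_exitMass (hazard := hazard) hq hR hi b))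
          rw [← Finset.sum_add_distrib]
          refine Finset.sum_le_sum fun j _ => ?_
          split_ifs
          · simp
          · refine (abs_sub _ _).trans (le_of_eq ?_)
            rw [abs_of_nonneg (hp.1 _), abs_of_nonneg (hq.1 _)]
      rw [riskRem_succ hi]
      refine (abs_add_le _ _).trans ((add_le_add h1 h2).trans ?_)
      have hDN : rowDist R hazard p q ≤ N := rowDist_le_card hp hq
      set D := rowDist R hazard p q
      set E := exitMass R hazard p
      set F := exitMass R hazard q
      have e1 : k * F * D ≤ k * F * N := mul_le_mul_of_nonneg_left hDN (by positivity)
      have e2 : 0 ≤ k * N * E := by positivity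
      have e3 : 0 ≤ k * N * D ^ 2 := by positivity
      have e4 : 0 ≤ (k : ℝ) * E := by positivity
      have e5 : 0 ≤ (k : ℝ) * F := by positivity
      nlinarith [sq_nonneg D]

end Remainder

/-! ### Limits along arrays whose rows converge on R. -/

section Limits

variable {S A : Type*} [Fintype S] {R hazard : Set S} {π : ℕ → S → A}
  {q : ℕ → S × A × S → ℝ} {t : S × A × S → ℝ}

/-- No transition of `t` leads out of `R` from a state of `R` outside `hazard`. -/
def IsClosedUnder (R hazard : Set S) (t : S × A × S → ℝ) : Prop :=
  ∀ i ∈ R, i ∉ hazard → ∀ b j, t (i, b, j) ≠ 0 → j ∈ R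

/-- The arrays `q n` are stochastic and converge to `t` at the rows of `R` outside `hazard`. -/
structure RowsTendsto (R hazard : Set S) (q : ℕ → S × A × S → ℝ) (t : S × A × S → ℝ) : Prop where
  stochastic : ∀ n, IsStochastic (q n)
  tendsto : ∀ i ∈ R, i ∉ hazard → ∀ b j, Tendsto (fun n => q n (i, b, j)) atTop (𝓝 (t (i, b, j)))

/-- Where the limiting entry vanishes, boundedness of the other factor suffices, so nothing is
required at states that t cannot reach. -/
theorem RowsTendsto.mul_apply (hq : RowsTendsto R hazard q t) {i : S} (hR : i ∈ R)
    (hi : i ∉ hazard) (b : A) (j : S) {a : ℕ → ℝ} {a' M : ℝ} (hbd : ∀ n, |a n| ≤ M)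
    (ha : t (i, b, j) ≠ 0 → Tendsto a atTop (𝓝 a')) :
    Tendsto (fun n => q n (i, b, j) * a n) atTop (𝓝 (t (i, b, j) * a')) := by
  have h := hq.tendsto i hR hi b j
  by_cases ht : t (i, b, j) = 0
  · rw [ht] at h ⊢
    rw [zero_mul]
    refine squeeze_zero_norm (a := fun n => ‖q n (i, b, j)‖ * M) (fun n => ?_) ?_
    · rw [norm_mul]
      exact mul_le_mul_of_nonneg_left (hbd n) (norm_nonneg _)
    · simpa using h.norm.mul_const M
  · exact h.mul (ha ht)

theorem RowsTendsto.sum_row (hq : RowsTendsto R hazard q t) (ht : IsClosedUnder R hazard t)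
    {i : S} (hR : i ∈ R) (hi : i ∉ hazard) (b : A) {a : ℕ → S → ℝ} {a' : S → ℝ} {M : ℝ}
    (hbd : ∀ n j, |a n j| ≤ M) (ha : ∀ j ∈ R, Tendsto (fun n => a n j) atTop (𝓝 (a' j))) :
    Tendsto (fun n => ∑ j, q n (i, b, j) * a n j) atTop (𝓝 (∑ j, t (i, b, j) * a' j)) :=
  tendsto_finsetSum _ fun j _ => hq.mul_apply hR hi b j (fun n => hbd n j)
    fun h => ha j (ht i hR hi b j h)

theorem RowsTendsto.policyRisk (hq : RowsTendsto R hazard q t) (ht : IsClosedUnder R hazard t)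
    (k : ℕ) {i : S} (hR : i ∈ R) (b : A) :
    Tendsto (fun n => policyRisk hazard π (q n) k i b) atTop
      (𝓝 (CautiousRL.policyRisk hazard π t k i b)) := by
  induction k generalizing i b with
  | zero =>
    by_cases hi : i ∈ hazard
    · simp [policyRisk_of_mem hi]
    · simp [policyRisk_zero hi]
  | succ k ih =>
    by_cases hi : i ∈ hazard
    · simp [policyRisk_of_mem hi]
    · simp_rw [policyRisk_succ hi]
      exact hq.sum_row ht hR hi b (fun n j => abs_policyRisk_le (hq.stochastic n) _ _ _)
        fun j hj => ih hj _

/-- The derivative with respect to x involves the risk at the target `x.2.2`, which is only known to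
converge on R; hence `hx`. -/
theorem RowsTendsto.riskGrad (hq : RowsTendsto R hazard q t) (ht : IsClosedUnder R hazard t)
    (k : ℕ) {i : S} (hR : i ∈ R) (b : A) {x : S × A × S} (hx : x.2.2 ∈ R) :
    Tendsto (fun n => riskGrad hazard π (q n) k i b x) atTop
      (𝓝 (CautiousRL.riskGrad hazard π t k i b x)) := by
  classical
  induction k generalizing i b with
  | zero => simp [riskGrad_zero]
  | succ k ih =>
    by_cases hi : i ∈ hazard
    · simp [riskGrad_of_mem hi]
    · simp_rw [riskGrad_succ hi]
      refine Tendsto.add (tendsto_finsetSum _ fun j _ => ?_)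
        (hq.sum_row ht hR hi b (fun n j => abs_riskGrad_le (hq.stochastic n) _ _ _ _)
          fun j hj => ih hj _)
      split_ifs with h
      · subst h
        exact hq.policyRisk ht k hx _
      · exact tendsto_const_nhds

/-- At states of `hazard` the polynomial is constant, and rows outside R matter only to paths that
leave R. Each of the k steps leaves with at most the exit mass, and the derivative from there on is
at most k. -/
theorem riskGrad_le_exitMass [Fintype A] {q : S × A × S → ℝ} (hq : IsStochastic q)
    {x : S × A × S} (hx : ¬(x.1 ∈ R ∧ x.1 ∉ hazard)) (k : ℕ) {i : S} (hR : i ∈ R) (b : A) :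
    riskGrad hazard π q k i b x ≤ k * k * exitMass R hazard q := by
  classical
  have hE := exitMass_nonneg (R := R) (hazard := hazard) hq
  induction k generalizing i b with
  | zero => simp [riskGrad_zero]
  | succ k ih =>
    by_cases hi : i ∈ hazard
    · rw [riskGrad_of_mem hi]
      positivity
    · have h0 : (∑ j, if (i, b, j) = x then CautiousRL.policyRisk hazard π q k j (π k j)
          else 0) = 0 := by
        refine Finset.sum_eq_zero fun j _ => if_neg ?_
        rintro rfl
        exact hx ⟨hR, hi⟩
      rw [riskGrad_succ hi, h0, zero_add]
      refine (le_abs_self _).trans ((abs_sum_row_mul_le hq hR hi b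
        (a := fun j => CautiousRL.riskGrad hazard π q k j (π k j) x)
        (M := k * k * exitMass R hazard q) (fun j hj => ?_)
        (fun j => abs_riskGrad_le hq k j _ x) (by positivity)).trans ?_)
      · rw [abs_of_nonneg (riskGrad_nonneg hq _ _ _ _)]
        exact ih hj _
      · push_cast
        have hk : (0 : ℝ) ≤ k := Nat.cast_nonneg k
        nlinarith [mul_nonneg hk hE]

/-! ### Minimal risks, safest policies and nondegeneracy of the gradient. -/

variable [Fintype A] [Nonempty A]

theorem estRisk_of_mem {q : S × A × S → ℝ} {k : ℕ} {i : S} (hi : i ∈ hazard) (b : A) :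
    estRisk hazard q k i b = 1 := by
  cases k <;> simp [estRisk, hi]

theorem estRisk_zero {q : S × A × S → ℝ} {i : S} (hi : i ∉ hazard) (b : A) :
    estRisk hazard q 0 i b = 0 := by
  simp [estRisk, hi]

theorem estRisk_succ {q : S × A × S → ℝ} {k : ℕ} {i : S} (hi : i ∉ hazard) (b : A) :
    estRisk hazard q (k + 1) i b = ∑ j, q (i, b, j) *
      Finset.univ.inf' Finset.univ_nonempty (fun c => estRisk hazard q k j c) := by
  simp [estRisk, hi]

theorem estRisk_nonneg {q : S × A × S → ℝ} (hq : IsStochastic q) (k : ℕ) (i : S) (b : A) :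
    0 ≤ estRisk hazard q k i b := by
  induction k generalizing i b with
  | zero =>
    by_cases hi : i ∈ hazard
    · simp [estRisk_of_mem hi]
    · simp [estRisk_zero hi]
  | succ k ih =>
    by_cases hi : i ∈ hazard
    · simp [estRisk_of_mem hi]
    · rw [estRisk_succ hi]
      exact Finset.sum_nonneg fun j _ => mul_nonneg (hq.1 _)
        ((Finset.le_inf'_iff _ _).2 fun c _ => ih j c)

theorem estRisk_le_one {q : S × A × S → ℝ} (hq : IsStochastic q) (k : ℕ) (i : S) (b : A) :
    estRisk hazard q k i b ≤ 1 := by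
  induction k generalizing i b with
  | zero =>
    by_cases hi : i ∈ hazard
    · simp [estRisk_of_mem hi]
    · simp [estRisk_zero hi]
  | succ k ih =>
    by_cases hi : i ∈ hazard
    · simp [estRisk_of_mem hi]
    · rw [estRisk_succ hi, ← hq.2 i b]
      exact Finset.sum_le_sum fun j _ => mul_le_of_le_one_right (hq.1 _)
        ((Finset.inf'_le _ (Finset.mem_univ b)).trans (ih j b))

theorem estRisk_le_succ {q : S × A × S → ℝ} (hq : IsStochastic q) (k : ℕ) (i : S) (b : A) :
    estRisk hazard q k i b ≤ estRisk hazard q (k + 1) i b := by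
  induction k generalizing i b with
  | zero =>
    by_cases hi : i ∈ hazard
    · simp [estRisk_of_mem hi]
    · rw [estRisk_zero hi]
      exact estRisk_nonneg hq _ _ _
  | succ k ih =>
    by_cases hi : i ∈ hazard
    · simp [estRisk_of_mem hi]
    · rw [estRisk_succ hi, estRisk_succ hi]
      refine Finset.sum_le_sum fun j _ => mul_le_mul_of_nonneg_left ?_ (hq.1 _)
      exact Finset.le_inf' _ _ fun c hc => (Finset.inf'_le _ hc).trans (ih j c)

theorem RowsTendsto.estRisk (hq : RowsTendsto R hazard q t) (ht : IsClosedUnder R hazard t)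
    (k : ℕ) {i : S} (hR : i ∈ R) (b : A) :
    Tendsto (fun n => estRisk hazard (q n) k i b) atTop
      (𝓝 (CautiousRL.estRisk hazard t k i b)) := by
  induction k generalizing i b with
  | zero =>
    by_cases hi : i ∈ hazard
    · simp [estRisk_of_mem hi]
    · simp [estRisk_zero hi]
  | succ k ih =>
    by_cases hi : i ∈ hazard
    · simp [estRisk_of_mem hi]
    · simp_rw [estRisk_succ hi]
      refine hq.sum_row ht hR hi b (M := 1) (fun n j => ?_) fun j hj => ?_
      · rw [abs_of_nonneg ((Finset.le_inf'_iff _ _).2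
          fun c _ => estRisk_nonneg (hq.stochastic n) k j c)]
        exact (Finset.inf'_le _ (Finset.mem_univ b)).trans
          (estRisk_le_one (hq.stochastic n) k j b)
      · exact Tendsto.finset_inf'_nhds_apply _ fun c _ => ih hj c

/-- With fewer than `m` steps to go and at the states of `R`, the actions of `π` are safest for
`t`. -/
def IsSafestOn (R hazard : Set S) (t : S × A × S → ℝ) (m : ℕ) (π : ℕ → S → A) : Prop :=
  ∀ k < m, ∀ i ∈ R, ∀ b, CautiousRL.estRisk hazard t k i (π k i) ≤
    CautiousRL.estRisk hazard t k i b

theorem IsSafest.isSafestOn (h : IsSafest hazard t π) (R : Set S) (m : ℕ) :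
    IsSafestOn R hazard t m π :=
  fun k _ i _ b => h k i b

theorem IsSafestOn.policyRisk_eq {m : ℕ} (hπ : IsSafestOn R hazard t m π)
    (ht : IsClosedUnder R hazard t) {k : ℕ} (hk : k ≤ m) {i : S} (hR : i ∈ R) (b : A) :
    policyRisk hazard π t k i b = CautiousRL.estRisk hazard t k i b := by
  induction k generalizing i b with
  | zero =>
    by_cases hi : i ∈ hazard
    · simp [policyRisk_of_mem hi, estRisk_of_mem hi]
    · simp [policyRisk_zero hi, estRisk_zero hi]
  | succ k ih =>
    by_cases hi : i ∈ hazard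
    · simp [policyRisk_of_mem hi, estRisk_of_mem hi]
    · rw [policyRisk_succ hi, estRisk_succ hi]
      refine Finset.sum_congr rfl fun j _ => ?_
      by_cases hj : t (i, b, j) = 0
      · simp [hj]
      · have hjR := ht i hR hi b j hj
        rw [ih (by lia) hjR]
        congr 1
        exact le_antisymm (Finset.le_inf' _ _ fun c _ => hπ k (by lia) j hjR c)
          (Finset.inf'_le _ (Finset.mem_univ _))

/-- The risk of a safest policy is the minimal risk, which cannot decrease when steps are added.
Policies that vary with the number of remaining steps need not have this property. -/
theorem IsSafestOn.policyRisk_mono {m : ℕ} (hπ : IsSafestOn R hazard t m π)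
    (hs : IsStochastic t) (ht : IsClosedUnder R hazard t) {k l : ℕ} (hkl : k ≤ l) (hl : l < m)
    {j : S} (hR : j ∈ R) :
    policyRisk hazard π t k j (π k j) ≤ policyRisk hazard π t l j (π l j) := by
  induction l, hkl using Nat.le_induction with
  | base => exact le_rfl
  | succ l hkl ih =>
    refine (ih (by lia)).trans ?_
    rw [hπ.policyRisk_eq ht (by lia) hR, hπ.policyRisk_eq ht hl.le hR]
    exact (hπ l (by lia) j hR _).trans (estRisk_le_succ hs l j _)

/-- The safest policies with the same horizon eventually include those safest for arrays
converging to `t`. -/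
theorem RowsTendsto.eventually_isSafestOn (hq : RowsTendsto R hazard q t)
    (ht : IsClosedUnder R hazard t) (m : ℕ) {ϖ : ℕ → ℕ → S → A}
    (hϖ : ∀ n, IsSafest hazard (q n) (ϖ n)) :
    ∀ᶠ n in atTop, IsSafestOn R hazard t m (ϖ n) := by
  -- Finitely many strict inequalities between true risks persist in the limit, so an action that is
  -- not safest for t is eventually not safest for `q n`.
  have h : ∀ k : Fin m, ∀ i : S, ∀ b c : A, ∀ᶠ n in atTop, i ∈ R →
      CautiousRL.estRisk hazard t k i b < CautiousRL.estRisk hazard t k i c →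
      CautiousRL.estRisk hazard (q n) k i b < CautiousRL.estRisk hazard (q n) k i c := by
    intro k i b c
    by_cases hR : i ∈ R
    · by_cases hlt : CautiousRL.estRisk hazard t k i b < CautiousRL.estRisk hazard t k i c
      · filter_upwards [(hq.estRisk ht k hR b).eventually_lt (hq.estRisk ht k hR c) hlt]
          with n hn _ _ using hn
      · exact Eventually.of_forall fun n _ h => absurd h hlt
    · exact Eventually.of_forall fun n h => absurd h hR
  have h' := eventually_all.2 fun k => eventually_all.2 fun i => eventually_all.2 fun b =>
    eventually_all.2 fun c => h k i b c
  filter_upwards [h'] with n hn k hk i hR b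
  by_contra hlt
  exact absurd (hϖ n k i b) (not_le.2 (hn ⟨k, hk⟩ i b _ hR (not_le.1 hlt)))

omit [Fintype A] [Nonempty A] in
-- The partial derivatives at two targets of one row carry the same nonnegative weights, the
-- probabilities of using the row at each step. They differ only in the risks of the targets, which
-- `hle` compares at every horizon.
theorem riskGrad_mono {π : ℕ → S → A} (hs : IsStochastic t) (i' : S) (b' : A) {j₀ j₁ : S}
    {k : ℕ} (hle : ∀ l < k, policyRisk hazard π t l j₀ (π l j₀) ≤
      policyRisk hazard π t l j₁ (π l j₁)) (i : S) (b : A) :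
    CautiousRL.riskGrad hazard π t k i b (i', b', j₀) ≤
      CautiousRL.riskGrad hazard π t k i b (i', b', j₁) := by
  classical
  induction k generalizing i b with
  | zero => simp [riskGrad_zero]
  | succ k ih =>
    by_cases hi : i ∈ hazard
    · simp [riskGrad_of_mem hi]
    · rw [riskGrad_succ hi, riskGrad_succ hi]
      refine add_le_add ?_ (Finset.sum_le_sum fun l' _ => mul_le_mul_of_nonneg_left
        (ih (fun l hl => hle l (hl.trans k.lt_succ_self)) _ _) (hs.1 _))
      by_cases h : i = i' ∧ b = b'
      · obtain ⟨rfl, rfl⟩ := h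
        simpa using hle k (by lia)
      · have h0 : ∀ z z' : S, ¬((i, b, z) = (i', b', z')) := fun z z' hz => by
          simp only [Prod.mk.injEq] at hz
          exact h ⟨hz.1, hz.2.1⟩
        simp [h0]

/-- If the risk of a safest policy is neither `0` nor `1`, then some row of `R` has two possible
transitions at which the gradient of the risk differs. -/
theorem IsSafestOn.exists_riskGrad_lt {m : ℕ} (hπ : IsSafestOn R hazard t m π)
    (hs : IsStochastic t) (ht : IsClosedUnder R hazard t) {k : ℕ} (hk : k ≤ m) {i : S}
    (hR : i ∈ R) (b : A) (h0 : policyRisk hazard π t k i b ≠ 0)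
    (h1 : policyRisk hazard π t k i b ≠ 1) :
    ∃ i' ∈ R, i' ∉ hazard ∧ ∃ b' j₀ j₁, t (i', b', j₀) ≠ 0 ∧ t (i', b', j₁) ≠ 0 ∧
      (∀ l < m, policyRisk hazard π t l j₀ (π l j₀) ≤ policyRisk hazard π t l j₁ (π l j₁)) ∧
      CautiousRL.riskGrad hazard π t k i b (i', b', j₀) <
        CautiousRL.riskGrad hazard π t k i b (i', b', j₁) := by
  classical
  induction k generalizing i b with
  | zero =>
    by_cases hi : i ∈ hazard
    · exact absurd (policyRisk_of_mem hi) h1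
    · exact absurd (policyRisk_zero hi) h0
  | succ k ih =>
    have hi : i ∉ hazard := fun hi => h1 (policyRisk_of_mem hi)
    -- Follow possible successors as long as the risk stays strictly between 0 and 1.
    by_cases hex : ∃ j, t (i, b, j) ≠ 0 ∧ policyRisk hazard π t k j (π k j) ≠ 0 ∧
        policyRisk hazard π t k j (π k j) ≠ 1
    · obtain ⟨j, hj, hj0, hj1⟩ := hex
      obtain ⟨i', hi'R, hi', b', j₀, j₁, ht0, ht1, hle, hlt⟩ :=
        ih (by lia) (ht i hR hi b j hj) (π k j) hj0 hj1
      refine ⟨i', hi'R, hi', b', j₀, j₁, ht0, ht1, hle, ?_⟩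
      have hle' : ∀ l < k, policyRisk hazard π t l j₀ (π l j₀) ≤
          policyRisk hazard π t l j₁ (π l j₁) := fun l hl => hle l (by lia)
      -- The strict inequality at j enters with weight t(i, b, j) > 0. The comparison at all
      -- horizons keeps every other term in the same order, so nothing cancels it.
      rw [riskGrad_succ hi, riskGrad_succ hi]
      refine add_lt_add_of_le_of_lt ?_ (Finset.sum_lt_sum (fun j' _ =>
        mul_le_mul_of_nonneg_left (riskGrad_mono hs i' b' hle' _ _)
          (hs.1 _)) ⟨j, Finset.mem_univ j, mul_lt_mul_of_pos_left hlt
            (lt_of_le_of_ne (hs.1 _) (Ne.symm hj))⟩)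
      by_cases h : i = i' ∧ b = b'
      · obtain ⟨rfl, rfl⟩ := h
        simpa using hle k (by lia)
      · have h0 : ∀ z z' : S, ¬((i, b, z) = (i', b', z')) := fun z z' hz => by
          simp only [Prod.mk.injEq] at hz
          exact h ⟨hz.1, hz.2.1⟩
        simp [h0]
    -- Now every possible successor has risk 0 or 1, and both values occur, since the risk at (i, b)
    -- is neither.
    · push Not at hex
      rw [policyRisk_succ hi] at h0 h1
      have hj₁ : ∃ j₁, t (i, b, j₁) ≠ 0 ∧ policyRisk hazard π t k j₁ (π k j₁) = 1 := by
        by_contra hno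
        push Not at hno
        refine h0 (Finset.sum_eq_zero fun j _ => ?_)
        by_cases hj : t (i, b, j) = 0
        · simp [hj]
        · by_cases hz : policyRisk hazard π t k j (π k j) = 0
          · simp [hz]
          · exact absurd (hex j hj hz) (hno j hj)
      have hj₀ : ∃ j₀, t (i, b, j₀) ≠ 0 ∧ policyRisk hazard π t k j₀ (π k j₀) = 0 := by
        by_contra hno
        push Not at hno
        refine h1 ?_
        rw [← hs.2 i b]
        refine Finset.sum_congr rfl fun j _ => ?_
        by_cases hj : t (i, b, j) = 0
        · simp [hj]
        · rw [hex j hj (hno j hj), mul_one]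
      obtain ⟨j₁, ht1, hu1⟩ := hj₁
      obtain ⟨j₀, ht0, hu0⟩ := hj₀
      -- Monotonicity in the horizon spreads the comparison from k to all l: below k the risk of j₀
      -- is still 0, above k that of j₁ is still 1.
      have hle : ∀ l < m, policyRisk hazard π t l j₀ (π l j₀) ≤
          policyRisk hazard π t l j₁ (π l j₁) := by
        intro l hl
        rcases le_total l k with hlk | hlk
        · exact ((hπ.policyRisk_mono hs ht hlk (by lia) (ht i hR hi b j₀ ht0)).trans_eq
            hu0).trans (policyRisk_nonneg hs _ _ _)
        · exact (policyRisk_le_one hs _ _ _).trans (hu1.symm.trans_le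
            (hπ.policyRisk_mono hs ht hlk hl (ht i hR hi b j₁ ht1)))
      refine ⟨i, hR, hi, b, j₀, j₁, ht0, ht1, hle, ?_⟩
      have hle' : ∀ l < k, policyRisk hazard π t l j₀ (π l j₀) ≤
          policyRisk hazard π t l j₁ (π l j₁) := fun l hl => hle l (by lia)
      rw [riskGrad_succ hi, riskGrad_succ hi]
      refine add_lt_add_of_lt_of_le ?_ (Finset.sum_le_sum fun j' _ =>
        mul_le_mul_of_nonneg_left (riskGrad_mono hs i b hle' _ _)
          (hs.1 _))
      simp [hu0, hu1]

end Limits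

/-! ### The limiting variance and its positivity. -/

section AsymptoticVariance

variable {S A : Type*} [Fintype S] [Fintype A] {R hazard : Set S} {π : ℕ → S → A}
  {t : S × A × S → ℝ}

theorem sum_mul_sq_sub_sq {ι : Type*} [Fintype ι] {w D : ι → ℝ} (hw : ∑ j, w j = 1) :
    ∑ j, w j * D j ^ 2 - (∑ j, w j * D j) ^ 2 = ∑ j, w j * (D j - ∑ l, w l * D l) ^ 2 := by
  set c := ∑ l, w l * D l with hc
  have : ∀ j, w j * (D j - c) ^ 2 = w j * D j ^ 2 - 2 * c * (w j * D j) + c ^ 2 * w j :=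
    fun j => by ring
  simp_rw [this]
  rw [Finset.sum_add_distrib, Finset.sum_sub_distrib, ← Finset.mul_sum, ← Finset.mul_sum, hw,
    ← hc]
  ring

open Classical in
/-- The limit of `n` times the first-order approximation of the variance of the risk. -/
def asympVar (R hazard : Set S) (π : ℕ → S → A) (t : S × A × S → ℝ) (m : ℕ) (s : S) (a : A) :
    ℝ :=
  ∑ i, ∑ b, if i ∈ R ∧ i ∉ hazard then
    ∑ j, t (i, b, j) * riskGrad hazard π t m s a (i, b, j) ^ 2 -
      (∑ j, t (i, b, j) * riskGrad hazard π t m s a (i, b, j)) ^ 2 else 0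

/-- Each row contributes the variance of its partial derivatives under t, and some row has two
different values of positive probability, which cannot both equal their mean. -/
theorem IsSafestOn.asympVar_pos [Nonempty A] {m : ℕ} (hπ : IsSafestOn R hazard t m π)
    (hs : IsStochastic t) (ht : IsClosedUnder R hazard t) {s : S} (hR : s ∈ R) (a : A)
    (h0 : policyRisk hazard π t m s a ≠ 0) (h1 : policyRisk hazard π t m s a ≠ 1) :
    0 < asympVar R hazard π t m s a := by
  classical
  obtain ⟨i, hiR, hi, b, j₀, j₁, ht0, ht1, -, hlt⟩ :=
    hπ.exists_riskGrad_lt hs ht le_rfl hR a h0 h1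
  unfold asympVar
  have hterm : ∀ i b, 0 ≤ ∑ j, t (i, b, j) * riskGrad hazard π t m s a (i, b, j) ^ 2 -
      (∑ j, t (i, b, j) * riskGrad hazard π t m s a (i, b, j)) ^ 2 := fun i b => by
    rw [sum_mul_sq_sub_sq (hs.2 i b)]
    exact Finset.sum_nonneg fun j _ => mul_nonneg (hs.1 _) (sq_nonneg _)
  have hterm' : ∀ i b, (0 : ℝ) ≤ if i ∈ R ∧ i ∉ hazard then
      ∑ j, t (i, b, j) * riskGrad hazard π t m s a (i, b, j) ^ 2 -
        (∑ j, t (i, b, j) * riskGrad hazard π t m s a (i, b, j)) ^ 2 else 0 := fun i b => by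
    split_ifs
    · exact hterm i b
    · exact le_rfl
  refine Finset.sum_pos' (fun i _ => Finset.sum_nonneg fun b _ => hterm' i b)
    ⟨i, Finset.mem_univ i, Finset.sum_pos' (fun b _ => hterm' i b) ⟨b, Finset.mem_univ b, ?_⟩⟩
  rw [if_pos ⟨hiR, hi⟩, sum_mul_sq_sub_sq (hs.2 i b)]
  set c := ∑ l, t (i, b, l) * riskGrad hazard π t m s a (i, b, l)
  have hpos : ∀ j, t (i, b, j) ≠ 0 → riskGrad hazard π t m s a (i, b, j) ≠ c →
      0 < ∑ j, t (i, b, j) * (riskGrad hazard π t m s a (i, b, j) - c) ^ 2 := fun j hj hne =>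
    Finset.sum_pos' (fun j _ => mul_nonneg (hs.1 _) (sq_nonneg _)) ⟨j, Finset.mem_univ j,
      mul_pos (lt_of_le_of_ne (hs.1 _) (Ne.symm hj))
        (sq_pos_of_ne_zero (sub_ne_zero.2 hne))⟩
  by_cases h : riskGrad hazard π t m s a (i, b, j₀) = c
  · exact hpos j₁ ht1 (by rw [← h]; exact hlt.ne')
  · exact hpos j₀ ht0 h

end AsymptoticVariance

/-! ### Negligible summands in a variance. -/

section VarianceLimits

/-- Cauchy–Schwarz, from the discriminant of c ↦ Var(cX + Y). -/
theorem covariance_sq_le {Ω : Type*} [MeasurableSpace Ω] {μ : Measure Ω} [IsFiniteMeasure μ]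
    {X Y : Ω → ℝ} (hX : MemLp X 2 μ) (hY : MemLp Y 2 μ) :
    cov[X, Y; μ] ^ 2 ≤ Var[X; μ] * Var[Y; μ] := by
  have h : ∀ c : ℝ, 0 ≤ Var[X; μ] * (c * c) + 2 * cov[X, Y; μ] * c + Var[Y; μ] := fun c => by
    have h1 := variance_fun_add (hX.const_mul c) hY
    rw [variance_const_mul, covariance_const_mul_left] at h1
    have h2 := variance_nonneg (fun ω => c * X ω + Y ω) μ
    rw [h1] at h2
    linarith
  have := discrim_le_zero h
  rw [discrim] at this
  linarith

theorem tendsto_mul_variance_add {Ω : ℕ → Type*} [∀ n, MeasurableSpace (Ω n)]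
    {μ : (n : ℕ) → Measure (Ω n)} [∀ n, IsFiniteMeasure (μ n)] {X Y : (n : ℕ) → Ω n → ℝ}
    (hX : ∀ n, MemLp (X n) 2 (μ n)) (hY : ∀ n, MemLp (Y n) 2 (μ n)) {v : ℝ}
    (hXv : Tendsto (fun n : ℕ => n * Var[X n; μ n]) atTop (𝓝 v))
    (hYv : Tendsto (fun n : ℕ => n * Var[Y n; μ n]) atTop (𝓝 0)) :
    Tendsto (fun n : ℕ => n * Var[fun ω => X n ω + Y n ω; μ n]) atTop (𝓝 v) := by
  have hc : Tendsto (fun n : ℕ => n * cov[X n, Y n; μ n]) atTop (𝓝 0) := by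
    have h1 : Tendsto (fun n : ℕ => √((n * Var[X n; μ n]) * (n * Var[Y n; μ n]))) atTop
        (𝓝 0) := by
      have := (hXv.mul hYv).sqrt
      rwa [mul_zero, Real.sqrt_zero] at this
    refine squeeze_zero_norm (fun n => ?_) h1
    rw [Real.norm_eq_abs]
    refine Real.abs_le_sqrt ?_
    have := mul_le_mul_of_nonneg_left (covariance_sq_le (hX n) (hY n)) (sq_nonneg (n : ℝ))
    linarith
  have h := (hXv.add (hc.const_mul 2)).add hYv
  simp only [mul_zero, add_zero] at h
  refine h.congr fun n => ?_
  rw [variance_fun_add (hX n) (hY n)]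
  ring

end VarianceLimits

/-! ### Posterior variance of the risk of a fixed policy. -/

section BeliefSequence

variable {S A : Type*} [Fintype S] [Fintype A] [Nonempty S]

/-- A sequence of Dirichlet parameters whose means converge to `t` at the rows of `R` outside
`hazard`, `n` transitions being seen from each of these rows at stage `n`, and boundedly many of
them out of `R`. -/
structure BeliefSequence (R hazard : Set S) (β : ℕ → S × A × S → ℝ) (t : S × A × S → ℝ) :
    Prop where
  pos : ∀ n x, 0 < β n x
  total : ∃ c : S → A → ℝ, (∀ i b, 0 ≤ c i b) ∧
    ∀ i ∈ R, i ∉ hazard → ∀ b n, ∑ j, β n (i, b, j) = c i b + n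
  exit : ∃ K : ℝ, 0 ≤ K ∧ ∀ n i b j, i ∈ R → i ∉ hazard → j ∉ R → β n (i, b, j) ≤ K
  rows : RowsTendsto R hazard (fun n => beliefMean (β n)) t

variable {R hazard : Set S} {β : ℕ → S × A × S → ℝ} {t : S × A × S → ℝ}

namespace BeliefSequence

omit [Nonempty S] in
theorem le_sum (h : BeliefSequence R hazard β t) {i : S} (hR : i ∈ R) (hi : i ∉ hazard) (b : A)
    (n : ℕ) : (n : ℝ) ≤ ∑ j, β n (i, b, j) := by
  obtain ⟨c, hc, hsum⟩ := h.total
  rw [hsum i hR hi b n]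
  linarith [hc i b]

theorem exists_mul_exitMass_le (h : BeliefSequence R hazard β t) :
    ∃ K : ℝ, 0 ≤ K ∧ ∀ n : ℕ, n * exitMass R hazard (beliefMean (β n)) ≤ K := by
  classical
  obtain ⟨K, hK, hexit⟩ := h.exit
  refine ⟨∑ _x : S × A × S, K, by positivity, fun n => ?_⟩
  unfold exitMass
  rw [Finset.mul_sum]
  refine Finset.sum_le_sum fun x _ => ?_
  obtain ⟨i, b, j⟩ := x
  split_ifs with hx
  · have hB : 0 < ∑ l, β n (i, b, l) := Finset.sum_pos (fun l _ => h.pos n _) Finset.univ_nonempty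
    rw [beliefMean_eq (h.pos n), ← mul_div_assoc, div_le_iff₀ hB, mul_comm]
    exact mul_le_mul (hexit n i b j hx.1 hx.2.1 hx.2.2) (h.le_sum hx.1 hx.2.1 b n)
      (Nat.cast_nonneg n) hK
  · simpa using hK

omit [Nonempty S] in
theorem tendsto_div_sum (h : BeliefSequence R hazard β t) {i : S} (hR : i ∈ R) (hi : i ∉ hazard)
    (b : A) : Tendsto (fun n : ℕ => (n : ℝ) / (∑ j, β n (i, b, j) + 1)) atTop (𝓝 1) := by
  obtain ⟨c, hc, hsum⟩ := h.total
  simp_rw [hsum i hR hi b]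
  have := tendsto_natCast_div_add_atTop (𝕜 := ℝ) (c i b + 1)
  refine this.congr fun n => ?_
  congr 1
  ring

/-- On learnt rows n/(total + 1) tends to 1 and the rest converges. On the other rows the total need
not grow with n, but the gradient there is O(1/n) by `riskGrad_le_exitMass`, so its square beats the
factor n. -/
theorem tendsto_mul_approxVar (h : BeliefSequence R hazard β t) (ht : IsClosedUnder R hazard t)
    (π : ℕ → S → A) (m : ℕ) {s : S} (hs : s ∈ R) (a : A) :
    Tendsto (fun n : ℕ => n * approxVar (riskPoly hazard π m s a) (β n)) atTop
      (𝓝 (asympVar R hazard π t m s a)) := by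
  classical
  have hst := fun n => isStochastic_beliefMean (h.pos n)
  simp_rw [approxVar_eq (h.pos _), Finset.mul_sum]
  unfold asympVar
  refine tendsto_finsetSum _ fun i _ => tendsto_finsetSum _ fun b _ => ?_
  change Tendsto (fun n : ℕ => (n : ℝ) *
    ((∑ j, beliefMean (β n) (i, b, j) *
      riskGrad hazard π (beliefMean (β n)) m s a (i, b, j) ^ 2 -
      (∑ j, beliefMean (β n) (i, b, j) *
        riskGrad hazard π (beliefMean (β n)) m s a (i, b, j)) ^ 2) /
      (∑ k, β n (i, b, k) + 1))) _ _
  split_ifs with hi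
  · have h1 := fun j => h.rows.mul_apply hi.1 hi.2 b j
      (a := fun n => riskGrad hazard π (beliefMean (β n)) m s a (i, b, j)) (M := m)
      (fun n => abs_riskGrad_le (hst n) _ _ _ _)
      fun hj => h.rows.riskGrad ht m hs a (x := (i, b, j)) (ht i hi.1 hi.2 b j hj)
    have h2 := fun j => h.rows.mul_apply hi.1 hi.2 b j
      (a := fun n => riskGrad hazard π (beliefMean (β n)) m s a (i, b, j) ^ 2) (M := m ^ 2)
      (fun n => by
        rw [abs_pow]
        exact pow_le_pow_left₀ (abs_nonneg _) (abs_riskGrad_le (hst n) _ _ _ _) 2)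
      fun hj => (h.rows.riskGrad ht m hs a (x := (i, b, j)) (ht i hi.1 hi.2 b j hj)).pow 2
    have h3 := (tendsto_finsetSum Finset.univ fun j _ => h2 j).sub
      ((tendsto_finsetSum Finset.univ fun j _ => h1 j).pow 2)
    have h4 := (h.tendsto_div_sum hi.1 hi.2 b).mul h3
    rw [one_mul] at h4
    exact h4.congr fun n => by ring
  · obtain ⟨K, hK, hexit⟩ := h.exists_mul_exitMass_le
    have hlim : Tendsto (fun n : ℕ => (m * m) ^ 2 * K ^ 2 / (n : ℝ)) atTop (𝓝 0) :=
      tendsto_const_div_atTop_nhds_zero_nat _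
    refine squeeze_zero' (Eventually.of_forall fun n => ?_) ?_ hlim
    · rw [sum_mul_sq_sub_sq ((hst n).2 i b)]
      exact mul_nonneg (Nat.cast_nonneg n) (div_nonneg
        (Finset.sum_nonneg fun j _ => mul_nonneg ((hst n).1 _) (sq_nonneg _))
        (add_nonneg (Finset.sum_nonneg fun k _ => (h.pos n _).le) zero_le_one))
    · filter_upwards [eventually_gt_atTop 0] with n hn
      have hn' : (0 : ℝ) < n := Nat.cast_pos.2 hn
      have hB : 0 < ∑ k, β n (i, b, k) :=
        Finset.sum_pos (fun l _ => h.pos n _) Finset.univ_nonempty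
      set z := exitMass R hazard (beliefMean (β n)) with hz
      have hz0 : 0 ≤ z := exitMass_nonneg (hst n)
      have hsum : ∑ j, beliefMean (β n) (i, b, j) *
          riskGrad hazard π (beliefMean (β n)) m s a (i, b, j) ^ 2 ≤ (m * m * z) ^ 2 := by
        calc _ ≤ ∑ j, beliefMean (β n) (i, b, j) * (m * m * z) ^ 2 :=
              Finset.sum_le_sum fun j _ => mul_le_mul_of_nonneg_left
                (pow_le_pow_left₀ (riskGrad_nonneg (hst n) _ _ _ _)
                  (riskGrad_le_exitMass (hst n) hi m hs a) 2) ((hst n).1 _)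
          _ = _ := by rw [← Finset.sum_mul, (hst n).2, one_mul]
      calc _ ≤ n * (m * m * z) ^ 2 := by
            refine mul_le_mul_of_nonneg_left ?_ hn'.le
            rw [div_le_iff₀ (by linarith)]
            have h1 := sq_nonneg (∑ j, beliefMean (β n) (i, b, j) *
              riskGrad hazard π (beliefMean (β n)) m s a (i, b, j))
            nlinarith [sq_nonneg (m * m * z)]
        _ = (m * m) ^ 2 * (n * z) ^ 2 / n := by
            field_simp
        _ ≤ (m * m) ^ 2 * K ^ 2 / n := by
            have := pow_le_pow_left₀ (by positivity) (hexit n) 2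
            gcongr

omit [Nonempty S] in
/-- The square of the bound for the error of the first-order expansion, in terms of single
transition probabilities. -/
theorem _root_.CautiousRL.sq_rowDist_add_exitMass_le (R hazard : Set S) (p q : S × A × S → ℝ) :
    (rowDist R hazard p q ^ 2 + (exitMass R hazard p + exitMass R hazard q)) ^ 2 ≤
      3 * (Fintype.card (S × A × S) ^ 3 * (∑ x : S × A × S,
          (Set.indicator {y : S × A × S | y.1 ∈ R ∧ y.1 ∉ hazard} 1 x * (p x - q x) ^ 4)) +
        Fintype.card (S × A × S) * (∑ x : S × A × S,
          (Set.indicator {y : S × A × S | y.1 ∈ R ∧ y.1 ∉ hazard ∧ y.2.2 ∉ R} 1 x * p x ^ 2)) +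
        exitMass R hazard q ^ 2) := by
  classical
  have h3 : ∀ a b c : ℝ, (a + (b + c)) ^ 2 ≤ 3 * (a ^ 2 + b ^ 2 + c ^ 2) := fun a b c => by
    nlinarith [sq_nonneg (a - b), sq_nonneg (a - c), sq_nonneg (b - c)]
  set N : ℝ := (Fintype.card (S × A × S) : ℝ)
  have hE : exitMass R hazard p ^ 2 ≤ N * (∑ x : S × A × S,
      (Set.indicator {y : S × A × S | y.1 ∈ R ∧ y.1 ∉ hazard ∧ y.2.2 ∉ R} 1 x * p x ^ 2)) := by
    refine sq_sum_le_card_mul_sum_sq.trans (le_of_eq ?_)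
    rw [Finset.card_univ]
    congr 1
    refine Finset.sum_congr rfl fun x _ => ?_
    by_cases hx : x.1 ∈ R ∧ x.1 ∉ hazard ∧ x.2.2 ∉ R <;> simp [Set.indicator, hx]
  have hD : (rowDist R hazard p q ^ 2) ^ 2 ≤ N ^ 3 * (∑ x : S × A × S,
      (Set.indicator {y : S × A × S | y.1 ∈ R ∧ y.1 ∉ hazard} 1 x * (p x - q x) ^ 4)) := by
    have h1 : rowDist R hazard p q ^ 2 ≤ N * ∑ x : S × A × S,
        (Set.indicator {y : S × A × S | y.1 ∈ R ∧ y.1 ∉ hazard} 1 x * (p x - q x) ^ 2) := by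
      refine sq_sum_le_card_mul_sum_sq.trans (le_of_eq ?_)
      rw [Finset.card_univ]
      congr 1
      refine Finset.sum_congr rfl fun x _ => ?_
      by_cases hx : x.1 ∈ R ∧ x.1 ∉ hazard <;> simp [Set.indicator, hx]
    have h2 : (∑ x : S × A × S,
        (Set.indicator {y : S × A × S | y.1 ∈ R ∧ y.1 ∉ hazard} (1 : S × A × S → ℝ) x *
          (p x - q x) ^ 2)) ^ 2 ≤ N * ∑ x : S × A × S,
        (Set.indicator {y : S × A × S | y.1 ∈ R ∧ y.1 ∉ hazard} 1 x * (p x - q x) ^ 4) := by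
      refine sq_sum_le_card_mul_sum_sq.trans (le_of_eq ?_)
      rw [Finset.card_univ]
      congr 1
      refine Finset.sum_congr rfl fun x _ => ?_
      by_cases hx : x.1 ∈ R ∧ x.1 ∉ hazard
      · simp [Set.indicator, hx]; ring
      · simp [Set.indicator, hx]
    calc _ ≤ (N * ∑ x : S × A × S, (Set.indicator {y : S × A × S | y.1 ∈ R ∧ y.1 ∉ hazard} 1 x *
          (p x - q x) ^ 2)) ^ 2 := pow_le_pow_left₀ (sq_nonneg _) h1 2
      _ = N ^ 2 * (∑ x : S × A × S, (Set.indicator {y : S × A × S | y.1 ∈ R ∧ y.1 ∉ hazard} 1 x *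
          (p x - q x) ^ 2)) ^ 2 := by ring
      _ ≤ N ^ 2 * (N * _) := mul_le_mul_of_nonneg_left h2 (sq_nonneg N)
      _ = _ := by ring
  refine (h3 _ _ _).trans ?_
  linarith

omit [Nonempty S] in
theorem _root_.CautiousRL.belief_memLp_of_bound {β : S × A × S → ℝ} (hβ : ∀ x, 0 < β x)
    {f : (S × A × S → ℝ) → ℝ} (hf : Measurable f) {C : ℝ} (hC : ∀ p, IsStochastic p → |f p| ≤ C)
    (r : ENNReal) : MemLp f r (belief β) := by
  have := isProbabilityMeasure_belief hβ
  refine MemLp.of_bound hf.aestronglyMeasurable C ?_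
  filter_upwards [belief_ae_isStochastic hβ] with p hp using hC p hp

omit [Nonempty S] in
theorem measurable_policyRisk (π : ℕ → S → A) (k : ℕ) (i : S) (b : A) :
    Measurable fun p => policyRisk hazard π p k i b :=
  (MvPolynomial.continuous_eval _).measurable

omit [Nonempty S] in
theorem measurable_riskRem (π : ℕ → S → A) (q : S × A × S → ℝ) (k : ℕ) (i : S) (b : A) :
    Measurable fun p => riskRem hazard π p q k i b := by
  unfold riskRem riskDiff
  refine ((measurable_policyRisk π k i b).sub_const _).sub ?_
  fun_prop

/-- On learnt rows, fourth central moments are O(1/n²), and so are second moments of entries whose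
parameter stays bounded while the total is at least n, as for the exits from R. -/
theorem exists_sq_mul_integral_le (h : BeliefSequence R hazard β t) :
    ∃ K : ℝ, ∀ n : ℕ, n ^ 2 * ∫ p, (rowDist R hazard p (beliefMean (β n)) ^ 2 +
      (exitMass R hazard p + exitMass R hazard (beliefMean (β n)))) ^ 2 ∂(belief (β n)) ≤ K := by
  classical
  obtain ⟨K, hK, hexit⟩ := h.exit
  obtain ⟨K', hK', hexit'⟩ := h.exists_mul_exitMass_le
  set N : ℝ := (Fintype.card (S × A × S) : ℝ) with hN
  refine ⟨3 * (N ^ 3 * (N * 1) + N * (N * (K * (K + 1))) + K' ^ 2), fun n => ?_⟩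
  have hprob := isProbabilityMeasure_belief (h.pos n)
  have hst := isStochastic_beliefMean (h.pos n)
  set q := beliefMean (β n) with hq
  have hi4 : ∀ x, Integrable (fun p : S × A × S → ℝ => Set.indicator
      {y : S × A × S | y.1 ∈ R ∧ y.1 ∉ hazard} 1 x * (p x - q x) ^ 4) (belief (β n)) := fun x =>
    (memLp_one_iff_integrable.1 (belief_memLp_of_bound (h.pos n) (C := 1)
      (f := fun p => (p x - q x) ^ 4) (by fun_prop) (fun p hp => by
        rw [abs_pow]
        exact pow_le_one₀ (abs_nonneg _) (hp.abs_sub_le_one hst x)) 1)).const_mul _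
  have hi2 : ∀ x, Integrable (fun p : S × A × S → ℝ => Set.indicator
      {y : S × A × S | y.1 ∈ R ∧ y.1 ∉ hazard ∧ y.2.2 ∉ R} 1 x * p x ^ 2) (belief (β n)) :=
    fun x => (memLp_one_iff_integrable.1 (belief_memLp_of_bound (h.pos n) (C := 1)
      (f := fun p => p x ^ 2) (by fun_prop) (fun p hp => by
        rw [abs_pow, abs_of_nonneg (hp.1 x)]
        exact pow_le_one₀ (hp.1 x) (hp.le_one x)) 1)).const_mul _
  have hint1 := (integrable_finsetSum Finset.univ fun x _ => hi4 x).const_mul (N ^ 3)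
  have hint2 := (integrable_finsetSum Finset.univ fun x _ => hi2 x).const_mul N
  have hle : ∫ p, (rowDist R hazard p q ^ 2 + (exitMass R hazard p + exitMass R hazard q)) ^ 2
      ∂(belief (β n)) ≤ 3 * (N ^ 3 * (∑ x : S × A × S,
        Set.indicator {y : S × A × S | y.1 ∈ R ∧ y.1 ∉ hazard} 1 x *
          ∫ p, (p x - q x) ^ 4 ∂(belief (β n))) +
        N * (∑ x : S × A × S,
          Set.indicator {y : S × A × S | y.1 ∈ R ∧ y.1 ∉ hazard ∧ y.2.2 ∉ R} 1 x *
            ∫ p, p x ^ 2 ∂(belief (β n))) + exitMass R hazard q ^ 2) := by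
    refine (integral_mono_of_nonneg (ae_of_all _ fun p => sq_nonneg _)
      (((hint1.add hint2).add (integrable_const (exitMass R hazard q ^ 2))).const_mul 3)
      (ae_of_all _ fun p => sq_rowDist_add_exitMass_le R hazard p q)).trans (le_of_eq ?_)
    rw [integral_const_mul]
    congr 1
    rw [integral_add' (hint1.add hint2) (integrable_const _), integral_add' hint1 hint2,
      integral_const_mul, integral_const_mul, integral_finsetSum _ fun x _ => hi4 x,
      integral_finsetSum _ fun x _ => hi2 x]
    simp_rw [integral_const_mul]
    simp
  have hb4 : ∀ x : S × A × S, (n : ℝ) ^ 2 * (Set.indicator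
      {y : S × A × S | y.1 ∈ R ∧ y.1 ∉ hazard} 1 x * ∫ p, (p x - q x) ^ 4 ∂(belief (β n))) ≤
      1 := by
    rintro ⟨i, b, j⟩
    by_cases hi : i ∈ R ∧ i ∉ hazard
    · have hB : 0 < ∑ l, β n (i, b, l) :=
        Finset.sum_pos (fun l _ => h.pos n _) Finset.univ_nonempty
      have h1 := belief_central_four_le (h.pos n) i b j
      rw [le_div_iff₀ (by positivity)] at h1
      have h2 := pow_le_pow_left₀ (Nat.cast_nonneg n) (h.le_sum hi.1 hi.2 b n) 2
      have h0 : 0 ≤ ∫ p, (p (i, b, j) - q (i, b, j)) ^ 4 ∂(belief (β n)) :=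
        integral_nonneg fun p => by positivity
      simp only [Set.indicator, Set.mem_ofPred_eq, hi, not_false_eq_true, and_self, if_true,
        Pi.one_apply, one_mul]
      nlinarith
    · simp [Set.indicator, hi]
  have hb2 : ∀ x : S × A × S, (n : ℝ) ^ 2 * (Set.indicator
      {y : S × A × S | y.1 ∈ R ∧ y.1 ∉ hazard ∧ y.2.2 ∉ R} 1 x *
        ∫ p, p x ^ 2 ∂(belief (β n))) ≤ K * (K + 1) := by
    rintro ⟨i, b, j⟩
    by_cases hi : i ∈ R ∧ i ∉ hazard ∧ j ∉ R
    · have hB : 0 < ∑ l, β n (i, b, l) :=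
        Finset.sum_pos (fun l _ => h.pos n _) Finset.univ_nonempty
      have h1 := belief_integral_sq (h.pos n) i b j
      have h2 := h.le_sum hi.1 hi.2.1 b n
      have h3 := hexit n i b j hi.1 hi.2.1 hi.2.2
      have h4 := h.pos n (i, b, j)
      simp only [Set.indicator, Set.mem_ofPred_eq, hi, not_false_eq_true, and_self, if_true,
        Pi.one_apply, one_mul]
      rw [h1]
      set B := ∑ l, β n (i, b, l)
      have e1 : (n : ℝ) / B ≤ 1 := (div_le_one hB).2 h2
      have e2 : (n : ℝ) / (B + 1) ≤ 1 := (div_le_one (by linarith)).2 (by linarith)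
      calc (n : ℝ) ^ 2 * (β n (i, b, j) / B * ((β n (i, b, j) + 1) / (B + 1)))
          = (n / B) * (n / (B + 1)) * (β n (i, b, j) * (β n (i, b, j) + 1)) := by ring
        _ ≤ 1 * 1 * (K * (K + 1)) := by gcongr
        _ = _ := by ring
    · simp only [Set.indicator, Set.mem_ofPred_eq, hi, if_false, zero_mul, mul_zero]
      positivity
  have hs4 := Finset.sum_le_sum fun (x : S × A × S) (_ : x ∈ Finset.univ) => hb4 x
  have hs2 := Finset.sum_le_sum fun (x : S × A × S) (_ : x ∈ Finset.univ) => hb2 x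
  rw [← Finset.mul_sum, Finset.sum_const, Finset.card_univ, nsmul_eq_mul, ← hN] at hs4 hs2
  have hE : (n * exitMass R hazard q) ^ 2 ≤ K' ^ 2 :=
    pow_le_pow_left₀ (mul_nonneg (Nat.cast_nonneg n) (exitMass_nonneg hst)) (hexit' n) 2
  refine (mul_le_mul_of_nonneg_left hle (sq_nonneg (n : ℝ))).trans ?_
  have e4 := mul_le_mul_of_nonneg_left hs4 (show 0 ≤ N ^ 3 by positivity)
  have e2 := mul_le_mul_of_nonneg_left hs2 (show 0 ≤ N by positivity)
  linarith

/-- The risk is a constant plus its linear part at the posterior mean plus a remainder. The variance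
of the remainder is O(1/n²), so after multiplication by n only the linear part counts. -/
theorem tendsto_mul_variance (h : BeliefSequence R hazard β t) (ht : IsClosedUnder R hazard t)
    (π : ℕ → S → A) (m : ℕ) {s : S} (hs : s ∈ R) (a : A) :
    Tendsto (fun n : ℕ => n * Var[fun p => MvPolynomial.eval p (riskPoly hazard π m s a);
      belief (β n)]) atTop (𝓝 (asympVar R hazard π t m s a)) := by
  have hprob := fun n => isProbabilityMeasure_belief (h.pos n)
  have hst := fun n => isStochastic_beliefMean (h.pos n)
  set q := fun n => beliefMean (β n) with hq
  have hrem : ∀ n, MemLp (fun p => riskRem hazard π p (q n) m s a) 2 (belief (β n)) := fun n =>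
    belief_memLp_of_bound (h.pos n) (measurable_riskRem π _ m s a)
      (fun p hp => abs_riskRem_le hp (hst n) m s a) 2
  have hlin : ∀ n, MemLp (fun p : S × A × S → ℝ =>
      ∑ x, riskGrad hazard π (q n) m s a x * p x) 2 (belief (β n)) := fun n =>
    memLp_finsetSum _ fun x _ => (belief_memLp (h.pos n) x).const_mul _
  have hlinv : ∀ n, Var[fun p : S × A × S → ℝ =>
      ∑ x, riskGrad hazard π (q n) m s a x * p x; belief (β n)] =
        approxVar (riskPoly hazard π m s a) (β n) := fun n =>
    belief_variance_linear (h.pos n) _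
  have hremv : Tendsto (fun n : ℕ => n * Var[fun p => riskRem hazard π p (q n) m s a;
      belief (β n)]) atTop (𝓝 0) := by
    obtain ⟨C, hC, hbound⟩ := exists_abs_riskRem_le (A := A) R hazard m
    obtain ⟨K, hK⟩ := h.exists_sq_mul_integral_le
    refine squeeze_zero' (Eventually.of_forall fun n =>
      mul_nonneg (Nat.cast_nonneg n) (variance_nonneg _ _)) ?_
      (tendsto_const_div_atTop_nhds_zero_nat (C ^ 2 * K))
    filter_upwards [eventually_gt_atTop 0] with n hn
    have hn' : (0 : ℝ) < n := Nat.cast_pos.2 hn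
    have h1 : Var[fun p => riskRem hazard π p (q n) m s a; belief (β n)] ≤
        C ^ 2 * ∫ p, (rowDist R hazard p (q n) ^ 2 +
          (exitMass R hazard p + exitMass R hazard (q n))) ^ 2 ∂(belief (β n)) := by
      refine (variance_le_expectation_sq (hrem n).aestronglyMeasurable).trans ?_
      rw [← integral_const_mul]
      refine integral_mono_of_nonneg (ae_of_all _ fun p => sq_nonneg _) ?_ ?_
      · refine memLp_one_iff_integrable.1 (belief_memLp_of_bound (h.pos n)
          (C := C ^ 2 * (Fintype.card (S × A × S) ^ 2 + (Fintype.card (S × A × S) +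
            Fintype.card (S × A × S))) ^ 2) ?_ (fun p hp => ?_) 1)
        · unfold rowDist exitMass
          refine Measurable.const_mul (Measurable.pow_const (Measurable.add
            (Measurable.pow_const (Finset.measurable_fun_sum _ fun x _ => ?_) 2)
            (Measurable.add_const (Finset.measurable_fun_sum _ fun x _ => ?_) _)) 2) _
          · split_ifs <;> fun_prop
          · split_ifs <;> fun_prop
        · have hE : ∀ r : S × A × S → ℝ, IsStochastic r →
              exitMass R hazard r ≤ Fintype.card (S × A × S) := fun r hr => by
            calc _ ≤ ∑ _x : S × A × S, (1 : ℝ) := Finset.sum_le_sum fun x _ => by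
                  split_ifs
                  · exact hr.le_one x
                  · exact zero_le_one
              _ = _ := by simp
          have e1 := rowDist_le_card (R := R) (hazard := hazard) hp (hst n)
          have e2 := hE p hp
          have e3 := hE _ (hst n)
          have e4 := rowDist_nonneg (R := R) (hazard := hazard) (p := p) (q := q n)
          have e5 := exitMass_nonneg (R := R) (hazard := hazard) hp
          have e6 := exitMass_nonneg (R := R) (hazard := hazard) (hst n)
          rw [abs_of_nonneg (by positivity)]
          gcongr
      · filter_upwards [belief_ae_isStochastic (h.pos n)] with p hp
        have := pow_le_pow_left₀ (abs_nonneg _) (hbound π p (q n) hp (hst n) s hs a) 2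
        rwa [sq_abs, mul_pow] at this
    rw [le_div_iff₀ hn']
    calc _ = (n : ℝ) ^ 2 * Var[fun p => riskRem hazard π p (q n) m s a; belief (β n)] := by ring
      _ ≤ (n : ℝ) ^ 2 * _ := mul_le_mul_of_nonneg_left h1 (sq_nonneg _)
      _ ≤ C ^ 2 * K := by
        have := mul_le_mul_of_nonneg_left (hK n) (sq_nonneg C)
        linarith
  have hsum := tendsto_mul_variance_add hlin hrem
    (by simp_rw [hlinv]; exact h.tendsto_mul_approxVar ht π m hs a) hremv
  refine hsum.congr fun n => ?_
  congr 1
  -- The constant restored here is the risk at the mean minus the linear part there.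
  rw [← variance_add_const (X := fun p => ∑ x, riskGrad hazard π (q n) m s a x * p x +
    riskRem hazard π p (q n) m s a) ((hlin n).add (hrem n)).aestronglyMeasurable
    (policyRisk hazard π (q n) m s a - ∑ x, riskGrad hazard π (q n) m s a x * q n x)]
  congr 1
  ext p
  simp only [riskRem, riskDiff, mul_sub, Finset.sum_sub_distrib]
  change _ = policyRisk hazard π p m s a
  ring

theorem tendsto_variance_div_approxVar (h : BeliefSequence R hazard β t)
    (ht : IsClosedUnder R hazard t) (π : ℕ → S → A) (m : ℕ) {s : S} (hs : s ∈ R) (a : A)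
    (hpos : 0 < asympVar R hazard π t m s a) :
    Tendsto (fun n : ℕ => Var[fun p => MvPolynomial.eval p (riskPoly hazard π m s a);
      belief (β n)] / approxVar (riskPoly hazard π m s a) (β n)) atTop (𝓝 1) := by
  have := (h.tendsto_mul_variance ht π m hs a).div (h.tendsto_mul_approxVar ht π m hs a) hpos.ne'
  rw [div_self hpos.ne'] at this
  refine this.congr' ?_
  filter_upwards [eventually_gt_atTop 0] with n hn
  exact mul_div_mul_left _ _ (Nat.cast_pos.2 hn).ne'

end BeliefSequence

end BeliefSequence

/-! ### Perturbations along which safest policies are indistinguishable to first order. -/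

section Tangent

variable {S A : Type*} [Fintype S] [Fintype A] {R hazard : Set S} {t d : S × A × S → ℝ}
  {π π' : ℕ → S → A}

/-- Perturbations of the rows of `R` outside `hazard` that keep them probability vectors of the same
support, to first order. -/
def IsTangent (R hazard : Set S) (t d : S × A × S → ℝ) : Prop :=
  ∀ i ∈ R, i ∉ hazard → ∀ b, (∀ j, t (i, b, j) = 0 → d (i, b, j) = 0) ∧ ∑ j, d (i, b, j) = 0

/-- Whether a risk is 0 depends only on which transitions are possible, and tangent directions
charge no impossible transition at the relevant rows. -/
theorem riskDiff_eq_zero_of_policyRisk_eq_zero (hs : IsStochastic t)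
    (ht : IsClosedUnder R hazard t) (hd : IsTangent R hazard t d) {k : ℕ} {i : S} (hR : i ∈ R)
    (b : A) (h : policyRisk hazard π t k i b = 0) : riskDiff hazard π t d k i b = 0 := by
  induction k generalizing i b with
  | zero => exact riskDiff_zero
  | succ k ih =>
    by_cases hi : i ∈ hazard
    · exact riskDiff_of_mem hi
    · rw [policyRisk_succ hi, Finset.sum_eq_zero_iff_of_nonneg fun j _ =>
        mul_nonneg (hs.1 _) (policyRisk_nonneg hs _ _ _)] at h
      rw [riskDiff_succ hi, Finset.sum_eq_zero, Finset.sum_eq_zero, add_zero]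
      · intro j _
        by_cases hj : t (i, b, j) = 0
        · rw [hj, zero_mul]
        · rw [ih (ht i hR hi b j hj) _
            ((mul_eq_zero.1 (h j (Finset.mem_univ j))).resolve_left hj), mul_zero]
      · intro j _
        by_cases hj : t (i, b, j) = 0
        · rw [(hd i hR hi b).1 j hj, zero_mul]
        · rw [(mul_eq_zero.1 (h j (Finset.mem_univ j))).resolve_left hj, mul_zero]

/-- Here all possible successors have risk 1, so the first-order change is the total change of the
row, which is 0 for tangent directions. -/
theorem riskDiff_eq_zero_of_policyRisk_eq_one (hs : IsStochastic t)
    (ht : IsClosedUnder R hazard t) (hd : IsTangent R hazard t d) {k : ℕ} {i : S} (hR : i ∈ R)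
    (b : A) (h : policyRisk hazard π t k i b = 1) : riskDiff hazard π t d k i b = 0 := by
  induction k generalizing i b with
  | zero => exact riskDiff_zero
  | succ k ih =>
    by_cases hi : i ∈ hazard
    · exact riskDiff_of_mem hi
    · have h1 : ∑ j, t (i, b, j) * (1 - policyRisk hazard π t k j (π k j)) = 0 := by
        simp_rw [mul_sub, mul_one]
        rw [Finset.sum_sub_distrib, hs.2, ← policyRisk_succ hi, h, sub_self]
      rw [Finset.sum_eq_zero_iff_of_nonneg fun j _ =>
        mul_nonneg (hs.1 _) (sub_nonneg.2 (policyRisk_le_one hs _ _ _))] at h1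
      have h2 : ∀ j, t (i, b, j) ≠ 0 → policyRisk hazard π t k j (π k j) = 1 := fun j hj =>
        (sub_eq_zero.1 ((mul_eq_zero.1 (h1 j (Finset.mem_univ j))).resolve_left hj)).symm
      have h3 : ∑ j, d (i, b, j) * policyRisk hazard π t k j (π k j) = 0 := by
        rw [← (hd i hR hi b).2]
        refine Finset.sum_congr rfl fun j _ => ?_
        by_cases hj : t (i, b, j) = 0
        · rw [(hd i hR hi b).1 j hj, zero_mul]
        · rw [h2 j hj, mul_one]
      rw [riskDiff_succ hi, h3, zero_add]
      refine Finset.sum_eq_zero fun j _ => ?_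
      by_cases hj : t (i, b, j) = 0
      · rw [hj, zero_mul]
      · rw [ih (ht i hR hi b j hj) _ (h2 j hj), mul_zero]

/-- All safest policies have the same risk differential in the tangent directions, if ties occur
only where the risk is `0` or `1`. -/
theorem IsSafestOn.riskDiff_eq [Nonempty A] {m : ℕ} (hπ : IsSafestOn R hazard t m π)
    (hπ' : IsSafestOn R hazard t m π') (hs : IsStochastic t) (ht : IsClosedUnder R hazard t)
    (hties : ∀ k < m, ∀ i ∈ R, i ∉ hazard → ∀ b b',
      (∀ c, estRisk hazard t k i b ≤ estRisk hazard t k i c) →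
      (∀ c, estRisk hazard t k i b' ≤ estRisk hazard t k i c) →
      b = b' ∨ estRisk hazard t k i b = 0 ∨ estRisk hazard t k i b = 1)
    (hd : IsTangent R hazard t d) {k : ℕ} (hk : k ≤ m) {i : S} (hR : i ∈ R) (b : A) :
    riskDiff hazard π t d k i b = riskDiff hazard π' t d k i b := by
  induction k generalizing i b with
  | zero => rw [riskDiff_zero, riskDiff_zero]
  | succ k ih =>
    by_cases hi : i ∈ hazard
    · rw [riskDiff_of_mem hi, riskDiff_of_mem hi]
    · have hkm : k < m := hk
      rw [riskDiff_succ hi, riskDiff_succ hi]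
      have hest : ∀ j ∈ R, estRisk hazard t k j (π k j) = estRisk hazard t k j (π' k j) :=
        fun j hj => le_antisymm (hπ k hkm j hj _) (hπ' k hkm j hj _)
      have h1 : ∀ j ∈ R, policyRisk hazard π t k j (π k j) =
          estRisk hazard t k j (π k j) := fun j hj => hπ.policyRisk_eq ht hkm.le hj _
      have h2 : ∀ j ∈ R, policyRisk hazard π' t k j (π' k j) =
          estRisk hazard t k j (π k j) := fun j hj => by
        rw [hest j hj]
        exact hπ'.policyRisk_eq ht hkm.le hj _
      congr 1
      · refine Finset.sum_congr rfl fun j _ => ?_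
        by_cases hj : t (i, b, j) = 0
        · rw [(hd i hR hi b).1 j hj, zero_mul, zero_mul]
        · rw [h1 j (ht i hR hi b j hj), h2 j (ht i hR hi b j hj)]
      · refine Finset.sum_congr rfl fun j _ => ?_
        by_cases hj : t (i, b, j) = 0
        · rw [hj, zero_mul, zero_mul]
        · have hjR := ht i hR hi b j hj
          congr 1
          by_cases hjh : j ∈ hazard
          · rw [riskDiff_of_mem hjh, riskDiff_of_mem hjh]
          -- Either both policies take the same action and the induction applies, or the common risk
          -- is 0 or 1 and both differentials vanish.
          · rcases hties k hkm j hjR hjh _ _ (hπ k hkm j hjR) (hπ' k hkm j hjR) with h | h | h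
            · rw [h]
              exact ih hkm.le hjR _
            · rw [riskDiff_eq_zero_of_policyRisk_eq_zero hs ht hd hjR _ ((h1 j hjR).trans h),
                riskDiff_eq_zero_of_policyRisk_eq_zero hs ht hd hjR _ ((h2 j hjR).trans h)]
            · rw [riskDiff_eq_zero_of_policyRisk_eq_one hs ht hd hjR _ ((h1 j hjR).trans h),
                riskDiff_eq_zero_of_policyRisk_eq_one hs ht hd hjR _ ((h2 j hjR).trans h)]

/-- The asymptotic variance depends only on the differential of the risk in the tangent
directions. -/
theorem asympVar_congr (hs : IsStochastic t) {m : ℕ} {s : S} {a : A}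
    (h : ∀ d, IsTangent R hazard t d →
      riskDiff hazard π t d m s a = riskDiff hazard π' t d m s a) :
    asympVar R hazard π t m s a = asympVar R hazard π' t m s a := by
  classical
  unfold asympVar
  refine Finset.sum_congr rfl fun i _ => Finset.sum_congr rfl fun b _ => ?_
  split_ifs with hi
  swap
  · rfl
  rw [sum_mul_sq_sub_sq (hs.2 i b), sum_mul_sq_sub_sq (hs.2 i b)]
  refine Finset.sum_congr rfl fun j _ => ?_
  by_cases hj : t (i, b, j) = 0
  · rw [hj, zero_mul, zero_mul]
  congr 2
  -- The direction from row t(i, b, ·) towards the point mass at j; it is tangent because t(i, b, j)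
  -- ≠ 0. The differential along it is the deviation of the j-th partial derivative from the row
  -- mean.
  set d : S × A × S → ℝ := fun x => if x.1 = i ∧ x.2.1 = b then
    (if x.2.2 = j then 1 else 0) - t (i, b, x.2.2) else 0 with hd
  have htan : IsTangent R hazard t d := by
    intro i' _ _ b'
    by_cases hib : i' = i ∧ b' = b
    · obtain ⟨rfl, rfl⟩ := hib
      refine ⟨fun l hl => ?_, ?_⟩
      · have : l ≠ j := fun h => hj (h ▸ hl)
        simp [hd, this, hl]
      · simp [hd, hs.2]
    · simp [hd, hib]
  have hval : ∀ ϖ : ℕ → S → A, riskDiff hazard ϖ t d m s a =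
      riskGrad hazard ϖ t m s a (i, b, j) -
        ∑ l, t (i, b, l) * riskGrad hazard ϖ t m s a (i, b, l) := by
    intro ϖ
    unfold riskDiff
    rw [Fintype.sum_prod_type, Finset.sum_eq_single i, Fintype.sum_prod_type,
      Finset.sum_eq_single b]
    · simp only [hd, and_self, if_true, mul_sub, Finset.sum_sub_distrib]
      congr 1
      · simp
      · exact Finset.sum_congr rfl fun l _ => mul_comm _ _
    · intro b' _ hb'
      simp [hd, hb']
    · simp
    · intro i' _ hi'
      simp [hd, hi']
    · simp
  rw [← hval, ← hval, h d htan]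

theorem exitMass_eq_zero (ht : IsClosedUnder R hazard t) : exitMass R hazard t = 0 :=
  Finset.sum_eq_zero fun y _ => by
    split_ifs with h
    · by_contra hy
      exact h.2.2 (ht y.1 h.1 h.2.1 y.2.1 y.2.2 hy)
    · rfl

/-- The gradient of the risk vanishes off the rows of `R` outside `hazard`. -/
theorem riskGrad_eq_zero (hs : IsStochastic t) (ht : IsClosedUnder R hazard t) (m : ℕ) {s : S}
    (hR : s ∈ R) (a : A) {x : S × A × S} (hx : ¬(x.1 ∈ R ∧ x.1 ∉ hazard)) :
    riskGrad hazard π t m s a x = 0 := by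
  refine le_antisymm ?_ (riskGrad_nonneg hs _ _ _ _)
  have := riskGrad_le_exitMass (π := π) hs hx m hR a
  rwa [exitMass_eq_zero ht, mul_zero] at this

end Tangent

/-! ### Dependence on the first m steps of the policy only. -/

section Truncation

variable {S A : Type*} [Fintype S] (hazard : Set S)

theorem riskPoly_congr {π π' : ℕ → S → A} {m : ℕ} (h : ∀ k < m, π k = π' k) (i : S) (b : A) :
    riskPoly hazard π m i b = riskPoly hazard π' m i b := by
  induction m generalizing i b with
  | zero => rfl
  | succ m ih =>
    unfold riskPoly
    split_ifs
    · rfl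
    · rw [h m m.lt_succ_self]
      exact Finset.sum_congr rfl fun j _ => by rw [ih fun k hk => h k (hk.trans m.lt_succ_self)]

/-- A sequence of policies chosen among those with a property that depends only on the first
`m` steps. -/
theorem tendsto_of_policies [Fintype A] [Nonempty A] {m : ℕ} {p : (ℕ → S → A) → Prop}
    (hp : ∀ π π' : ℕ → S → A, (∀ k < m, π k = π' k) → p π → p π')
    {F : ℕ → (ℕ → S → A) → ℝ} (hF : ∀ n π π', (∀ k < m, π k = π' k) → F n π = F n π')
    {l : ℝ} (hlim : ∀ π, p π → Tendsto (fun n => F n π) atTop (𝓝 l)) {ϖ : ℕ → ℕ → S → A}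
    (hϖ : ∀ᶠ n in atTop, p (ϖ n)) : Tendsto (fun n => F n (ϖ n)) atTop (𝓝 l) := by
  classical
  obtain ⟨c⟩ := ‹Nonempty A›
  -- Policies restricted to the horizon form a finite set, so convergence for each is uniform over
  -- them. The action c beyond the horizon is arbitrary.
  set ext : (Fin m → S → A) → ℕ → S → A :=
    fun f k i => if hk : k < m then f ⟨k, hk⟩ i else c with hext
  have hres : ∀ π : ℕ → S → A, ∀ k < m, π k = ext (fun k => π k) k := fun π k hk => by
    ext i
    simp [hext, hk]
  intro U hU
  have hall : ∀ᶠ n in atTop, ∀ f : Fin m → S → A, p (ext f) → F n (ext f) ∈ U := by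
    refine eventually_all.2 fun f => ?_
    by_cases hf : p (ext f)
    · filter_upwards [hlim _ hf hU] with n hn _ using hn
    · exact Eventually.of_forall fun n h => absurd h hf
  rw [Filter.mem_map]
  filter_upwards [hall, hϖ] with n hn hpn
  change F n (ϖ n) ∈ U
  rw [hF n _ _ (hres (ϖ n))]
  exact hn (fun k => ϖ n k) (hp _ _ (hres (ϖ n)) hpn)

end Truncation

/-! ### Independent transitions: law of large numbers and central limit theorem. -/

section Sample

variable {S A Ω : Type*} [Fintype S]

theorem trueProb_isStochastic (P : S → A → PMF S) : IsStochastic (trueProb P) := by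
  refine ⟨fun x => ENNReal.toReal_nonneg, fun i b => ?_⟩
  have h := (P i b).tsum_coe
  rw [tsum_fintype] at h
  change ∑ j, (P i b j).toReal = 1
  rw [← ENNReal.toReal_sum fun j _ => (P i b).apply_ne_top j, h, ENNReal.toReal_one]

theorem trueProb_isClosedUnder (P : S → A → PMF S) (hazard : Set S) (s : S) :
    IsClosedUnder {i | Reachable P hazard s i} hazard (trueProb P) :=
  fun _ hi hih b _ hj => Relation.ReflTransGen.tail hi
    ⟨hih, b, lt_of_le_of_ne ((trueProb_isStochastic P).1 _) (Ne.symm hj)⟩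

variable [Fintype A] [MeasurableSpace S] [MeasurableSingletonClass S] [MeasurableSpace Ω]

/-- Independent transitions `Y k i b`, those out of `(i, b)` having the law `P i b`. -/
structure IsTransitionSample (P : S → A → PMF S) (Y : ℕ → S → A → Ω → S) (μ : Measure Ω) :
    Prop where
  measurable : ∀ k i b, Measurable (Y k i b)
  law : ∀ k i b, μ.map (Y k i b) = (P i b).toMeasure
  indep : iIndepFun (fun c : ℕ × S × A => Y c.1 c.2.1 c.2.2) μ

/-- The empirical frequencies of the first `n` transitions. -/
def hitFreq (Y : ℕ → S → A → Ω → S) (n : ℕ) (ω : Ω) : S × A × S → ℝ :=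
  fun x => (n : ℝ)⁻¹ * ∑ k ∈ Finset.range n,
    Set.indicator {ω' | Y k x.1 x.2.1 ω' = x.2.2} (fun _ => (1 : ℝ)) ω

variable {P : S → A → PMF S} {Y : ℕ → S → A → Ω → S} {μ : Measure Ω} [IsProbabilityMeasure μ]

namespace IsTransitionSample

variable (hY : IsTransitionSample P Y μ)

include hY

omit [Fintype A] [IsProbabilityMeasure μ] in
theorem integral_comp (k : ℕ) (i : S) (b : A) (f : S → ℝ) :
    ∫ ω, f (Y k i b ω) ∂μ = ∑ j, trueProb P (i, b, j) * f j := by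
  rw [← integral_map (f := f) (hY.measurable k i b).aemeasurable
    (Measurable.of_discrete).aestronglyMeasurable, hY.law, PMF.integral_eq_sum]
  rfl

omit [Fintype A] in
theorem memLp_comp (k : ℕ) (i : S) (b : A) (f : S → ℝ) (r : ENNReal) :
    MemLp (fun ω => f (Y k i b ω)) r μ :=
  MemLp.of_bound ((Measurable.of_discrete (f := f)).comp (hY.measurable k i b)).aestronglyMeasurable
    (∑ j, |f j|) (ae_of_all _ fun _ =>
      Finset.single_le_sum (f := fun j => |f j|) (fun _ _ => abs_nonneg _) (Finset.mem_univ _))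

omit [IsProbabilityMeasure μ] in
-- Impossible transitions almost surely add nothing to the counts; hence the O(1/n) bound on the
-- exit mass.
theorem ae_trueProb_ne_zero : ∀ᵐ ω ∂μ, ∀ k i b, trueProb P (i, b, Y k i b ω) ≠ 0 := by
  refine ae_all_iff.2 fun k => ae_all_iff.2 fun i => ae_all_iff.2 fun b => ?_
  have h : ∀ᵐ j ∂(P i b).toMeasure, trueProb P (i, b, j) ≠ 0 := by
    rw [ae_iff, PMF.toMeasure_apply_eq_zero_iff _ (Set.toFinite _).measurableSet]
    rw [Set.disjoint_left]
    intro j hj hj0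
    simp only [ne_eq, not_not] at hj0
    exact (PMF.mem_support_iff _ _).1 hj
      (((ENNReal.toReal_eq_zero_iff _).1 hj0).resolve_right ((P i b).apply_ne_top j))
  rw [← hY.law k i b] at h
  exact ae_of_ae_map (hY.measurable k i b).aemeasurable h

omit [Fintype S] [Fintype A] [MeasurableSingletonClass S] [IsProbabilityMeasure μ] in
theorem map_block (k : ℕ) : μ.map (fun ω (c : S × A) => Y k c.1 c.2 ω) =
    Measure.infinitePi fun c : S × A => (P c.1 c.2).toMeasure := by
  have h : iIndepFun (fun c : S × A => Y k c.1 c.2) μ :=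
    hY.indep.precomp (g := fun c : S × A => (k, c)) (Prod.mk_right_injective k)
  have h' := h.map_fun_eq_infinitePi_map fun c : S × A => hY.measurable k c.1 c.2
  simp_rw [hY.law] at h'
  exact h'

omit [Fintype S] [Fintype A] [MeasurableSingletonClass S] in
-- With `identDistrib_block`, the vectors of the k-th transitions of all pairs behave as an i.i.d.
-- sequence, so scalar limit theorems apply to any function of them, including sums over several
-- rows.
theorem iIndepFun_block : iIndepFun (fun (k : ℕ) ω (c : S × A) => Y k c.1 c.2 ω) μ := by
  have hm : ∀ k, Measurable fun ω (c : S × A) => Y k c.1 c.2 ω := fun k =>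
    measurable_pi_iff.2 fun c => hY.measurable k c.1 c.2
  rw [iIndepFun_iff_map_fun_eq_infinitePi_map hm]
  have h := hY.indep.map_fun_eq_infinitePi_map fun c : ℕ × S × A => hY.measurable c.1 c.2.1 c.2.2
  simp_rw [hY.law] at h
  simp_rw [hY.map_block]
  rw [← Measure.infinitePi_map_curry (fun (_ : ℕ) (c : S × A) => (P c.1 c.2).toMeasure), ← h,
    Measure.map_map (by fun_prop) (measurable_pi_iff.2 fun c : ℕ × S × A =>
      hY.measurable c.1 c.2.1 c.2.2)]
  rfl

omit [IsProbabilityMeasure μ] in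
theorem identDistrib_block (k : ℕ) (f : (S × A → S) → ℝ) :
    IdentDistrib (fun ω => f fun c => Y k c.1 c.2 ω) (fun ω => f fun c => Y 0 c.1 c.2 ω) μ μ := by
  have hm : ∀ k, Measurable fun ω (c : S × A) => Y k c.1 c.2 ω := fun k =>
    measurable_pi_iff.2 fun c => hY.measurable k c.1 c.2
  exact IdentDistrib.comp (u := f) ⟨(hm k).aemeasurable, (hm 0).aemeasurable, by
    rw [hY.map_block, hY.map_block]⟩ Measurable.of_discrete

theorem indepFun_block_comp (f : (S × A → S) → ℝ) :
    iIndepFun (fun k ω => f fun c => Y k c.1 c.2 ω) μ :=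
  hY.iIndepFun_block.comp (fun _ => f) fun _ => Measurable.of_discrete

theorem tendsto_hitFreq : ∀ᵐ ω ∂μ, ∀ x, Tendsto (fun n => hitFreq Y n ω x) atTop
    (𝓝 (trueProb P x)) := by
  classical
  refine ae_all_iff.2 fun x => ?_
  set f : (S × A → S) → ℝ := fun y => Set.indicator {x.2.2} (fun _ => (1 : ℝ)) (y (x.1, x.2.1))
  have h := strong_law_ae (μ := μ) (fun k ω => f fun c => Y k c.1 c.2 ω)
    ((memLp_one_iff_integrable).1 (hY.memLp_comp 0 x.1 x.2.1 _ 1))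
    (fun k l hkl => (hY.indepFun_block_comp f).indepFun hkl) (fun k => hY.identDistrib_block k f)
  filter_upwards [h] with ω hω
  have hint : ∫ ω, f (fun c => Y 0 c.1 c.2 ω) ∂μ = trueProb P x := by
    refine (hY.integral_comp 0 x.1 x.2.1 (Set.indicator {x.2.2} fun _ => (1 : ℝ))).trans ?_
    simp [Set.indicator_apply]
  rw [hint] at hω
  exact hω

theorem integral_sq_hitFreq_sub_le (x : S × A × S) {n : ℕ} (hn : 0 < n) :
    ∫ ω, (hitFreq Y n ω x - trueProb P x) ^ 2 ∂μ ≤ 1 / n := by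
  classical
  set f : (S × A → S) → ℝ := fun y => Set.indicator {x.2.2} (fun _ => (1 : ℝ)) (y (x.1, x.2.1))
    with hf
  have hL : ∀ k, MemLp (fun ω => f fun c => Y k c.1 c.2 ω) 2 μ := fun k =>
    hY.memLp_comp k x.1 x.2.1 _ 2
  have hn' : (0 : ℝ) < n := Nat.cast_pos.2 hn
  have hint : ∀ k, ∫ ω, f (fun c => Y k c.1 c.2 ω) ∂μ = trueProb P x := fun k => by
    refine (hY.integral_comp k x.1 x.2.1 (Set.indicator {x.2.2} fun _ => (1 : ℝ))).trans ?_
    simp [Set.indicator_apply]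
  have hfreq : ∀ ω, hitFreq Y n ω x =
      (n : ℝ)⁻¹ * (∑ k ∈ Finset.range n, fun ω => f fun c => Y k c.1 c.2 ω) ω := fun ω => by
    rw [Finset.sum_apply]
    rfl
  have hmean : ∫ ω, hitFreq Y n ω x ∂μ = trueProb P x := by
    simp_rw [hfreq, Finset.sum_apply]
    rw [integral_const_mul, integral_finsetSum _ fun k _ => (hL k).integrable one_le_two]
    simp_rw [hint]
    rw [Finset.sum_const, Finset.card_range, nsmul_eq_mul, inv_mul_cancel_left₀ hn'.ne']
  have hmL : MemLp (fun ω => hitFreq Y n ω x) 2 μ := by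
    simp_rw [hfreq, Finset.sum_apply]
    exact (memLp_finsetSum _ fun k _ => hL k).const_mul _
  have hvar : Var[fun ω => hitFreq Y n ω x; μ] =
      ∫ ω, (hitFreq Y n ω x - trueProb P x) ^ 2 ∂μ := by
    rw [variance_eq_integral hmL.aemeasurable, hmean]
  rw [← hvar]
  simp_rw [hfreq]
  rw [variance_const_mul, IndepFun.variance_sum (fun k _ => hL k)
    fun k _ l _ hkl => (hY.indepFun_block_comp f).indepFun hkl]
  have h1 : ∀ k, Var[fun ω => f fun c => Y k c.1 c.2 ω; μ] ≤ 1 := fun k => by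
    refine (variance_le_expectation_sq (hL k).aestronglyMeasurable).trans ?_
    have hb : ∀ y, f y ^ 2 ≤ 1 := fun y => by
      simp only [hf, Set.indicator_apply]
      split_ifs <;> norm_num
    calc _ ≤ ∫ _ω, (1 : ℝ) ∂μ := integral_mono_of_nonneg (ae_of_all _ fun ω => sq_nonneg _)
          (integrable_const _) (ae_of_all _ fun ω => hb fun c => Y k c.1 c.2 ω)
      _ = 1 := by simp
  calc _ ≤ ((n : ℝ)⁻¹) ^ 2 * ∑ _k ∈ Finset.range n, (1 : ℝ) :=
        mul_le_mul_of_nonneg_left (Finset.sum_le_sum fun k _ => h1 k) (sq_nonneg _)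
    _ = 1 / n := by
        simp
        field_simp

/-- The central limit theorem for linear functions of the empirical frequencies. -/
theorem tendstoInDistribution_hitFreq (D : S × A × S → ℝ) {v : ℝ}
    (hv : v = ∑ i, ∑ b, (∑ j, trueProb P (i, b, j) * D (i, b, j) ^ 2 -
      (∑ j, trueProb P (i, b, j) * D (i, b, j)) ^ 2)) (hv0 : 0 ≤ v) :
    TendstoInDistribution
      (fun (n : ℕ) ω => √n * ∑ x, D x * (hitFreq Y n ω x - trueProb P x)) atTop
      (fun z => √v * z) (fun _ => μ) (gaussianReal 0 1) := by
  classical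
  -- One scalar per block, so that the weighted frequencies become an average of i.i.d. variables.
  -- Independence of the rows within a block makes its variance the sum v.
  set f : (S × A → S) → ℝ := fun y => ∑ c : S × A, D (c.1, c.2, y c) with hf
  have hLc : ∀ c : S × A, MemLp (fun ω => D (c.1, c.2, Y 0 c.1 c.2 ω)) 2 μ := fun c =>
    hY.memLp_comp 0 c.1 c.2 (fun j => D (c.1, c.2, j)) 2
  have hL : MemLp (fun ω => f fun c => Y 0 c.1 c.2 ω) 2 μ := memLp_finsetSum _ fun c _ => hLc c
  have hmeanc : ∀ c : S × A, ∫ ω, D (c.1, c.2, Y 0 c.1 c.2 ω) ∂μ =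
      ∑ j, trueProb P (c.1, c.2, j) * D (c.1, c.2, j) := fun c =>
    hY.integral_comp 0 c.1 c.2 fun j => D (c.1, c.2, j)
  have hmean : ∫ ω, f (fun c => Y 0 c.1 c.2 ω) ∂μ = ∑ x, D x * trueProb P x := by
    simp only [hf]
    rw [integral_finsetSum _ fun c _ => (hLc c).integrable one_le_two]
    simp_rw [hmeanc, Fintype.sum_prod_type, mul_comm]
  have hvar : Var[fun ω => f fun c => Y 0 c.1 c.2 ω; μ] = v := by
    have h1 : (fun ω => f fun c => Y 0 c.1 c.2 ω) =
        ∑ c : S × A, fun ω => D (c.1, c.2, Y 0 c.1 c.2 ω) := by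
      ext ω
      simp [hf]
    have hind : iIndepFun (fun (c : S × A) ω => D (c.1, c.2, Y 0 c.1 c.2 ω)) μ :=
      (hY.indep.precomp (g := fun c : S × A => (0, c)) (Prod.mk_right_injective 0)).comp
        (fun c j => D (c.1, c.2, j)) fun c => Measurable.of_discrete
    rw [h1, IndepFun.variance_sum (fun c _ => hLc c) fun c _ c' _ h => hind.indepFun h, hv,
      Fintype.sum_prod_type]
    refine Finset.sum_congr rfl fun i _ => Finset.sum_congr rfl fun b _ => ?_
    rw [variance_eq_sub (hLc (i, b)), hmeanc (i, b)]
    congr 1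
    exact hY.integral_comp 0 i b fun j => D (i, b, j) ^ 2
  have hlaw : HasLaw (fun z => √v * z)
      (gaussianReal 0 Var[fun ω => f fun c => Y 0 c.1 c.2 ω; μ].toNNReal) (gaussianReal 0 1) := by
    rw [hvar]
    have h := gaussianReal_const_mul (X := id) (P := gaussianReal 0 1) HasLaw.id (√v)
    have hvv : v.toNNReal = (.mk (√v ^ 2) (sq_nonneg _) * 1 : NNReal) := by
      ext
      simp [hv0, Real.sq_sqrt hv0]
    rw [hvv]
    simpa using h
  obtain ⟨X, hX⟩ : ∃ X : ℕ → Ω → ℝ, X = fun k ω => f fun c => Y k c.1 c.2 ω := ⟨_, rfl⟩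
  have hX0 : X 0 = fun ω => f fun c => Y 0 c.1 c.2 ω := by rw [hX]
  have hXind : iIndepFun X μ := by
    rw [hX]
    exact hY.indepFun_block_comp f
  have hXid : ∀ k, IdentDistrib (X k) (X 0) μ μ := fun k => by
    rw [hX]
    exact hY.identDistrib_block k f
  rw [← hX0] at hlaw hL hmean
  have h := tendstoInDistribution_inv_sqrt_mul_sum_sub hlaw hL hXind hXid
  convert! h using 3 with n ω
  have hsum : ∑ x, D x * hitFreq Y n ω x =
      (n : ℝ)⁻¹ * ∑ k ∈ Finset.range n, X k ω := by
    simp only [hitFreq, hX, hf, Finset.mul_sum]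
    rw [Finset.sum_comm]
    refine Finset.sum_congr rfl fun k _ => ?_
    simp_rw [Fintype.sum_prod_type]
    refine Finset.sum_congr rfl fun i _ => Finset.sum_congr rfl fun b _ => ?_
    simp [Set.indicator_apply, mul_comm]
  simp_rw [mul_sub, Finset.sum_sub_distrib]
  rw [hsum, hmean]
  rcases Nat.eq_zero_or_pos n with rfl | hn
  · simp
  · have hn' : (0 : ℝ) < n := Nat.cast_pos.2 hn
    have hs : √(n : ℝ) * √(n : ℝ) = n := Real.mul_self_sqrt hn'.le
    have hs0 : √(n : ℝ) ≠ 0 := (Real.sqrt_pos.2 hn').ne'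
    field_simp
    rw [← sq] at hs
    rw [hs]

omit hY in
-- The parameters at stage n are a function of finitely many variables with values in a finite set,
-- so any function of them is measurable. This is what allows an arbitrary tie-breaking rule.
theorem measurable_of_sample (hYm : ∀ k i b, Measurable (Y k i b)) {α : S × A × S → ℝ}
    {visits : S → A → ℕ → ℕ} (F : (S × A × S → ℝ) → ℝ) (n : ℕ) :
    Measurable fun ω => F (posterior α Y visits n ω) := by
  classical
  obtain ⟨N, hle⟩ : ∃ N, ∀ i b, visits i b n ≤ N :=
    ⟨∑ c : S × A, visits c.1 c.2 n, fun i b =>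
      Finset.single_le_sum (f := fun c : S × A => visits c.1 c.2 n) (fun _ _ => Nat.zero_le _)
        (Finset.mem_univ (i, b))⟩
  set G : (Fin N × S × A → S) → S × A × S → ℝ := fun y x => α x +
    ∑ k : Fin N, if (k : ℕ) < visits x.1 x.2.1 n then
      Set.indicator {x.2.2} (fun _ => (1 : ℝ)) (y (k, x.1, x.2.1)) else 0 with hG
  have hpost : ∀ ω, posterior α Y visits n ω = G fun c => Y c.1 c.2.1 c.2.2 ω := fun ω => by
    ext x
    simp only [posterior, hG]
    congr 1
    rw [Fin.sum_univ_eq_sum_range (fun k => if k < visits x.1 x.2.1 n then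
      Set.indicator {x.2.2} (fun _ => (1 : ℝ)) (Y k x.1 x.2.1 ω) else 0) N,
      ← Finset.sum_filter]
    refine Finset.sum_congr ?_ fun k _ => rfl
    ext k
    simp only [Finset.mem_range, Finset.mem_filter]
    exact ⟨fun h => ⟨h.trans_le (hle _ _), h⟩, fun h => h.2⟩
  have h1 : Measurable fun y => F (G y) := Measurable.of_discrete
  have h2 : Measurable fun ω (c : Fin N × S × A) => Y c.1 c.2.1 c.2.2 ω :=
    measurable_pi_iff.2 fun c => hYm _ _ _
  have h3 : (fun ω => F (posterior α Y visits n ω)) =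
      (fun y => F (G y)) ∘ fun ω (c : Fin N × S × A) => Y c.1 c.2.1 c.2.2 ω :=
    funext fun ω => congrArg F (hpost ω)
  rw [h3]
  exact h1.comp h2

end IsTransitionSample

end Sample

/-! ### Posterior means against empirical frequencies. -/

section Data

variable {S A Ω : Type*} [Fintype S] {P : S → A → PMF S} {Y : ℕ → S → A → Ω → S}
  {R hazard : Set S} {α : S × A × S → ℝ} {visits : S → A → ℕ → ℕ} {ω : Ω}

omit [Fintype S] in
theorem nat_mul_hitFreq (Y : ℕ → S → A → Ω → S) (n : ℕ) (ω : Ω) (x : S × A × S) :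
    n * hitFreq Y n ω x = ∑ k ∈ Finset.range n,
      Set.indicator {ω' | Y k x.1 x.2.1 ω' = x.2.2} (fun _ => (1 : ℝ)) ω := by
  unfold hitFreq
  rcases Nat.eq_zero_or_pos n with rfl | hn
  · simp
  · rw [mul_inv_cancel_left₀ (Nat.cast_pos.2 hn).ne']

omit [Fintype S] in
theorem hitFreq_nonneg (Y : ℕ → S → A → Ω → S) (n : ℕ) (ω : Ω) (x : S × A × S) :
    0 ≤ hitFreq Y n ω x :=
  mul_nonneg (inv_nonneg.2 n.cast_nonneg) (Finset.sum_nonneg fun _ _ =>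
    Set.indicator_nonneg (fun _ _ => zero_le_one) _)

theorem nat_mul_sum_hitFreq (Y : ℕ → S → A → Ω → S) (n : ℕ) (ω : Ω) (i : S) (b : A) :
    n * ∑ j, hitFreq Y n ω (i, b, j) = n := by
  classical
  simp_rw [Finset.mul_sum, nat_mul_hitFreq]
  rw [Finset.sum_comm]
  simp [Set.indicator_apply]

theorem sum_hitFreq (Y : ℕ → S → A → Ω → S) {n : ℕ} (hn : 0 < n) (ω : Ω) (i : S) (b : A) :
    ∑ j, hitFreq Y n ω (i, b, j) = 1 :=
  mul_left_cancel₀ (Nat.cast_pos.2 hn).ne' ((nat_mul_sum_hitFreq Y n ω i b).trans (mul_one _).symm)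

omit [Fintype S] in
theorem hitFreq_eq_zero (h : ∀ k i b, trueProb P (i, b, Y k i b ω) ≠ 0) (n : ℕ)
    {x : S × A × S} (hx : trueProb P x = 0) : hitFreq Y n ω x = 0 := by
  unfold hitFreq
  rw [Finset.sum_eq_zero, mul_zero]
  intro k _
  refine Set.indicator_of_notMem (fun hk => h k x.1 x.2.1 ?_) _
  rw [show Y k x.1 x.2.1 ω = x.2.2 from hk]
  exact hx

theorem isTangent_hitFreq (h : ∀ k i b, trueProb P (i, b, Y k i b ω) ≠ 0) {n : ℕ} (hn : 0 < n) :
    IsTangent R hazard (trueProb P) (fun x => hitFreq Y n ω x - trueProb P x) := by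
  refine fun i _ _ b => ⟨fun j hj => ?_, ?_⟩
  · simp only [hitFreq_eq_zero h n hj, hj, sub_zero]
  · rw [Finset.sum_sub_distrib, sum_hitFreq Y hn, (trueProb_isStochastic P).2, sub_self]

omit [Fintype S] in
theorem posterior_pos (hα : ∀ x, 0 < α x) (n : ℕ) (x : S × A × S) :
    0 < posterior α Y visits n ω x :=
  add_pos_of_pos_of_nonneg (hα x) (Finset.sum_nonneg fun _ _ =>
    Set.indicator_nonneg (fun _ _ => zero_le_one) _)

omit [Fintype S] in
theorem posterior_eq {n : ℕ} {i : S} {b : A} (h : visits i b n = n) (j : S) :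
    posterior α Y visits n ω (i, b, j) = α (i, b, j) + n * hitFreq Y n ω (i, b, j) := by
  rw [nat_mul_hitFreq]
  simp only [posterior, h]

theorem sum_posterior {n : ℕ} {i : S} {b : A} (h : visits i b n = n) :
    ∑ j, posterior α Y visits n ω (i, b, j) = ∑ j, α (i, b, j) + n := by
  simp_rw [posterior_eq h, Finset.sum_add_distrib, ← Finset.mul_sum]
  rw [nat_mul_sum_hitFreq]

variable [Fintype A] [Nonempty S]

theorem beliefMean_posterior (hα : ∀ x, 0 < α x) {n : ℕ} {i : S} {b : A} (h : visits i b n = n)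
    (j : S) : beliefMean (posterior α Y visits n ω) (i, b, j) =
      (α (i, b, j) + n * hitFreq Y n ω (i, b, j)) / (∑ l, α (i, b, l) + n) := by
  rw [beliefMean_eq (posterior_pos hα n), sum_posterior h, posterior_eq h]

/-- With c the prior total of the row and f the frequency, the difference is (α - cf)/(c + n), and
its numerator is at most c in absolute value. -/
theorem abs_beliefMean_sub_hitFreq_le (hα : ∀ x, 0 < α x) {n : ℕ} (hn : 0 < n) {i : S} {b : A}
    (h : visits i b n = n) (j : S) :
    |beliefMean (posterior α Y visits n ω) (i, b, j) - hitFreq Y n ω (i, b, j)| ≤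
      (∑ x, α x) / n := by
  have hn' : (0 : ℝ) < n := Nat.cast_pos.2 hn
  rw [beliefMean_posterior hα h]
  set c := ∑ l, α (i, b, l) with hc
  set f := hitFreq Y n ω (i, b, j) with hf
  have hc0 : 0 ≤ c := Finset.sum_nonneg fun _ _ => (hα _).le
  have hαc : α (i, b, j) ≤ c :=
    Finset.single_le_sum (f := fun l => α (i, b, l)) (fun _ _ => (hα _).le) (Finset.mem_univ _)
  have hcT : c ≤ ∑ x, α x := by
    simp_rw [hc, Fintype.sum_prod_type]
    exact (Finset.single_le_sum (f := fun b => ∑ l, α (i, b, l))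
      (fun _ _ => Finset.sum_nonneg fun _ _ => (hα _).le) (Finset.mem_univ b)).trans
      (Finset.single_le_sum (f := fun i => ∑ b, ∑ l, α (i, b, l)) (fun _ _ =>
        Finset.sum_nonneg fun _ _ => Finset.sum_nonneg fun _ _ => (hα _).le) (Finset.mem_univ i))
  have hf0 : 0 ≤ f := hitFreq_nonneg Y n ω _
  have hf1 : f ≤ 1 := by
    rw [← sum_hitFreq Y hn ω i b]
    exact Finset.single_le_sum (f := fun l => hitFreq Y n ω (i, b, l))
      (fun _ _ => hitFreq_nonneg Y n ω _) (Finset.mem_univ j)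
  have hcf : c * f ≤ c := mul_le_of_le_one_right hc0 hf1
  have hcf0 : 0 ≤ c * f := mul_nonneg hc0 hf0
  have h1 : (α (i, b, j) + n * f) / (c + n) - f = (α (i, b, j) - c * f) / (c + n) := by
    field_simp
    ring
  rw [h1, abs_div, abs_of_pos (by linarith : 0 < c + n)]
  refine div_le_div₀ (hc0.trans hcT) ?_ hn' (by linarith)
  exact abs_le.2 ⟨by linarith [(hα (i, b, j)).le], by linarith⟩

/-- The posteriors from data with the right frequencies and supports. -/
theorem beliefSequence_posterior (hα : ∀ x, 0 < α x) (hR : IsClosedUnder R hazard (trueProb P))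
    (hvisits : ∀ i ∈ R, i ∉ hazard → ∀ b n, visits i b n = n)
    (hsupp : ∀ k i b, trueProb P (i, b, Y k i b ω) ≠ 0)
    (hfreq : ∀ x, Tendsto (fun n => hitFreq Y n ω x) atTop (𝓝 (trueProb P x))) :
    BeliefSequence R hazard (fun n => posterior α Y visits n ω) (trueProb P) where
  pos := posterior_pos hα
  total := ⟨fun i b => ∑ j : S, α (i, b, j), fun i b => Finset.sum_nonneg fun _ _ => (hα _).le,
    fun i hi hih b n => sum_posterior (hvisits i hi hih b n)⟩
  exit := ⟨∑ x : S × A × S, α x, Finset.sum_nonneg fun _ _ => (hα _).le, fun n i b j hi hih hj => by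
    rw [posterior_eq (hvisits i hi hih b n),
      hitFreq_eq_zero hsupp n (by_contra fun h => hj (hR i hi hih b j h)), mul_zero, add_zero]
    exact Finset.single_le_sum (f := α) (fun _ _ => (hα _).le) (Finset.mem_univ _)⟩
  rows :=
    { stochastic := fun n => isStochastic_beliefMean (posterior_pos hα n)
      tendsto := fun i hi hih b j => by
        have h0 := tendsto_const_div_atTop_nhds_zero_nat (∑ x, α x)
        have h1 : Tendsto (fun n => beliefMean (posterior α Y visits n ω) (i, b, j) -
            hitFreq Y n ω (i, b, j)) atTop (𝓝 0) := by
          refine squeeze_zero_norm' ?_ h0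
          filter_upwards [eventually_gt_atTop 0] with n hn
          exact abs_beliefMean_sub_hitFreq_le hα hn (hvisits i hi hih b n) j
        simpa using h1.add (hfreq (i, b, j)) }

/-- Uniformly in the policy, the error of the estimated risk of a policy is, up to terms of second
order, a linear function of the errors of the empirical frequencies. -/
theorem exists_abs_policyRisk_sub_le (hα : ∀ x, 0 < α x)
    (hR : IsClosedUnder R hazard (trueProb P))
    (hvisits : ∀ i ∈ R, i ∉ hazard → ∀ b n, visits i b n = n) (Y : ℕ → S → A → Ω → S)
    (m : ℕ) {s : S} (hs : s ∈ R) (a : A) :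
    ∃ K : ℝ, ∀ ω, (∀ k i b, trueProb P (i, b, Y k i b ω) ≠ 0) → ∀ n > 0, ∀ π : ℕ → S → A,
      |policyRisk hazard π (beliefMean (posterior α Y visits n ω)) m s a -
        policyRisk hazard π (trueProb P) m s a -
        riskDiff hazard π (trueProb P) (fun x => hitFreq Y n ω x - trueProb P x) m s a| ≤
      K * (∑ x, (hitFreq Y n ω x - trueProb P x) ^ 2 + 1 / n) := by
  classical
  obtain ⟨C, hC, hrem⟩ := exists_abs_riskRem_le (A := A) R hazard m
  set t := trueProb P with ht
  set T := ∑ x, α x with hT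
  set N : ℝ := (Fintype.card (S × A × S) : ℝ) with hN
  have hT0 : 0 ≤ T := Finset.sum_nonneg fun _ _ => (hα _).le
  -- The terms come from `hdist` (the first two), `hexit` and `hlin`, in this order.
  refine ⟨2 * N * C + 2 * N ^ 2 * T ^ 2 * C + N * T * C + N * (m * T), fun ω hω n hn π => ?_⟩
  have hn' : (0 : ℝ) < n := Nat.cast_pos.2 hn
  have hn1 : (1 : ℝ) ≤ n := Nat.one_le_cast.2 hn
  set f := hitFreq Y n ω with hf
  set p := beliefMean (posterior α Y visits n ω) with hp
  have hst := trueProb_isStochastic P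
  have hpst : IsStochastic p := isStochastic_beliefMean (posterior_pos hα n)
  have hpf : ∀ x : S × A × S, x.1 ∈ R → x.1 ∉ hazard → |p x - f x| ≤ T / n :=
    fun x h1 h2 => abs_beliefMean_sub_hitFreq_le hα hn (hvisits x.1 h1 h2 x.2.1 n) x.2.2
  have hTn : 0 ≤ T / n := by positivity
  set Q := ∑ x, (f x - t x) ^ 2 with hQ
  have hQ0 : 0 ≤ Q := Finset.sum_nonneg fun _ _ => sq_nonneg _
  have hdist : rowDist R hazard p t ^ 2 ≤ 2 * N * Q + 2 * N ^ 2 * T ^ 2 * (1 / n) := by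
    have h1 : rowDist R hazard p t ≤ ∑ x : S × A × S, (|f x - t x| + T / n) := by
      refine Finset.sum_le_sum fun x _ => ?_
      split_ifs with hx
      · have h2 := abs_sub_le (p x) (f x) (t x)
        linarith [hpf x hx.1 hx.2]
      · positivity
    calc _ ≤ (∑ x : S × A × S, (|f x - t x| + T / n)) ^ 2 :=
          pow_le_pow_left₀ rowDist_nonneg h1 2
      _ ≤ N * ∑ x : S × A × S, (|f x - t x| + T / n) ^ 2 := sq_sum_le_card_mul_sum_sq
      _ ≤ N * ∑ x : S × A × S, (2 * (f x - t x) ^ 2 + 2 * (T / n) ^ 2) := by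
          refine mul_le_mul_of_nonneg_left (Finset.sum_le_sum fun x _ => ?_) (by positivity)
          rw [← sq_abs (f x - t x)]
          nlinarith [sq_nonneg (|f x - t x| - T / n)]
      _ = 2 * N * Q + 2 * N ^ 2 * T ^ 2 * (1 / n ^ 2) := by
          rw [Finset.sum_add_distrib, ← Finset.mul_sum, Finset.sum_const, Finset.card_univ,
            nsmul_eq_mul]
          ring
      _ ≤ _ := by
          have : (1 : ℝ) / n ^ 2 ≤ 1 / n :=
            one_div_le_one_div_of_le hn' (by nlinarith)
          gcongr
  have hexit : exitMass R hazard p ≤ N * T * (1 / n) := by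
    calc exitMass R hazard p ≤ ∑ _x : S × A × S, T / n := by
          refine Finset.sum_le_sum fun x _ => ?_
          split_ifs with hx
          · have h1 := hpf x hx.1 hx.2.1
            rw [hf, hitFreq_eq_zero hω n (by_contra fun h =>
              hx.2.2 (hR x.1 hx.1 hx.2.1 x.2.1 x.2.2 h)), sub_zero] at h1
            exact (le_abs_self _).trans h1
          · exact hTn
      _ = _ := by
          rw [Finset.sum_const, Finset.card_univ, nsmul_eq_mul]
          ring
  have hlin : |riskDiff hazard π t (fun x => p x - t x) m s a -
      riskDiff hazard π t (fun x => f x - t x) m s a| ≤ N * (m * T) * (1 / n) := by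
    unfold riskDiff
    rw [← Finset.sum_sub_distrib]
    calc _ ≤ ∑ x, |riskGrad hazard π t m s a x * (p x - t x) -
          riskGrad hazard π t m s a x * (f x - t x)| := Finset.abs_sum_le_sum_abs _ _
      _ ≤ ∑ _x : S × A × S, m * (T / n) := by
          refine Finset.sum_le_sum fun x _ => ?_
          rw [← mul_sub, sub_sub_sub_cancel_right, abs_mul]
          -- Off the learnt rows the posterior mean need not be close to the frequencies, but there
          -- the gradient at t vanishes.
          by_cases hx : x.1 ∈ R ∧ x.1 ∉ hazard
          · exact mul_le_mul (abs_riskGrad_le hst _ _ _ _) (hpf x hx.1 hx.2) (abs_nonneg _)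
              m.cast_nonneg
          · rw [riskGrad_eq_zero hst hR m hs a hx, abs_zero, zero_mul]
            positivity
      _ = _ := by
          rw [Finset.sum_const, Finset.card_univ, nsmul_eq_mul]
          ring
  -- The expansion is about the true array, whose exit mass is 0; only that of the posterior mean
  -- remains.
  have hr := hrem π p t hpst hst s hs a
  rw [exitMass_eq_zero hR, add_zero] at hr
  have hr' : |riskRem hazard π p t m s a| ≤
      C * (2 * N * Q + 2 * N ^ 2 * T ^ 2 * (1 / n) + N * T * (1 / n)) :=
    hr.trans (mul_le_mul_of_nonneg_left (add_le_add hdist hexit) hC)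
  have hsplit : policyRisk hazard π p m s a - policyRisk hazard π t m s a -
      riskDiff hazard π t (fun x => f x - t x) m s a = riskRem hazard π p t m s a +
        (riskDiff hazard π t (fun x => p x - t x) m s a -
          riskDiff hazard π t (fun x => f x - t x) m s a) := by
    unfold riskRem
    ring
  rw [hsplit]
  refine (abs_add_le _ _).trans ((add_le_add hr' hlin).trans ?_)
  have e : (0 : ℝ) ≤ 1 / n := by positivity
  have a1 : 0 ≤ N * C * (1 / n) := by positivity
  have a2 : 0 ≤ N ^ 2 * T ^ 2 * C * Q := by positivity
  have a3 : 0 ≤ N * T * C * Q := by positivity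
  have a4 : 0 ≤ N * (m * T) * Q := by positivity
  linarith

end Data

/-! ### Two criteria for convergence in measure to zero. -/

section Convergence

variable {Ω : Type*} [MeasurableSpace Ω] {μ : Measure Ω} [IsFiniteMeasure μ]

theorem tendstoInMeasure_zero_of_tendsto_integral {G : ℕ → Ω → ℝ} (h0 : ∀ n ω, 0 ≤ G n ω)
    (hint : ∀ n, Integrable (G n) μ) (hlim : Tendsto (fun n => ∫ ω, G n ω ∂μ) atTop (𝓝 0)) :
    TendstoInMeasure μ G atTop 0 := by
  rw [tendstoInMeasure_iff_measureReal_norm]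
  intro ε hε
  have h1 : Tendsto (fun n => (∫ ω, G n ω ∂μ) / ε) atTop (𝓝 0) := by
    simpa using hlim.div_const ε
  refine squeeze_zero (fun n => measureReal_nonneg) (fun n => ?_) h1
  rw [le_div_iff₀' hε]
  simp only [Pi.zero_apply, sub_zero, Real.norm_of_nonneg (h0 n _)]
  exact mul_meas_ge_le_integral_of_nonneg (ae_of_all _ (h0 n)) (hint n) ε

/-- The stage from which the bound holds depends on ω. Passing to subsequences along which G
converges almost surely makes this harmless. -/
theorem tendstoInMeasure_zero_of_eventually_abs_le {F G : ℕ → Ω → ℝ}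
    (hF : ∀ n, AEStronglyMeasurable (F n) μ) (hG : TendstoInMeasure μ G atTop 0)
    (hle : ∀ᵐ ω ∂μ, ∀ᶠ n in atTop, |F n ω| ≤ G n ω) : TendstoInMeasure μ F atTop 0 := by
  rw [exists_seq_tendstoInMeasure_atTop_iff hF]
  intro ns hns
  obtain ⟨ns', hns', hlim⟩ := (hG.comp hns.tendsto_atTop).exists_seq_tendsto_ae
  refine ⟨ns', hns', ?_⟩
  filter_upwards [hlim, hle] with ω h1 h2
  exact squeeze_zero_norm' ((hns.comp hns').tendsto_atTop.eventually h2) h1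

end Convergence

/-! ### Asymptotic normality of the estimated risk. -/

section CentralLimit

variable {S A Ω : Type*} [Fintype S] [Fintype A] [Nonempty S] [MeasurableSpace S]
  [MeasurableSingletonClass S] [MeasurableSpace Ω] {μ : Measure Ω} [IsProbabilityMeasure μ]
  {P : S → A → PMF S} {Y : ℕ → S → A → Ω → S} {R hazard : Set S} {α : S × A × S → ℝ}
  {visits : S → A → ℕ → ℕ}

namespace IsTransitionSample

variable (hY : IsTransitionSample P Y μ)

include hY

omit [Fintype A] [Nonempty S] in
theorem memLp_hitFreq (n : ℕ) (x : S × A × S) : MemLp (fun ω => hitFreq Y n ω x) 2 μ :=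
  (memLp_finsetSum (Finset.range n) fun k _ =>
    hY.memLp_comp k x.1 x.2.1 (Set.indicator {x.2.2} fun _ => (1 : ℝ)) 2).const_mul _

omit [Nonempty S] in
-- The squared errors have mean O(1/n), so the quadratic remainder, multiplied by √n, is O(1/√n) in
-- mean.
theorem tendstoInMeasure_sqrt_mul_sum_sq (K : ℝ) (hK : 0 ≤ K) :
    TendstoInMeasure μ (fun (n : ℕ) ω => √n * (K *
      (∑ x, (hitFreq Y n ω x - trueProb P x) ^ 2 + 1 / n))) atTop 0 := by
  set N : ℝ := (Fintype.card (S × A × S) : ℝ) with hN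
  have hi : ∀ n x, Integrable (fun ω => (hitFreq Y n ω x - trueProb P x) ^ 2) μ := fun n x =>
    ((hY.memLp_hitFreq n x).sub (memLp_const _)).integrable_sq
  have hi' : ∀ n : ℕ, Integrable (fun ω =>
      ∑ x, (hitFreq Y n ω x - trueProb P x) ^ 2) μ := fun n =>
    integrable_finsetSum _ fun x _ => hi n x
  have h0 : ∀ (n : ℕ) ω, 0 ≤ √n * (K * (∑ x, (hitFreq Y n ω x - trueProb P x) ^ 2 + 1 / n)) :=
    fun n ω => by positivity
  refine tendstoInMeasure_zero_of_tendsto_integral h0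
    (fun n => (((hi' n).add (integrable_const _)).const_mul K).const_mul _) ?_
  have hlim : Tendsto (fun n : ℕ => K * (N + 1) * (√n)⁻¹) atTop (𝓝 0) := by
    have h1 : Tendsto (fun n : ℕ => √(n : ℝ)) atTop atTop :=
      Real.tendsto_sqrt_atTop.comp tendsto_natCast_atTop_atTop
    simpa using h1.inv_tendsto_atTop.const_mul (K * (N + 1))
  refine squeeze_zero' (Eventually.of_forall fun n => integral_nonneg (h0 n)) ?_ hlim
  filter_upwards [eventually_gt_atTop 0] with n hn
  have hn' : (0 : ℝ) < n := Nat.cast_pos.2 hn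
  rw [integral_const_mul, integral_const_mul, integral_add (hi' n) (integrable_const _),
    integral_finsetSum _ fun x _ => hi n x, integral_const]
  have h1 : ∑ x, ∫ ω, (hitFreq Y n ω x - trueProb P x) ^ 2 ∂μ ≤ N * (1 / n) := by
    calc _ ≤ ∑ _x : S × A × S, (1 : ℝ) / n :=
          Finset.sum_le_sum fun x _ => hY.integral_sq_hitFreq_sub_le x hn
      _ = _ := by rw [Finset.sum_const, Finset.card_univ, nsmul_eq_mul]
  have hs : 0 < √(n : ℝ) := Real.sqrt_pos.2 hn'
  have hss : √(n : ℝ) * √(n : ℝ) = n := Real.mul_self_sqrt hn'.le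
  calc _ ≤ √n * (K * (N * (1 / n) + 1 / n)) := by
        simp only [probReal_univ, one_smul]
        gcongr
    _ = K * (N + 1) * (√n * (1 / (√n * √n))) := by
        rw [hss]
        ring
    _ = _ := by
        field_simp

/-- The central limit theorem for the error of the estimated risk of policies that depend on the
posterior and have eventually the same first-order behaviour as a given policy. -/
theorem tendstoInDistribution_policyRisk (hα : ∀ x, 0 < α x)
    (hR : IsClosedUnder R hazard (trueProb P))
    (hvisits : ∀ i ∈ R, i ∉ hazard → ∀ b n, visits i b n = n) {m : ℕ} {s : S} (hs : s ∈ R) {a : A}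
    {π : ℕ → S → A} (hpos : 0 < asympVar R hazard π (trueProb P) m s a)
    {ϖ : (S × A × S → ℝ) → ℕ → S → A}
    (hϖ : ∀ᵐ ω ∂μ, ∀ᶠ n in atTop, ∀ d, IsTangent R hazard (trueProb P) d →
      riskDiff hazard (ϖ (posterior α Y visits n ω)) (trueProb P) d m s a =
        riskDiff hazard π (trueProb P) d m s a) :
    TendstoInDistribution (fun n ω =>
      (policyRisk hazard (ϖ (posterior α Y visits n ω)) (beliefMean (posterior α Y visits n ω))
          m s a -
        policyRisk hazard (ϖ (posterior α Y visits n ω)) (trueProb P) m s a) /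
      √(approxVar (riskPoly hazard (ϖ (posterior α Y visits n ω)) m s a)
        (posterior α Y visits n ω))) atTop id (fun _ => μ) (gaussianReal 0 1) := by
  classical
  have : Nonempty A := ⟨a⟩
  set t := trueProb P with ht
  have hst : IsStochastic t := trueProb_isStochastic P
  set v := asympVar R hazard π t m s a with hv
  set Δ : (S × A × S → ℝ) → ℝ := fun β =>
    policyRisk hazard (ϖ β) (beliefMean β) m s a - policyRisk hazard (ϖ β) t m s a with hΔ
  set V : (S × A × S → ℝ) → ℝ := fun β =>
    approxVar (riskPoly hazard (ϖ β) m s a) β with hV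
  obtain ⟨K, hK⟩ := exists_abs_policyRisk_sub_le hα hR hvisits Y m hs a
  have hmeas : ∀ (F : (S × A × S → ℝ) → ℝ) n,
      Measurable fun ω => F (posterior α Y visits n ω) := fun F n =>
    measurable_of_sample hY.measurable F n
  -- The gradient vanishes off the learnt rows, so the frequencies of n transitions may be used for
  -- every row, whatever the actual number of visits.
  have hlin := hY.tendstoInDistribution_hitFreq (riskGrad hazard π t m s a) (v := v) (by
    rw [hv]
    unfold asympVar
    refine Finset.sum_congr rfl fun i _ => Finset.sum_congr rfl fun b _ => ?_
    split_ifs with hi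
    · rfl
    · have h0 : ∀ j, riskGrad hazard π t m s a (i, b, j) = 0 := fun j =>
        riskGrad_eq_zero hst hR m hs a hi
      simp [h0]) hpos.le
  have hscaled : TendstoInDistribution
      (fun (n : ℕ) ω => √n * Δ (posterior α Y visits n ω)) atTop (fun z => √v * z) (fun _ => μ)
      (gaussianReal 0 1) := by
    refine tendstoInDistribution_of_tendstoInMeasure_sub _ _ hlin ?_
      fun n => (hmeas (fun β => √n * Δ β) n).aemeasurable
    refine tendstoInMeasure_zero_of_eventually_abs_le (fun n => AEMeasurable.aestronglyMeasurable
      ((hmeas (fun β => √n * Δ β) n).aemeasurable.sub (hlin.forall_aemeasurable n)))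
      (hY.tendstoInMeasure_sqrt_mul_sum_sq |K| (abs_nonneg K)) ?_
    filter_upwards [hY.ae_trueProb_ne_zero, hϖ] with ω hω hωϖ
    filter_upwards [hωϖ, eventually_gt_atTop 0] with n hn hn0
    have h1 := hK ω hω n hn0 (ϖ (posterior α Y visits n ω))
    -- The error of the frequencies is a tangent direction, so the differential of the policy in use
    -- may be replaced by that of π.
    rw [hn _ (isTangent_hitFreq hω hn0)] at h1
    simp only [Pi.sub_apply]
    rw [← mul_sub, abs_mul, abs_of_nonneg (Real.sqrt_nonneg _)]
    refine mul_le_mul_of_nonneg_left (h1.trans ?_) (Real.sqrt_nonneg _)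
    exact mul_le_mul_of_nonneg_right (le_abs_self K) (by positivity)
  have hvar : ∀ᵐ ω ∂μ, Tendsto (fun n : ℕ => (√(n * V (posterior α Y visits n ω)))⁻¹) atTop
      (𝓝 (√v)⁻¹) := by
    filter_upwards [hY.ae_trueProb_ne_zero, hY.tendsto_hitFreq, hϖ] with ω hω hωf hωϖ
    have hB := beliefSequence_posterior hα hR hvisits hω hωf
    refine (Tendsto.sqrt ?_).inv₀ (Real.sqrt_pos.2 hpos).ne'
    refine tendsto_of_policies (m := m) (p := fun π' => ∀ d, IsTangent R hazard t d →
        riskDiff hazard π' t d m s a = riskDiff hazard π t d m s a)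
      (F := fun n π' => n * approxVar (riskPoly hazard π' m s a) (posterior α Y visits n ω))
      (fun π₁ π₂ h h1 d hd => ?_) (fun n π₁ π₂ h => ?_) (fun π' h => ?_) hωϖ
    · rw [← h1 d hd]
      unfold riskDiff riskGrad
      rw [riskPoly_congr hazard h]
    · rw [riskPoly_congr hazard h]
    · rw [hv, ← asympVar_congr hst h]
      exact hB.tendsto_mul_approxVar hR π' m hs a
  -- Slutsky: the scaled error is multiplied by 1/√(nV), which tends almost surely to the constant
  -- 1/√v.
  have hprod := hscaled.continuous_comp_prodMk_of_tendstoInMeasure_const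
    (g := fun x : ℝ × ℝ => x.1 * x.2) (by fun_prop)
    (tendstoInMeasure_of_tendsto_ae (fun n : ℕ =>
      (hmeas (fun β => (√(n * V β))⁻¹) n).aestronglyMeasurable) hvar)
    fun n => (hmeas (fun β => (√(n * V β))⁻¹) n).aemeasurable
  have hid : (fun z : ℝ => √v * z * (√v)⁻¹) = id := by
    ext z
    have := (Real.sqrt_pos.2 hpos).ne'
    simp only [id]
    field_simp
  simp only [hid] at hprod
  refine tendstoInDistribution_of_tendstoInMeasure_sub _ _ hprod ?_
    fun n => (hmeas (fun β => Δ β / √(V β)) n).aemeasurable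
  refine tendstoInMeasure_of_tendsto_ae (fun n => AEMeasurable.aestronglyMeasurable
    ((hmeas (fun β => Δ β / √(V β)) n).aemeasurable.sub (hprod.forall_aemeasurable n)))
    (ae_of_all _ fun ω => tendsto_const_nhds.congr' ?_)
  -- The factors √n cancel only for n > 0.
  filter_upwards [eventually_gt_atTop 0] with n hn
  have hn' : (0 : ℝ) < n := Nat.cast_pos.2 hn
  have hs0 : √(n : ℝ) ≠ 0 := (Real.sqrt_pos.2 hn').ne'
  simp only [Pi.sub_apply, Pi.zero_apply]
  rw [Real.sqrt_mul hn'.le, mul_inv, eq_comm, sub_eq_zero, div_eq_mul_inv]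
  field_simp
  rfl

end IsTransitionSample

end CentralLimit

end

end CautiousRL

/-! ### The theorem. -/

theorem theorem1 {S A Ω : Type*} [Fintype S] [Fintype A] [Nonempty A]
    [MeasurableSpace S] [MeasurableSingletonClass S]
    [MeasurableSpace Ω] (μ : Measure Ω) [IsProbabilityMeasure μ]
    (P : S → A → PMF S) (hazard : Set S) (m : ℕ) (s : S) (a : A)
    (α : S × A × S → ℝ) (hα : ∀ x, 0 < α x)
    (Y : ℕ → S → A → Ω → S)
    (hY : ∀ k i b, Measurable (Y k i b))
    (hYlaw : ∀ k i b, μ.map (Y k i b) = (P i b).toMeasure)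
    (hYindep : iIndepFun (fun c : ℕ × S × A => Y c.1 c.2.1 c.2.2) μ)
    (visits : S → A → ℕ → ℕ)
    (hvisits : ∀ i, Reachable P hazard s i → i ∉ hazard →
      ∀ b n, visits i b n = n) :
    -- the polynomial of a fixed policy
    (∀ π : ℕ → S → A,
      (∀ᵐ ω ∂μ, Tendsto
        (fun n => MvPolynomial.eval
          (beliefMean (posterior α Y visits n ω))
          (riskPoly hazard π m s a))
        atTop
        (𝓝 (MvPolynomial.eval (trueProb P) (riskPoly hazard π m s a)))) ∧
      (IsSafest hazard (trueProb P) π →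
        MvPolynomial.eval (trueProb P) (riskPoly hazard π m s a) ≠ 0 →
        MvPolynomial.eval (trueProb P) (riskPoly hazard π m s a) ≠ 1 →
        (∀ᵐ ω ∂μ, Tendsto
          (fun n =>
            Var[fun p => MvPolynomial.eval p (riskPoly hazard π m s a);
              belief (posterior α Y visits n ω)] /
            approxVar (riskPoly hazard π m s a)
              (posterior α Y visits n ω))
          atTop (𝓝 1)) ∧
        TendstoInDistribution
          (fun n ω =>
            (MvPolynomial.eval (beliefMean (posterior α Y visits n ω))
                (riskPoly hazard π m s a) -
              MvPolynomial.eval (trueProb P) (riskPoly hazard π m s a)) /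
            √(approxVar (riskPoly hazard π m s a)
              (posterior α Y visits n ω)))
          atTop id (fun _ => μ) (gaussianReal 0 1))) ∧
    -- the policy is recomputed from the posterior means at each stage
    (∀ sel : (S × A × S → ℝ) → ℕ → S → A, (∀ q, IsSafest hazard q (sel q)) →
      (∀ᵐ ω ∂μ,
        Tendsto
          (fun n => estRisk hazard
            (beliefMean (posterior α Y visits n ω)) m s a)
          atTop (𝓝 (estRisk hazard (trueProb P) m s a)) ∧
        Tendsto
          (fun n => MvPolynomial.eval (trueProb P)
            (riskPoly hazard
              (sel (beliefMean (posterior α Y visits n ω))) m s a))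
          atTop (𝓝 (estRisk hazard (trueProb P) m s a))) ∧
      (estRisk hazard (trueProb P) m s a ≠ 0 →
        estRisk hazard (trueProb P) m s a ≠ 1 →
        (∀ᵐ ω ∂μ, Tendsto
          (fun n =>
            Var[fun p => MvPolynomial.eval p
                (riskPoly hazard
                  (sel (beliefMean (posterior α Y visits n ω))) m s a);
              belief (posterior α Y visits n ω)] /
            approxVar
              (riskPoly hazard
                (sel (beliefMean (posterior α Y visits n ω))) m s a)
              (posterior α Y visits n ω))
          atTop (𝓝 1)) ∧
        (NoRelevantTies P hazard s m →
          TendstoInDistribution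
            (fun n ω =>
              (estRisk hazard
                  (beliefMean (posterior α Y visits n ω)) m s a -
                MvPolynomial.eval (trueProb P)
                  (riskPoly hazard
                    (sel (beliefMean (posterior α Y visits n ω))) m s a)) /
              √(approxVar
                (riskPoly hazard
                  (sel (beliefMean (posterior α Y visits n ω))) m s a)
                (posterior α Y visits n ω)))
            atTop id (fun _ => μ) (gaussianReal 0 1)))) := by
  have : Nonempty S := ⟨s⟩
  have hYs : IsTransitionSample P Y μ := ⟨hY, hYlaw, hYindep⟩
  have hst := trueProb_isStochastic P
  set R : Set S := {i | Reachable P hazard s i} with hRdef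
  have hR : IsClosedUnder R hazard (trueProb P) := trueProb_isClosedUnder P hazard s
  have hs : s ∈ R := Relation.ReflTransGen.refl
  have hB : ∀ᵐ ω ∂μ, BeliefSequence R hazard (fun n => posterior α Y visits n ω) (trueProb P) := by
    filter_upwards [hYs.ae_trueProb_ne_zero, hYs.tendsto_hitFreq] with ω h1 h2
    exact beliefSequence_posterior hα hR hvisits h1 h2
  refine ⟨fun π => ⟨?_, fun hπ h0 h1 => ⟨?_, ?_⟩⟩, fun sel hsel => ⟨?_, fun h0 h1 => ⟨?_, ?_⟩⟩⟩
  · filter_upwards [hB] with ω hω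
    exact hω.rows.policyRisk hR m hs a
  · have hpos := (hπ.isSafestOn R m).asympVar_pos hst hR hs a h0 h1
    filter_upwards [hB] with ω hω
    exact hω.tendsto_variance_div_approxVar hR π m hs a hpos
  · have hpos := (hπ.isSafestOn R m).asympVar_pos hst hR hs a h0 h1
    exact hYs.tendstoInDistribution_policyRisk hα hR hvisits hs hpos (ϖ := fun _ => π)
      (ae_of_all _ fun _ => Eventually.of_forall fun _ _ _ => rfl)
  · filter_upwards [hB] with ω hω
    refine ⟨hω.rows.estRisk hR m hs a, tendsto_const_nhds.congr' ?_⟩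
    filter_upwards [hω.rows.eventually_isSafestOn hR m fun n => hsel _] with n hn
    exact (hn.policyRisk_eq hR le_rfl hs a).symm
  · filter_upwards [hB] with ω hω
    -- Safest policies may differ in their limiting variances, but for each of them the ratio tends
    -- to 1, so no assumption on ties is needed here.
    refine tendsto_of_policies (m := m) (p := IsSafestOn R hazard (trueProb P) m)
      (F := fun n π => Var[fun p => MvPolynomial.eval p (riskPoly hazard π m s a);
          belief (posterior α Y visits n ω)] /
        approxVar (riskPoly hazard π m s a) (posterior α Y visits n ω))
      (fun π π' h hπ k hk i hi b => ?_) (fun n π π' h => ?_) (fun π hπ => ?_)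
      (hω.rows.eventually_isSafestOn hR m fun n => hsel _)
    · rw [← h k hk]
      exact hπ k hk i hi b
    · simp only [riskPoly_congr hazard h]
    · have hrisk := hπ.policyRisk_eq hR le_rfl hs a
      exact hω.tendsto_variance_div_approxVar hR π m hs a
        (hπ.asympVar_pos hst hR hs a (by rwa [hrisk]) (by rwa [hrisk]))
  · intro hties
    -- The policy selected for the true array serves as reference. The recomputed policies are
    -- eventually safest on R and so share its differential.
    have hπ := (hsel (trueProb P)).isSafestOn R m
    have hrisk := hπ.policyRisk_eq hR le_rfl hs a
    have hpos := hπ.asympVar_pos hst hR hs a (by rwa [hrisk]) (by rwa [hrisk])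
    have hclt := hYs.tendstoInDistribution_policyRisk hα hR hvisits hs hpos
      (ϖ := fun β => sel (beliefMean β)) (by
        filter_upwards [hB] with ω hω
        filter_upwards [hω.rows.eventually_isSafestOn hR m fun n => hsel _] with n hn d hd
        exact hn.riskDiff_eq hπ hst hR hties hd le_rfl hs a)
    simp_rw [← eval_riskPoly_of_isSafest hazard _ _ (hsel _)]
    exact hclt
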